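/- Computations are performed on a deterministic random access machine with uniform cost measure, whose arithmetic operations are addition, truncated subtraction and halving (rounded down) on natural numbers, and which has registers and indirectly addressed memory arrays, initially zero; programs are built from elementary instructions by sequencing, branching and while loops, and each elementary instruction and each evaluation of a condition takes one step. An input graph on the vertex set $\{0,\dots,n-1\}$ is given by its adjacency matrix and the vector of its vertex weights in $\mathbb N$, one entry of which can be read per step; numerical arguments are given in registers; a set of vertices is output as an indicator vector. A class of finite graphs (closed under isomorphism) is hereditary if every induced subgraph of a graph in the class belongs to the class. There is an absolute constant $K\in\mathbb N$ such that the following holds. Let $\mathcal C$ be a hereditary graph class, and let $t\colon\mathbb N\times\mathbb N\to\mathbb N$ be nondecreasing in both arguments. Suppose that there is a program that, given an $n$-vertex graph $G\in\mathcal C$ with vertex weights $w\colon V(G)\to\mathbb N$ and a number $\ell\in\mathbb N$, computes a maximum-weight independent set of $G$ among those of size at most $\ell$, and that halts within $t(\ell,n)$ steps whenever $n,\ell\ge 1$. Then there is a program that, given an $n$-vertex graph $G\in\mathcal C$ with vertex weights $w\colon V(G)\to\mathbb N$ and numbers $\ell,c\in\mathbb N$, computes a vertex set $S$ of maximum weight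 among all sets $S\subseteq V(G)$ with $|S|\le\ell$ for which the induced subgraph $G[S]$ is $c$-colorable, and that, whenever $n\ge 2$ and $\ell,c\ge 1$, halts within $$K\cdot 2^{\ell+c}\cdot c^{\ell}\cdot \ell^{K\log\ell}\cdot(\log n)^2\cdot t(\ell,n)$$ steps, that is, in $2^{\ell+c}\,c^{\ell}\,\ell^{O(\log \ell)}\log^2 n\cdot t(\ell,n)$ time. -/

import Mathlib

/-! ### Random access machines

The machine is a random access machine under the uniform cost measure, whose arithmetic operations
are addition, truncated subtraction and halving. It has registers `0, 1, 2, …` and memory arrays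
`0, 1, 2, …` with cells `0, 1, 2, …`, all holding natural numbers (a program names only finitely
many registers and arrays). The input graph on `{0, …, n - 1}` is given by its adjacency matrix
and its vector of vertex weights, both read-only, one entry being readable per step. -/

namespace RAM

/-- Structured programs. `x`, `y`, `z` are registers, `a` is an array, `k` is a constant. -/
inductive Prog : Type
  /-- `x := k` -/
  | const (x k : ℕ)
  /-- `x := y + z` -/
  | add (x y z : ℕ)
  /-- `x := y - z`, or `0` if `y < z` -/
  | sub (x y z : ℕ)
  /-- `x := ⌊y / 2⌋` -/
  | half (x y : ℕ)
  /-- `x := a[y]` -/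
  | load (x a y : ℕ)
  /-- `a[x] := y` -/
  | store (a x y : ℕ)
  /-- `x :=` the weight of vertex `y` of the input graph -/
  | weight (x y : ℕ)
  /-- `x := 1` if the vertices `y` and `z` of the input graph are adjacent, and `x := 0` if not -/
  | adj (x y z : ℕ)
  /-- `p` and then `q` -/
  | seq (p q : Prog)
  /-- if `x ≠ 0` then `p` else `q` -/
  | ite (x : ℕ) (p q : Prog)
  /-- while `x ≠ 0` do `p` -/
  | loop (x : ℕ) (p : Prog)

/-- The contents of the registers and of the arrays. -/
@[ext] structure State where
  reg : ℕ → ℕ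
  arr : ℕ → ℕ → ℕ

namespace State

/-- Write the value `v` into register `x`. -/
def setReg (s : State) (x v : ℕ) : State :=
  { s with reg := Function.update s.reg x v }

/-- Write the value `v` into cell `i` of array `a`. -/
def setArr (s : State) (a i v : ℕ) : State :=
  { s with arr := Function.update s.arr a (Function.update (s.arr a) i v) }

/-- The initial state: the arguments are in registers `0, 1, …`; everything else is zero. -/
def init (args : List ℕ) : State where
  reg x := args.getD x 0
  arr _ _ := 0

/-- The output of a final state, a set of vertices given by its indicator vector in array `0`. -/
def output (n : ℕ) (s : State) : Finset (Fin n) :=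
  Finset.univ.filter fun v => s.arr 0 v ≠ 0

end State

/-- The entry of the weight vector at `i` (zero if there is no vertex `i`). -/
def weightEntry {n : ℕ} (w : Fin n → ℕ) (i : ℕ) : ℕ :=
  if h : i < n then w ⟨i, h⟩ else 0

open Classical in
/-- The entry of the adjacency matrix at `i`, `j` (zero if there is no vertex `i` or `j`). -/
noncomputable def adjEntry {n : ℕ} (G : SimpleGraph (Fin n)) (i j : ℕ) : ℕ :=
  if ∃ (hi : i < n) (hj : j < n), G.Adj ⟨i, hi⟩ ⟨j, hj⟩ then 1 else 0

/-- `Exec G w p s s' k`: on the input graph `G` with vertex weights `w`, the program `p`, started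
in state `s`, halts in state `s'` after exactly `k` steps. Every elementary instruction and every
evaluation of the condition of an `ite` or a `loop` is one step. -/
inductive Exec {n : ℕ} (G : SimpleGraph (Fin n)) (w : Fin n → ℕ) :
    Prog → State → State → ℕ → Prop
  | const (s : State) (x k : ℕ) : Exec G w (.const x k) s (s.setReg x k) 1
  | add (s : State) (x y z : ℕ) :
      Exec G w (.add x y z) s (s.setReg x (s.reg y + s.reg z)) 1
  | sub (s : State) (x y z : ℕ) :
      Exec G w (.sub x y z) s (s.setReg x (s.reg y - s.reg z)) 1
  | half (s : State) (x y : ℕ) : Exec G w (.half x y) s (s.setReg x (s.reg y / 2)) 1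
  | load (s : State) (x a y : ℕ) :
      Exec G w (.load x a y) s (s.setReg x (s.arr a (s.reg y))) 1
  | store (s : State) (a x y : ℕ) :
      Exec G w (.store a x y) s (s.setArr a (s.reg x) (s.reg y)) 1
  | weight (s : State) (x y : ℕ) :
      Exec G w (.weight x y) s (s.setReg x (weightEntry w (s.reg y))) 1
  | adj (s : State) (x y z : ℕ) :
      Exec G w (.adj x y z) s (s.setReg x (adjEntry G (s.reg y) (s.reg z))) 1
  | seq {p q : Prog} {s₁ s₂ s₃ : State} {k₁ k₂ : ℕ} :
      Exec G w p s₁ s₂ k₁ → Exec G w q s₂ s₃ k₂ → Exec G w (.seq p q) s₁ s₃ (k₁ + k₂)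
  | ite_true {x : ℕ} {p q : Prog} {s s' : State} {k : ℕ} :
      s.reg x ≠ 0 → Exec G w p s s' k → Exec G w (.ite x p q) s s' (k + 1)
  | ite_false {x : ℕ} {p q : Prog} {s s' : State} {k : ℕ} :
      s.reg x = 0 → Exec G w q s s' k → Exec G w (.ite x p q) s s' (k + 1)
  | loop_stop {x : ℕ} {p : Prog} {s : State} :
      s.reg x = 0 → Exec G w (.loop x p) s s 1
  | loop_step {x : ℕ} {p : Prog} {s₁ s₂ s₃ : State} {k₁ k₂ : ℕ} :
      s₁.reg x ≠ 0 → Exec G w p s₁ s₂ k₁ → Exec G w (.loop x p) s₂ s₃ k₂ →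
      Exec G w (.loop x p) s₁ s₃ (k₁ + k₂ + 1)

/-- The machine is deterministic: the final state and the number of steps are unique. -/
theorem Exec.unique {n : ℕ} {G : SimpleGraph (Fin n)} {w : Fin n → ℕ} {p : Prog}
    {s s₁ s₂ : State} {k₁ k₂ : ℕ} (h₁ : Exec G w p s s₁ k₁) (h₂ : Exec G w p s s₂ k₂) :
    s₁ = s₂ ∧ k₁ = k₂ := by
  induction h₁ generalizing s₂ k₂ with
  | seq _ _ ih₁ ih₂ =>
    cases h₂ with
    | seq a b =>
      obtain ⟨rfl, rfl⟩ := ih₁ a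
      obtain ⟨rfl, rfl⟩ := ih₂ b
      exact ⟨rfl, rfl⟩
  | ite_true h _ ih =>
    cases h₂ with
    | ite_true _ a => obtain ⟨rfl, rfl⟩ := ih a; exact ⟨rfl, rfl⟩
    | ite_false h' _ => exact absurd h' h
  | ite_false h _ ih =>
    cases h₂ with
    | ite_true h' _ => exact absurd h h'
    | ite_false _ a => obtain ⟨rfl, rfl⟩ := ih a; exact ⟨rfl, rfl⟩
  | loop_stop h =>
    cases h₂ with
    | loop_stop _ => exact ⟨rfl, rfl⟩
    | loop_step h' _ _ => exact absurd h h'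
  | loop_step h _ _ ih₁ ih₂ =>
    cases h₂ with
    | loop_stop h' => exact absurd h' h
    | loop_step _ a b =>
      obtain ⟨rfl, rfl⟩ := ih₁ a
      obtain ⟨rfl, rfl⟩ := ih₂ b
      exact ⟨rfl, rfl⟩
  | _ => cases h₂; exact ⟨rfl, rfl⟩

/-- On the input graph `G` with vertex weights `w` and the given numerical arguments, the program
`p` halts after exactly `k` steps with output `S`. -/
def Prog.Outputs (p : Prog) {n : ℕ} (G : SimpleGraph (Fin n)) (w : Fin n → ℕ) (args : List ℕ)
    (S : Finset (Fin n)) (k : ℕ) : Prop :=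
  ∃ s : State, Exec G w p (State.init args) s k ∧ s.output n = S

end RAM

/-! ### Graph classes and the two optimization problems -/

/-- A class of finite graphs, closed under isomorphism. -/
structure GraphClass where
  Mem : ∀ {V : Type} [Finite V], SimpleGraph V → Prop
  iso : ∀ {V W : Type} [Finite V] [Finite W] {G : SimpleGraph V} {H : SimpleGraph W},
    Nonempty (G ≃g H) → Mem G → Mem H

/-- Every induced subgraph of a graph in the class belongs to the class. -/
def GraphClass.IsHereditary (C : GraphClass) : Prop :=
  ∀ {V : Type} [Finite V] (G : SimpleGraph V) (S : Set V), C.Mem G → C.Mem (G.induce S)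

/-- `S` is a set of maximum weight among the sets of vertices with property `P`. -/
def IsMaxWeight {V : Type} (w : V → ℕ) (P : Finset V → Prop) (S : Finset V) : Prop :=
  P S ∧ ∀ T : Finset V, P T → ∑ v ∈ T, w v ≤ ∑ v ∈ S, w v

/-- `S` is a maximum-weight independent set of size at most `ℓ`. -/
def IsMaxWeightIndepSet {V : Type} (G : SimpleGraph V) (w : V → ℕ) (ℓ : ℕ) (S : Finset V) : Prop :=
  IsMaxWeight w (fun T => T.card ≤ ℓ ∧ G.IsIndepSet (T : Set V)) S

/-- `S` induces a maximum-weight `c`-colorable subgraph with at most `ℓ` vertices. -/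
def IsMaxWeightColorable {V : Type} (G : SimpleGraph V) (w : V → ℕ) (c ℓ : ℕ) (S : Finset V) :
    Prop :=
  IsMaxWeight w (fun T => T.card ≤ ℓ ∧ (G.induce (T : Set V)).Colorable c) S

/-- The program `p` computes, from a graph in `C` with vertex weights and from `ℓ`, a
maximum-weight independent set of size at most `ℓ`, in at most `t ℓ n` steps if `n, ℓ ≥ 1`,
where `n` is the number of vertices. -/
def ComputesMaxWeightIndepSet (p : RAM.Prog) (C : GraphClass) (t : ℕ → ℕ → ℕ) : Prop :=
  ∀ (n : ℕ) (G : SimpleGraph (Fin n)) (w : Fin n → ℕ) (ℓ : ℕ), C.Mem G →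
    ∃ (S : Finset (Fin n)) (k : ℕ), p.Outputs G w [n, ℓ] S k ∧
      IsMaxWeightIndepSet G w ℓ S ∧ (1 ≤ n → 1 ≤ ℓ → k ≤ t ℓ n)

/-- The program `p` computes, from a graph in `C` with vertex weights and from `ℓ` and `c`, a
maximum-weight induced `c`-colorable subgraph with at most `ℓ` vertices, in at most `T c ℓ n`
steps if `n ≥ 2` and `ℓ, c ≥ 1`, where `n` is the number of vertices. -/
def ComputesMaxWeightColorable (p : RAM.Prog) (C : GraphClass) (T : ℕ → ℕ → ℕ → ℝ) : Prop :=
  ∀ (n : ℕ) (G : SimpleGraph (Fin n)) (w : Fin n → ℕ) (ℓ c : ℕ), C.Mem G →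
    ∃ (S : Finset (Fin n)) (k : ℕ), p.Outputs G w [n, ℓ, c] S k ∧
      IsMaxWeightColorable G w c ℓ S ∧ (2 ≤ n → 1 ≤ ℓ → 1 ≤ c → (k : ℝ) ≤ T c ℓ n)

/-! Fix a colouring of the vertices with c colours. A best set of at most ℓ vertices on which this
colouring is proper is a union of independent sets, one in each colour class. A knapsack recurrence
over colours and sizes (`Optimal.step`) therefore finds it with at most c·ℓ² calls of the given
program, each on the whole graph with the weights outside one class set to zero. What remains is to
list few colourings such that every colouring of every set of at most ℓ vertices is a restriction of
one of them.

Let k = ⌈√ℓ⌉, so that ℓ ≤ k² ≤ ℓ + 2k. Any set of at most k² vertices is mapped injectively by v ↦ v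
mod m₁ mod m₂ for suitable moduli (`exists_mod_mod_injOn`). There are O(ℓ² log n) candidates for m₁,
and the number N of candidates for m₂ is polynomial in ℓ and log log n. It thus suffices to colour
{0, …, N - 1}. A set of k² points there can be cut into k successive intervals with at most k points
each, so a family F that is universal for k points yields one for k² points, with ((N + 1)|F|)^k
members (`Universal.chainRows`). The family F comes from greedy covering of the partial colourings
with at most k prescribed values. A uniformly random colouring matches such a partial colouring with
probability at least c^(-k), and the method of conditional expectations finds a colouring that does
as well as the average (`wp_greedyRound`). Hence |F| is at most c^k times the logarithm of the
number of partial colourings, up to constants (`wp_greedyProg`), and the whole table has about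
c^(k²) rows, up to a factor (ℓ · c · log log n)^O(k).

Two points about the machine matter. The given program expects zeroed memory at each call; clearing
it could be too slow, so the program is simulated with time-stamped memory, and incrementing one
clock register resets everything (`wp_sim`, `wp_callProg`). The overhead linear in n at each call is
absorbed by t(ℓ, n), because a correct program has to read nearly all weights
(`le_succ_of_computesMaxWeightIndepSet`).

With Z = (ℓ + 2)(c + 2)(size (size n) + 2), the total is at most size n · c^ℓ · Z^(20(k + 1)) · t(ℓ,
n) (`tableTime_add_searchTime_le`). The exponent of the quasi-polynomial factor is √ℓ · log Z up to
constants, which is at most a small multiple of ℓ plus O(log² Z). So this factor is O(2^(ℓ + c +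
size (size n))) (`exists_pow_le_two_pow`), and 2^(size (size n)) = O(log n) supplies the second
logarithm. Of the factor ℓ^(K log ℓ) in the claim only the bound ≥ 1 is needed. -/

namespace RAM

-- Program logic: total correctness with step counts.

infixr:60 " ;; " => Prog.seq

namespace State

@[simp] theorem setReg_reg (s : State) (x v y : ℕ) :
    (s.setReg x v).reg y = if y = x then v else s.reg y := by
  simp [setReg, Function.update_apply]

theorem setReg_self (s : State) (x v : ℕ) : (s.setReg x v).reg x = v := by simp

theorem setReg_ne (s : State) {x y : ℕ} (v : ℕ) (h : y ≠ x) :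
    (s.setReg x v).reg y = s.reg y := by simp [h]

@[simp] theorem setReg_arr (s : State) (x v : ℕ) : (s.setReg x v).arr = s.arr := rfl

@[simp] theorem setArr_reg (s : State) (a i v : ℕ) : (s.setArr a i v).reg = s.reg := rfl

@[simp] theorem setArr_arr (s : State) (a i v b j : ℕ) :
    (s.setArr a i v).arr b j = if b = a ∧ j = i then v else s.arr b j := by
  by_cases hb : b = a
  · subst hb
    simp [setArr, Function.update_apply]
  · simp [setArr, hb]

theorem setArr_self (s : State) (a i v : ℕ) : (s.setArr a i v).arr a i = v := by simp

theorem setArr_ne (s : State) {a b i j : ℕ} (v : ℕ) (h : b ≠ a ∨ j ≠ i) :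
    (s.setArr a i v).arr b j = s.arr b j := by
  rw [setArr_arr, if_neg (by tauto)]

end State

/-- `p`, started in `s`, halts, and the final state and the number of steps satisfy `Q`. -/
def WP {n : ℕ} (G : SimpleGraph (Fin n)) (w : Fin n → ℕ) (p : Prog) (s : State)
    (Q : State → ℕ → Prop) : Prop :=
  ∃ s' k, Exec G w p s s' k ∧ Q s' k

/-- The registers that `p` may write. -/
def Prog.writes : Prog → ℕ → Bool
  | .const x _, r => x == r
  | .add x _ _, r => x == r
  | .sub x _ _, r => x == r
  | .half x _, r => x == r
  | .load x _ _, r => x == r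
  | .store _ _ _, _ => false
  | .weight x _, r => x == r
  | .adj x _ _, r => x == r
  | .seq p q, r => p.writes r || q.writes r
  | .ite _ p q, r => p.writes r || q.writes r
  | .loop _ p, r => p.writes r

/-- The arrays that `p` may write. -/
def Prog.stores : Prog → ℕ → Bool
  | .store a _ _, b => a == b
  | .seq p q, b => p.stores b || q.stores b
  | .ite _ p q, b => p.stores b || q.stores b
  | .loop _ p, b => p.stores b
  | _, _ => false

/-- `s'` differs from `s` at most in the registers and arrays that `p` may write. -/
structure Frame (p : Prog) (s s' : State) : Prop where
  reg : ∀ x, p.writes x = false → s'.reg x = s.reg x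
  arr : ∀ a, p.stores a = false → s'.arr a = s.arr a

theorem Frame.refl (p : Prog) (s : State) : Frame p s s := ⟨fun _ _ => rfl, fun _ _ => rfl⟩

theorem Frame.trans {p : Prog} {s₁ s₂ s₃ : State} (h : Frame p s₁ s₂) (h' : Frame p s₂ s₃) :
    Frame p s₁ s₃ :=
  ⟨fun x hx => (h'.reg x hx).trans (h.reg x hx), fun a ha => (h'.arr a ha).trans (h.arr a ha)⟩

theorem Frame.mono {p q : Prog} {s s' : State} (h : Frame p s s')
    (hw : ∀ x, q.writes x = false → p.writes x = false)
    (hs : ∀ a, q.stores a = false → p.stores a = false) : Frame q s s' :=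
  ⟨fun x hx => h.reg x (hw x hx), fun a ha => h.arr a (hs a ha)⟩

section

variable {n : ℕ} {G : SimpleGraph (Fin n)} {w : Fin n → ℕ}

/-- Since `writes` and `stores` are computable, later proofs that a register or array survived a
concrete program are closed by `rfl` or `decide`. -/
theorem Exec.frame {p : Prog} {s s' : State} {k : ℕ} (h : Exec G w p s s' k) : Frame p s s' := by
  induction h with
  | seq _ _ ih₁ ih₂ =>
    refine (ih₁.mono ?_ ?_).trans (ih₂.mono ?_ ?_) <;> intro x hx <;>
      simp_all [Prog.writes, Prog.stores]
  | ite_true _ _ ih =>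
    refine ih.mono ?_ ?_ <;> intro x hx <;> simp_all [Prog.writes, Prog.stores]
  | ite_false _ _ ih =>
    refine ih.mono ?_ ?_ <;> intro x hx <;> simp_all [Prog.writes, Prog.stores]
  | loop_stop _ => exact Frame.refl _ _
  | loop_step _ _ _ ih₁ ih₂ =>
    refine (ih₁.mono ?_ ?_).trans ih₂ <;> intro x hx <;> simp_all [Prog.writes, Prog.stores]
  | store s a x y =>
    refine ⟨fun _ _ => rfl, fun b hb => ?_⟩
    funext j
    simp only [Prog.stores, beq_eq_false_iff_ne] at hb
    simp [Ne.symm hb]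
  | _ =>
    refine ⟨fun y hy => ?_, fun _ _ => rfl⟩
    simp only [Prog.writes, beq_eq_false_iff_ne] at hy
    simp [Ne.symm hy]

/-- The frame condition comes for free, so specifications need not mention what a program leaves
alone. -/
theorem WP.imp {p : Prog} {s : State} {Q Q' : State → ℕ → Prop} (h : WP G w p s Q)
    (hQ : ∀ s' k, Frame p s s' → Q s' k → Q' s' k) : WP G w p s Q' := by
  obtain ⟨s', k, he, hq⟩ := h
  exact ⟨s', k, he, hQ s' k he.frame hq⟩

@[simp] theorem wp_const {x k : ℕ} {s : State} {Q : State → ℕ → Prop} :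
    WP G w (.const x k) s Q ↔ Q (s.setReg x k) 1 :=
  ⟨fun ⟨_, _, h, hq⟩ => by cases h; exact hq, fun h => ⟨_, _, .const s x k, h⟩⟩

@[simp] theorem wp_add {x y z : ℕ} {s : State} {Q : State → ℕ → Prop} :
    WP G w (.add x y z) s Q ↔ Q (s.setReg x (s.reg y + s.reg z)) 1 :=
  ⟨fun ⟨_, _, h, hq⟩ => by cases h; exact hq, fun h => ⟨_, _, .add s x y z, h⟩⟩

@[simp] theorem wp_sub {x y z : ℕ} {s : State} {Q : State → ℕ → Prop} :
    WP G w (.sub x y z) s Q ↔ Q (s.setReg x (s.reg y - s.reg z)) 1 :=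
  ⟨fun ⟨_, _, h, hq⟩ => by cases h; exact hq, fun h => ⟨_, _, .sub s x y z, h⟩⟩

@[simp] theorem wp_half {x y : ℕ} {s : State} {Q : State → ℕ → Prop} :
    WP G w (.half x y) s Q ↔ Q (s.setReg x (s.reg y / 2)) 1 :=
  ⟨fun ⟨_, _, h, hq⟩ => by cases h; exact hq, fun h => ⟨_, _, .half s x y, h⟩⟩

@[simp] theorem wp_load {x a y : ℕ} {s : State} {Q : State → ℕ → Prop} :
    WP G w (.load x a y) s Q ↔ Q (s.setReg x (s.arr a (s.reg y))) 1 :=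
  ⟨fun ⟨_, _, h, hq⟩ => by cases h; exact hq, fun h => ⟨_, _, .load s x a y, h⟩⟩

@[simp] theorem wp_store {a x y : ℕ} {s : State} {Q : State → ℕ → Prop} :
    WP G w (.store a x y) s Q ↔ Q (s.setArr a (s.reg x) (s.reg y)) 1 :=
  ⟨fun ⟨_, _, h, hq⟩ => by cases h; exact hq, fun h => ⟨_, _, .store s a x y, h⟩⟩

@[simp] theorem wp_weight {x y : ℕ} {s : State} {Q : State → ℕ → Prop} :
    WP G w (.weight x y) s Q ↔ Q (s.setReg x (weightEntry w (s.reg y))) 1 :=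
  ⟨fun ⟨_, _, h, hq⟩ => by cases h; exact hq, fun h => ⟨_, _, .weight s x y, h⟩⟩

@[simp] theorem wp_adj {x y z : ℕ} {s : State} {Q : State → ℕ → Prop} :
    WP G w (.adj x y z) s Q ↔ Q (s.setReg x (adjEntry G (s.reg y) (s.reg z))) 1 :=
  ⟨fun ⟨_, _, h, hq⟩ => by cases h; exact hq, fun h => ⟨_, _, .adj s x y z, h⟩⟩

@[simp] theorem wp_seq {p q : Prog} {s : State} {Q : State → ℕ → Prop} :
    WP G w (p ;; q) s Q ↔ WP G w p s fun s₁ k₁ => WP G w q s₁ fun s₂ k₂ => Q s₂ (k₁ + k₂) := by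
  constructor
  · rintro ⟨_, _, h, hq⟩
    cases h with
    | seq a b => exact ⟨_, _, a, _, _, b, hq⟩
  · rintro ⟨_, _, a, _, _, b, hq⟩
    exact ⟨_, _, .seq a b, hq⟩

@[simp] theorem wp_ite {x : ℕ} {p q : Prog} {s : State} {Q : State → ℕ → Prop} :
    WP G w (.ite x p q) s Q ↔
      (s.reg x ≠ 0 → WP G w p s fun s' k => Q s' (k + 1)) ∧
      (s.reg x = 0 → WP G w q s fun s' k => Q s' (k + 1)) := by
  constructor
  · rintro ⟨_, _, h, hq⟩
    cases h with
    | ite_true h a => exact ⟨fun _ => ⟨_, _, a, hq⟩, fun h' => absurd h' h⟩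
    | ite_false h a => exact ⟨fun h' => absurd h h', fun _ => ⟨_, _, a, hq⟩⟩
  · rintro ⟨h₁, h₂⟩
    by_cases hx : s.reg x = 0
    · obtain ⟨_, _, a, hq⟩ := h₂ hx
      exact ⟨_, _, .ite_false hx a, hq⟩
    · obtain ⟨_, _, a, hq⟩ := h₁ hx
      exact ⟨_, _, .ite_true hx a, hq⟩

/-- The rule for `while` loops: `I j` holds before the `j`-th iteration. -/
theorem wp_loop {x : ℕ} {body : Prog} {s : State} {Q : State → ℕ → Prop}
    (I : ℕ → State → Prop) (J T : ℕ) (h₀ : I 0 s)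
    (hJ : ∀ j s', I j s' → s'.reg x ≠ 0 → j < J)
    (step : ∀ j s', Frame body s s' → I j s' → s'.reg x ≠ 0 →
      WP G w body s' fun s'' k => I (j + 1) s'' ∧ k ≤ T)
    (done : ∀ j s' k, Frame body s s' → I j s' → s'.reg x = 0 → j ≤ J → k ≤ j * (T + 1) + 1 →
      Q s' k) : WP G w (.loop x body) s Q := by
  -- `d` is fuel, an upper bound for the number `J - j` of remaining passes.
  suffices H : ∀ d j s', J ≤ j + d → j ≤ J → Frame body s s' → I j s' →
      WP G w (.loop x body) s' fun s'' k => ∃ j', j ≤ j' ∧ j' ≤ J ∧ Frame body s s'' ∧ I j' s'' ∧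
        s''.reg x = 0 ∧ k ≤ (j' - j) * (T + 1) + 1 by
    refine (H J 0 s (by omega) (by omega) (Frame.refl _ _) h₀).imp ?_
    rintro s' k - ⟨j', -, hj, hf, hi, hx, hk⟩
    exact done j' s' k hf hi hx hj hk
  intro d
  induction d with
  | zero =>
    intro j s' hd hj hf hi
    by_cases hx : s'.reg x = 0
    · exact ⟨s', 1, Exec.loop_stop hx, j, le_rfl, hj, hf, hi, hx, by omega⟩
    · exact absurd (hJ j s' hi hx) (by omega)
  | succ d ih =>
    intro j s' hd hj hf hi
    by_cases hx : s'.reg x = 0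
    · exact ⟨s', 1, Exec.loop_stop hx, j, le_rfl, hj, hf, hi, hx, by omega⟩
    · have hj' := hJ j s' hi hx
      obtain ⟨s₁, k₁, e₁, hi₁, hk₁⟩ := step j s' hf hi hx
      obtain ⟨s₂, k₂, e₂, j', h1, h2, h3, h4, h5, h6⟩ :=
        ih (j + 1) s₁ (by omega) (by omega) (hf.trans e₁.frame) hi₁
      refine ⟨s₂, _, .loop_step hx e₁ e₂, j', by omega, h2, h3, h4, h5, ?_⟩
      obtain ⟨e, rfl⟩ := Nat.exists_eq_add_of_le h1
      have : j + 1 + e - (j + 1) = e := by omega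
      rw [this] at h6
      have : j + 1 + e - j = e + 1 := by omega
      rw [this]
      nlinarith

/-- Maintains loop invariants of the form "the first `j` cells are correct" when cell `j` is
written. -/
theorem prefix_update {f g : ℕ → ℕ} {j x : ℕ} (h : ∀ i, i < j → f i = g i) (hx : x = g j) (i : ℕ)
    (hi : i < j + 1) : (if i = j then x else f i) = g i := by
  rcases Nat.lt_succ_iff_lt_or_eq.1 hi with h' | rfl
  · rw [if_neg (by omega), h i h']
  · rw [if_pos rfl, hx]

/-- `for i < m do body`; the register `t` is scratch. -/
def forLt (i m t : ℕ) (body : Prog) : Prog :=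
  .const i 0 ;; .sub t m i ;; .loop t (body ;; .const t 1 ;; .add i i t ;; .sub t m i)

/-- One pass costs the body, three bookkeeping instructions and a test, whence `T + 4`; the two
instructions before the loop and the last test give the `3`. The bookkeeping overwrites the counter
and the scratch register, so the invariant must not depend on them (`hI`). -/
theorem wp_forLt {i m t : ℕ} {body : Prog} {s : State} {Q : State → ℕ → Prop}
    (I : ℕ → State → Prop) (T : ℕ) (M : ℕ) (hM : s.reg m = M)
    (hd : i ≠ m ∧ i ≠ t ∧ m ≠ t) (hbi : body.writes i = false) (hbm : body.writes m = false)
    (hI : ∀ j s' a b, I j s' → I j ((s'.setReg i a).setReg t b))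
    (h₀ : I 0 s)
    (step : ∀ j s', j < M → s'.reg i = j → s'.reg m = M → Frame (forLt i m t body) s s' →
      I j s' → WP G w body s' fun s'' k => I (j + 1) s'' ∧ k ≤ T)
    (done : ∀ s' k, Frame (forLt i m t body) s s' → I M s' → k ≤ M * (T + 4) + 3 → Q s' k) :
    WP G w (forLt i m t body) s Q := by
  obtain ⟨him, hit, hmt⟩ := hd
  have hfr : ∀ a b, Frame (forLt i m t body) s ((s.setReg i a).setReg t b) := by
    intro a b
    refine ⟨fun x hx => ?_, fun _ _ => rfl⟩
    simp only [forLt, Prog.writes, Bool.or_eq_false_iff, beq_eq_false_iff_ne] at hx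
    simp [Ne.symm hx.1, Ne.symm hx.2.1]
  have key : WP G w (forLt i m t body) s fun s' k =>
      Frame (forLt i m t body) s s' ∧ I M s' ∧ k ≤ M * (T + 4) + 3 := by
    unfold forLt
    simp only [wp_seq, wp_const, wp_sub]
    refine wp_loop (J := M) (T := T + 3)
      (fun j s' => j ≤ M ∧ s'.reg i = j ∧ s'.reg m = M ∧ s'.reg t = M - j ∧ I j s' ∧
        Frame (forLt i m t body) s s') ?_ ?_ ?_ ?_
    · simp [hit, Ne.symm him, hmt, hM, hI _ _ _ _ h₀, hfr]
    · rintro j s' ⟨_, h2, h3, h4, -⟩ h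
      omega
    · rintro j s' - ⟨h1, h2, h3, h4, h5, h6⟩ hx
      have hj : j < M := by omega
      simp only [wp_seq, wp_const, wp_add, wp_sub]
      refine (step j s' hj h2 h3 h6 h5).imp ?_
      rintro s'' k hf ⟨hi', hk⟩
      have e1 := hf.reg i hbi
      have e2 := hf.reg m hbm
      refine ⟨⟨by omega, by simp [hit, e1, h2], by simp [hmt, Ne.symm him, e2, h3], ?_, ?_, ?_⟩,
        by omega⟩
      · simp [hit, hmt, Ne.symm him, e1, e2, h2, h3]
      -- The bookkeeping writes the scratch register twice; only its last value survives, and this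
      -- brings the state into the form required by `hI`.
      · have := hI (j + 1) s'' (j + 1) (M - (j + 1)) hi'
        convert this using 1
        ext y
        · simp only [State.setReg_reg]
          split_ifs <;> simp_all
        · simp
      · refine h6.trans ⟨fun x hx => ?_, fun a ha => ?_⟩
        · simp only [forLt, Prog.writes, Bool.or_eq_false_iff, beq_eq_false_iff_ne] at hx
          have hx3 := hf.reg x hx.2.2.1
          simp [Ne.symm hx.1, Ne.symm hx.2.1, hx3]
        · simp only [forLt, Prog.stores, Bool.or_eq_false_iff] at ha
          simpa using hf.arr a ha.2.2.1
    · rintro j s' k - ⟨h1, h2, h3, h4, h5, h6⟩ hx hj hk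
      have : j = M := by omega
      subst this
      rw [show T + 3 + 1 = T + 4 by omega] at hk
      exact ⟨h6, h5, by omega⟩
  exact key.imp fun s' k _ h => done s' k h.1 h.2.1 h.2.2

/-! ### Arithmetic subroutines. -/

/-- `x := y`; register `3` is scratch. -/
def mov (x y : ℕ) : Prog := .const 3 0 ;; .add x y 3

@[simp] theorem wp_mov {x y : ℕ} {s : State} {Q : State → ℕ → Prop} :
    WP G w (mov x y) s Q ↔ Q ((s.setReg 3 0).setReg x (if y = 3 then 0 else s.reg y)) 2 := by
  simp [mov]

/-- `r₁₀ := r₁₁ * r₁₂`. -/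
def mulProg : Prog := .const 10 0 ;; forLt 13 12 3 (.add 10 10 11)

/-- Repeated addition takes time linear in the second factor, so callers put the smaller or cheaper
factor into register `12`. -/
theorem wp_mulProg {s : State} {Q : State → ℕ → Prop}
    (h : ∀ s' k, Frame mulProg s s' → s'.reg 10 = s.reg 11 * s.reg 12 →
      k ≤ 5 * s.reg 12 + 4 → Q s' k) : WP G w mulProg s Q := by
  have key : WP G w mulProg s fun s' k =>
      s'.reg 10 = s.reg 11 * s.reg 12 ∧ k ≤ 5 * s.reg 12 + 4 := by
    simp only [mulProg, wp_seq, wp_const]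
    refine wp_forLt (fun j s' => s'.reg 10 = s.reg 11 * j) 1 (s.reg 12) (by simp) (by decide)
      (by decide) (by decide) (by simp) (by simp) ?_ ?_
    · intro j s' hj hi hm hf hI
      have h11 := hf.reg 11 (by decide)
      simp at h11
      simp [hI, h11, mul_add]
    · intro s' k hf hI hk
      exact ⟨hI, by omega⟩
  exact key.imp fun s' k hf hq => h s' k hf hq.1 hq.2

/-- `r₁₀ := ` the number of binary digits of `r₁₁`. -/
def sizeProg : Prog :=
  .const 10 0 ;; .loop 11 (.half 11 11 ;; .const 3 1 ;; .add 10 10 3)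

theorem size_div_two (m : ℕ) (h : m ≠ 0) : Nat.size m = Nat.size (m / 2) + 1 := by
  conv_lhs => rw [← Nat.bit_bodd_div2 m]
  rw [Nat.size_bit (by rwa [Nat.bit_bodd_div2]), Nat.div2_val]

theorem wp_sizeProg {s : State} {Q : State → ℕ → Prop}
    (h : ∀ s' k, Frame sizeProg s s' → s'.reg 10 = Nat.size (s.reg 11) →
      k ≤ 4 * Nat.size (s.reg 11) + 2 → Q s' k) : WP G w sizeProg s Q := by
  have key : WP G w sizeProg s fun s' k =>
      s'.reg 10 = Nat.size (s.reg 11) ∧ k ≤ 4 * Nat.size (s.reg 11) + 2 := by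
    simp only [sizeProg, wp_seq, wp_const]
    refine wp_loop (fun j s' => s'.reg 10 = j ∧ j + Nat.size (s'.reg 11) = Nat.size (s.reg 11))
      (Nat.size (s.reg 11)) 3 (by simp) ?_ ?_ ?_
    · rintro j s' ⟨h1, h2⟩ hx
      have := size_div_two _ hx
      omega
    · rintro j s' - ⟨h1, h2⟩ hx
      have := size_div_two _ hx
      simp [h1]
      omega
    · rintro j s' k - ⟨h1, h2⟩ hx hj hk
      rw [hx] at h2
      simp at h2
      omega
  exact key.imp fun s' k hf hq => h s' k hf hq.1 hq.2

/-- `r₂₀ := ⌈√r₁⌉` and `r₂₁ := r₂₀²`. -/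
def sqrtProg : Prog :=
  .const 20 0 ;; .const 21 0 ;; .sub 3 1 21 ;;
    .loop 3 (.add 21 21 20 ;; .add 21 21 20 ;; .const 3 1 ;; .add 21 21 3 ;; .add 20 20 3 ;;
      .sub 3 1 21)

/-- Squares are built up from `(j + 1)² = j² + 2j + 1`, and the loop stops at the first square that
reaches the input. The overshoot is thus at most `2 * r`, which later costs only a factor `c ^ (2 *
r)`. -/
theorem wp_sqrtProg {s : State} {Q : State → ℕ → Prop}
    (h : ∀ s' k r, Frame sqrtProg s s' → s'.reg 20 = r → s'.reg 21 = r * r → s.reg 1 ≤ r * r →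
      r * r ≤ s.reg 1 + 2 * r → r ≤ s.reg 1 → k ≤ 7 * s.reg 1 + 4 → Q s' k) :
    WP G w sqrtProg s Q := by
  have key : WP G w sqrtProg s fun s' k => ∃ r, s'.reg 20 = r ∧ s'.reg 21 = r * r ∧
      s.reg 1 ≤ r * r ∧ r * r ≤ s.reg 1 + 2 * r ∧ r ≤ s.reg 1 ∧ k ≤ 7 * s.reg 1 + 4 := by
    simp only [sqrtProg, wp_seq, wp_const, wp_sub]
    refine wp_loop (fun j s' => s'.reg 20 = j ∧ s'.reg 21 = j * j ∧ j * j ≤ s.reg 1 + 2 * j ∧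
      j ≤ s.reg 1 ∧ s'.reg 3 = s.reg 1 - j * j)
      (s.reg 1) 6 (by simp) ?_ ?_ ?_
    · rintro j s' ⟨h1, h2, h3, h4, h5⟩ hx
      have : j ≤ j * j := Nat.le_mul_self j
      omega
    · rintro j s' hf ⟨h1, h2, h3, h4, h5⟩ hx
      have : j ≤ j * j := Nat.le_mul_self j
      have e := hf.reg 1 (by decide)
      have e2 : (j + 1) * (j + 1) = j * j + j + j + 1 := by ring
      simp at e
      simp [h1, h2, e, e2]
      omega
    · rintro j s' k - ⟨h1, h2, h3, h4, h5⟩ hx hj hk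
      exact ⟨j, h1, h2, by omega, h3, h4, by omega⟩
  exact key.imp fun s' k hf ⟨r, h1, h2, h3, h4, h5, h6⟩ => h s' k r hf h1 h2 h3 h4 h5 h6

end

/-! ### Simulation of a program with time-stamped memory -/

/-- `r_t := ` the simulated register `x`. -/
def getSim (t x : ℕ) : Prog :=
  .sub 3 99 (101 + 2 * x) ;; .ite 3 (.const t 0) (.const 3 0 ;; .add t (100 + 2 * x) 3)

/-- Write register `t` into the simulated register `x`. -/
def setSim (x t : ℕ) : Prog :=
  .const 3 0 ;; .add (100 + 2 * x) t 3 ;; .add (101 + 2 * x) 99 3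

/-- The simulation of a program. Simulated registers and array cells are valid if their time stamp
is the contents of register `99`; vertex weights are read from array `8`. -/
def sim : Prog → Prog
  | .const x k => .const 4 k ;; setSim x 4
  | .add x y z => getSim 4 y ;; getSim 5 z ;; .add 4 4 5 ;; setSim x 4
  | .sub x y z => getSim 4 y ;; getSim 5 z ;; .sub 4 4 5 ;; setSim x 4
  | .half x y => getSim 4 y ;; .half 4 4 ;; setSim x 4
  | .load x a y => getSim 4 y ;; .load 5 (21 + 2 * a) 4 ;; .sub 5 99 5 ;;
      .ite 5 (.const 4 0) (.load 4 (20 + 2 * a) 4) ;; setSim x 4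
  | .store a x y => getSim 4 x ;; getSim 5 y ;; .store (20 + 2 * a) 4 5 ;;
      .store (21 + 2 * a) 4 99
  | .weight x y => getSim 4 y ;; .load 4 8 4 ;; setSim x 4
  | .adj x y z => getSim 4 y ;; getSim 5 z ;; .adj 4 4 5 ;; setSim x 4
  | .seq p q => sim p ;; sim q
  | .ite x p q => getSim 4 x ;; .ite 4 (sim p) (sim q)
  | .loop x p => getSim 4 x ;; .loop 4 (sim p ;; getSim 4 x)

/-- Simulated registers and their stamps live from `100` on, so the calling program can keep its own
data below, apart from three scratch registers. -/
theorem sim_writes (p : Prog) (x : ℕ) (hx : x < 100) (h3 : x ≠ 3) (h4 : x ≠ 4) (h5 : x ≠ 5) :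
    (sim p).writes x = false := by
  induction p <;> simp_all [sim, Prog.writes, getSim, setSim]
  all_goals omega

theorem sim_stores (p : Prog) (a : ℕ) (ha : a < 20) : (sim p).stores a = false := by
  induction p <;> simp_all [sim, Prog.stores, getSim, setSim]
  all_goals omega

/-- The state `q` simulates the state `s`, with time stamp `cur`. -/
structure Simulates {n : ℕ} (w : Fin n → ℕ) (cur : ℕ) (s q : State) : Prop where
  stamp : q.reg 99 = cur
  reg : ∀ x, s.reg x = if q.reg (101 + 2 * x) = cur then q.reg (100 + 2 * x) else 0
  arr : ∀ a i, s.arr a i = if q.arr (21 + 2 * a) i = cur then q.arr (20 + 2 * a) i else 0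
  reg_le : ∀ x, q.reg (101 + 2 * x) ≤ cur
  arr_le : ∀ a i, q.arr (21 + 2 * a) i ≤ cur
  weight : ∀ i, q.arr 8 i = weightEntry w i

section

variable {n : ℕ} {G : SimpleGraph (Fin n)} {w w' : Fin n → ℕ}

theorem Simulates.setReg_low {cur : ℕ} {s q : State} (h : Simulates w cur s q) {t : ℕ} (v : ℕ)
    (ht : t < 99) : Simulates w cur s (q.setReg t v) where
  stamp := by simp [h.stamp, Ne.symm ht.ne]
  reg x := by
    simp (disch := omega) only [State.setReg_ne]
    exact h.reg x
  arr := h.arr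
  reg_le x := by
    simp (disch := omega) only [State.setReg_ne]
    exact h.reg_le x
  arr_le := h.arr_le
  weight := h.weight

/-- Stamps never exceed the clock, so the truncated difference of clock and stamp vanishes exactly
when the stamp is current. A stale stamp means that the register has not been written in this run
and still holds its initial zero. -/
theorem wp_getSim {cur : ℕ} {s q : State} (h : Simulates w cur s q) (t x : ℕ) (ht : t < 99)
    {Q : State → ℕ → Prop}
    (hQ : ∀ q' k, Simulates w cur s q' → q'.reg t = s.reg x →
      (∀ y, y < 99 → y ≠ 3 → y ≠ t → q'.reg y = q.reg y) → k ≤ 4 → Q q' k) :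
    WP G w' (getSim t x) q Q := by
  have h1 := h.reg x
  have h2 := h.reg_le x
  have h3 := h.stamp
  simp only [getSim, wp_seq, wp_sub, wp_ite, wp_const, wp_add]
  refine ⟨fun hx => hQ _ _ ((h.setReg_low _ (by omega)).setReg_low _ ht) ?_ ?_ (by omega),
    fun hx => hQ _ _ (((h.setReg_low _ (by omega)).setReg_low _ (by omega)).setReg_low _ ht)
      ?_ ?_ (by omega)⟩
  · simp only [State.setReg_reg, if_true] at hx ⊢
    rw [h1, if_neg (by omega)]
  · intro y h1 h2 h3
    simp [h2, h3]
  · simp only [State.setReg_reg, if_true] at hx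
    simp (disch := omega) only [State.setReg_ne, State.setReg_self, add_zero]
    rw [h1, if_pos (by omega)]
  · intro y h1 h2 h3
    simp [h2, h3]

theorem wp_setSim {cur : ℕ} {s q : State} (h : Simulates w cur s q) (x t v : ℕ)
    (ht3 : t ≠ 3) (hv : q.reg t = v) {Q : State → ℕ → Prop}
    (hQ : ∀ q', Simulates w cur (s.setReg x v) q' → Q q' 3) :
    WP G w' (setSim x t) q Q := by
  have h3 := h.stamp
  simp only [setSim, wp_seq, wp_const, wp_add]
  refine hQ _ ⟨?_, fun y => ?_, ?_, fun y => ?_, h.arr_le, h.weight⟩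
  · simp (disch := omega) only [State.setReg_ne, h3]
  · have h1 := h.reg y
    by_cases hy : y = x
    · subst hy
      simp (disch := omega) only [State.setReg_ne, State.setReg_self, add_zero, h3, hv, if_true]
    · simp (disch := omega) only [State.setReg_ne, h1]
  · exact h.arr
  · have h1 := h.reg_le y
    by_cases hy : y = x
    · subst hy
      simp (disch := omega) only [State.setReg_ne, State.setReg_self, add_zero, h3, le_refl]
    · simp (disch := omega) only [State.setReg_ne, h1]

/-- One unrolling of a loop. The simulation follows a given execution step by step, so this is
needed instead of the invariant rule. -/
theorem wp_loop_iff {x : ℕ} {body : Prog} {s : State} {Q : State → ℕ → Prop} :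
    WP G w (.loop x body) s Q ↔
      (s.reg x = 0 → Q s 1) ∧ (s.reg x ≠ 0 → WP G w body s fun s₁ k₁ =>
        WP G w (.loop x body) s₁ fun s₂ k₂ => Q s₂ (k₁ + k₂ + 1)) := by
  constructor
  · rintro ⟨_, _, h, hq⟩
    cases h with
    | loop_stop h => exact ⟨fun _ => hq, fun h' => absurd h h'⟩
    | loop_step h a b => exact ⟨fun h' => absurd h' h, fun _ => ⟨_, _, a, _, _, b, hq⟩⟩
  · rintro ⟨h1, h2⟩
    by_cases hx : s.reg x = 0
    · exact ⟨_, _, Exec.loop_stop hx, h1 hx⟩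
    · obtain ⟨_, _, a, _, _, b, hq⟩ := h2 hx
      exact ⟨_, _, .loop_step hx a b, hq⟩

/-- The simulation slows a program down by a constant factor. -/
theorem wp_sim {p : Prog} {s s' : State} {k : ℕ} (he : Exec G w p s s' k) {cur : ℕ} {q : State}
    (h : Simulates w cur s q) :
    WP G w' (sim p) q fun q' k' => Simulates w cur s' q' ∧ k' ≤ 12 * k := by
  induction he generalizing q with
  | const s x k =>
    simp only [sim, wp_seq, wp_const]
    refine wp_setSim (h.setReg_low k (by omega)) x 4 k (by omega) (by simp) ?_
    exact fun q' hq => ⟨hq, by omega⟩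
  | add s x y z =>
    simp only [sim, wp_seq, wp_add]
    refine wp_getSim h 4 y (by omega) fun q₁ k₁ hq₁ e₁ _ hk₁ => ?_
    refine wp_getSim hq₁ 5 z (by omega) fun q₂ k₂ hq₂ e₂ o₂ hk₂ => ?_
    have o := o₂ 4 (by omega) (by omega) (by omega)
    refine wp_setSim (hq₂.setReg_low _ (by omega)) x 4 (s.reg y + s.reg z) (by omega) (by simp [o, e₁, e₂]) ?_
    intro q' hq
    exact ⟨hq, by omega⟩
  | sub s x y z =>
    simp only [sim, wp_seq, wp_sub]
    refine wp_getSim h 4 y (by omega) fun q₁ k₁ hq₁ e₁ _ hk₁ => ?_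
    refine wp_getSim hq₁ 5 z (by omega) fun q₂ k₂ hq₂ e₂ o₂ hk₂ => ?_
    have o := o₂ 4 (by omega) (by omega) (by omega)
    refine wp_setSim (hq₂.setReg_low _ (by omega)) x 4 (s.reg y - s.reg z) (by omega) (by simp [o, e₁, e₂]) ?_
    intro q' hq
    exact ⟨hq, by omega⟩
  | half s x y =>
    simp only [sim, wp_seq, wp_half]
    refine wp_getSim h 4 y (by omega) fun q₁ k₁ hq₁ e₁ _ hk₁ => ?_
    refine wp_setSim (hq₁.setReg_low _ (by omega)) x 4 (s.reg y / 2) (by omega) (by simp [e₁]) ?_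
    intro q' hq
    exact ⟨hq, by omega⟩
  | load s x a y =>
    simp only [sim, wp_seq, wp_load, wp_sub, wp_ite, wp_const]
    refine wp_getSim h 4 y (by omega) fun q₁ k₁ hq₁ e₁ _ hk₁ => ?_
    have h1 := hq₁.arr a (q₁.reg 4)
    have h2 := hq₁.arr_le a (q₁.reg 4)
    have h3 := hq₁.stamp
    have hl := (hq₁.setReg_low (q₁.arr (21 + 2 * a) (q₁.reg 4)) (show 5 < 99 by omega)).setReg_low
      (cur - q₁.arr (21 + 2 * a) (q₁.reg 4)) (show 5 < 99 by omega)
    simp only [State.setReg_reg, State.setReg_arr, h3]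
    -- A nonzero difference means a stale stamp, and then the simulated cell is zero.
    refine ⟨fun hx => ?_, fun hx => ?_⟩
    · refine wp_setSim (hl.setReg_low _ (by omega)) x 4 0 (by omega) (by simp) ?_
      intro q' hq
      simp at hx
      rw [if_neg (by omega), e₁] at h1
      rw [← h1] at hq
      exact ⟨hq, by omega⟩
    · refine wp_setSim (hl.setReg_low _ (by omega)) x 4 (q₁.arr (20 + 2 * a) (q₁.reg 4))
        (by omega) (by simp) ?_
      intro q' hq
      simp at hx
      rw [if_pos (by omega)] at h1
      rw [← h1, e₁] at hq
      exact ⟨hq, by omega⟩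
  | store s a x y =>
    simp only [sim, wp_seq, wp_store]
    refine wp_getSim h 4 x (by omega) fun q₁ k₁ hq₁ e₁ _ hk₁ => ?_
    refine wp_getSim hq₁ 5 y (by omega) fun q₂ k₂ hq₂ e₂ o₂ hk₂ => ?_
    have e₃ : q₂.reg 4 = s.reg x := (o₂ 4 (by omega) (by omega) (by omega)).trans e₁
    refine ⟨⟨hq₂.stamp, hq₂.reg, fun b i => ?_, hq₂.reg_le, fun b i => ?_, fun i => ?_⟩, by omega⟩
    · have h1 := hq₂.arr b i
      simp only [State.setArr_reg, e₂, e₃, hq₂.stamp]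
      by_cases hb : b = a ∧ i = s.reg x
      · obtain ⟨rfl, rfl⟩ := hb
        simp (disch := omega) only [State.setArr_ne, State.setArr_self, if_true]
      · simp (disch := omega) only [State.setArr_ne, h1]
    · have h1 := hq₂.arr_le b i
      have h2 := hq₂.stamp
      simp only [State.setArr_arr, State.setArr_reg]
      split_ifs <;> omega
    · have h1 := hq₂.weight i
      simp (disch := omega) only [State.setArr_ne, h1]
  | weight s x y =>
    simp only [sim, wp_seq, wp_load]
    refine wp_getSim h 4 y (by omega) fun q₁ k₁ hq₁ e₁ _ hk₁ => ?_
    refine wp_setSim (hq₁.setReg_low _ (by omega)) x 4 (weightEntry _ (s.reg y)) (by omega) (by simpa [e₁] using hq₁.weight _) ?_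
    intro q' hq
    exact ⟨hq, by omega⟩
  | adj s x y z =>
    simp only [sim, wp_seq, wp_adj]
    refine wp_getSim h 4 y (by omega) fun q₁ k₁ hq₁ e₁ _ hk₁ => ?_
    refine wp_getSim hq₁ 5 z (by omega) fun q₂ k₂ hq₂ e₂ o₂ hk₂ => ?_
    have o := o₂ 4 (by omega) (by omega) (by omega)
    refine wp_setSim (hq₂.setReg_low _ (by omega)) x 4 (adjEntry G (s.reg y) (s.reg z)) (by omega) (by simp [o, e₁, e₂]) ?_
    intro q' hq
    exact ⟨hq, by omega⟩
  | seq _ _ ih₁ ih₂ =>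
    simp only [sim, wp_seq]
    refine (ih₁ h).imp fun q₁ k₁ _ h₁ => (ih₂ h₁.1).imp fun q₂ k₂ _ h₂ => ⟨h₂.1, ?_⟩
    have := h₁.2
    have := h₂.2
    omega
  | ite_true hx _ ih =>
    simp only [sim, wp_seq, wp_ite]
    refine wp_getSim h 4 _ (by omega) fun q₁ k₁ hq₁ e₁ _ hk₁ =>
      ⟨fun _ => (ih hq₁).imp fun q₂ k₂ _ h₂ => ⟨h₂.1, ?_⟩, fun h0 => absurd (e₁ ▸ h0) hx⟩
    have := h₂.2
    omega
  | ite_false hx _ ih =>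
    simp only [sim, wp_seq, wp_ite]
    refine wp_getSim h 4 _ (by omega) fun q₁ k₁ hq₁ e₁ _ hk₁ =>
      ⟨fun h0 => absurd (e₁.trans hx) h0, fun _ => (ih hq₁).imp fun q₂ k₂ _ h₂ => ⟨h₂.1, ?_⟩⟩
    have := h₂.2
    omega
  | loop_stop hx =>
    simp only [sim, wp_seq]
    refine wp_getSim h 4 _ (by omega) fun q₁ k₁ hq₁ e₁ _ hk₁ => ?_
    rw [wp_loop_iff]
    exact ⟨fun _ => ⟨hq₁, by omega⟩, fun h0 => absurd (e₁.trans hx) h0⟩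
  | loop_step hx _ _ ih₁ ih₂ =>
    simp only [sim, wp_seq]
    refine wp_getSim h 4 _ (by omega) fun q₁ k₁ hq₁ e₁ _ hk₁ => ?_
    rw [wp_loop_iff]
    refine ⟨fun h0 => absurd (e₁ ▸ h0) hx, fun _ => ?_⟩
    simp only [wp_seq]
    refine (ih₁ hq₁).imp fun q₂ k₂ _ h₂ => ?_
    -- The simulated body ends by reloading the loop condition, which is also how the simulation of
    -- the remaining iterations begins; hence the hypothesis for the rest matches what follows the
    -- body.
    have h₃ := ih₂ h₂.1
    simp only [sim, wp_seq] at h₃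
    refine h₃.imp fun q₃ k₃ _ h₄ => h₄.imp fun q₄ k₄ _ h₅ => ⟨h₅.1, ?_⟩
    have := h₂.2
    have := h₅.2
    omega

/-- Time stamps are at most the contents of register `99`, and the simulated weight vector has no
entries beyond `n`. -/
structure SimReady (n : ℕ) (s : State) : Prop where
  reg_le : ∀ x, s.reg (101 + 2 * x) ≤ s.reg 99
  arr_le : ∀ a i, s.arr (21 + 2 * a) i ≤ s.reg 99
  tail : ∀ i, n ≤ i → s.arr 8 i = 0

theorem SimReady.of_frame {p : Prog} {s s' : State} (h : SimReady n s) (hf : Frame p s s')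
    (hr : ∀ x, 99 ≤ x → p.writes x = false) (ha : ∀ a, 8 = a ∨ 20 ≤ a → p.stores a = false) :
    SimReady n s' where
  reg_le x := by
    rw [hf.reg _ (hr _ (by omega)), hf.reg _ (hr _ le_rfl)]
    exact h.reg_le x
  arr_le a i := by
    rw [hf.arr _ (ha _ (by omega)), hf.reg _ (hr _ le_rfl)]
    exact h.arr_le a i
  tail i hi := by
    rw [hf.arr _ (ha _ (by omega))]
    exact h.tail i hi

/-! ### Calling the independent-set program on one colour class. -/

/-- Put the weights of the vertices `v` whose entry in array `7` is `r₆₇` into array `8`. -/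
def classWeights : Prog :=
  forLt 63 0 3 (.load 4 7 63 ;; .sub 5 4 67 ;; .sub 6 67 4 ;; .add 5 5 6 ;;
    .ite 5 (.const 4 0) (.weight 4 63) ;; .store 8 63 4)

/-- A colour class is selected by giving weight zero to all other vertices, so that no renumbered
subgraph has to be built. Equality of colours is tested by adding the two truncated differences,
whose sum is the absolute difference. -/
theorem wp_classWeights {s : State} (hn : s.reg 0 = n) (hs : SimReady n s)
    {Q : State → ℕ → Prop}
    (hQ : ∀ s' k, Frame classWeights s s' → SimReady n s' →
      (∀ i, s'.arr 8 i = weightEntry (fun v => if s.arr 7 v = s.reg 67 then w v else 0) i) →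
      k ≤ 12 * n + 3 → Q s' k) : WP G w classWeights s Q := by
  have key : WP G w classWeights s fun s' k =>
      (∀ i, s'.arr 8 i = weightEntry (fun v => if s.arr 7 v = s.reg 67 then w v else 0) i) ∧
      k ≤ 12 * n + 3 := by
    refine wp_forLt (fun j s' => (∀ i, n ≤ i → s'.arr 8 i = 0) ∧ ∀ i, i < j → s'.arr 8 i =
      weightEntry (fun v => if s.arr 7 v = s.reg 67 then w v else 0) i) 8 n hn (by decide)
      (by decide) (by decide) (by simp) ⟨hs.tail, by simp⟩ ?_ ?_
    · intro j s' hj hi hm hf ⟨hI₁, hI₂⟩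
      have h7 := hf.arr 7 (by decide)
      have h67 := hf.reg 67 (by decide)
      simp only [wp_seq, wp_load, wp_sub, wp_add, wp_ite, wp_const, wp_store, wp_weight]
      have hst : ∀ x : ℕ, x = weightEntry (fun v => if s.arr 7 v = s.reg 67 then w v else 0) j →
          (∀ i, n ≤ i → (if i = j then x else s'.arr 8 i) = 0) ∧
          ∀ i, i < j + 1 → (if i = j then x else s'.arr 8 i) =
            weightEntry (fun v => if s.arr 7 v = s.reg 67 then w v else 0) i :=
        fun x hx => ⟨fun i hi => by rw [if_neg (by omega), hI₁ i hi], prefix_update hI₂ hx⟩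
      simp only [State.setReg_reg, hi, h7, h67]
      simp [-Order.lt_add_one_iff]
      constructor
      · intro hne
        have := hst 0 (by rw [weightEntry, dif_pos hj, if_neg]; simp only; omega)
        simpa [-Order.lt_add_one_iff] using this
      · intro h1 h2
        refine hst _ ?_
        rw [weightEntry, dif_pos hj, weightEntry, dif_pos hj, if_pos]
        simp only
        omega
    · intro s' k hf hI hk
      refine ⟨fun i => ?_, by omega⟩
      by_cases h : i < n
      · exact hI.2 i h
      · rw [hI.1 i (by omega), weightEntry, dif_neg h]
  refine key.imp fun s' k hf hq => hQ s' k hf ?_ hq.1 hq.2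
  have h99 := hf.reg 99 (by decide)
  refine ⟨fun x => ?_, fun a i => ?_, fun i hi => ?_⟩
  · rw [hf.reg _ (by simp [classWeights, forLt, Prog.writes]; omega), h99]
    exact hs.reg_le x
  · rw [hf.arr _ (by simp [classWeights, forLt, Prog.stores]; omega), h99]
    exact hs.arr_le a i
  · rw [hq.1, weightEntry, dif_neg (by omega)]

/-- Simulate `p` with the arguments `r₀`, `r₇₁` and the weights in array `8`. -/
def callProg (p : Prog) : Prog :=
  .const 3 1 ;; .add 99 99 3 ;; mov 100 0 ;; mov 101 99 ;; mov 102 71 ;; mov 103 99 ;; sim p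

/-- All stamps are at most the old clock value, so incrementing the clock makes every simulated
register and cell zero at once. Writing the two arguments then produces a simulation of the initial
state in constant time. -/
theorem wp_callProg {p : Prog} {s : State} (hn : s.reg 0 = n) (hs : SimReady n s)
    {S : Finset (Fin n)} {τ : ℕ} (hw : ∀ i, s.arr 8 i = weightEntry w i)
    (hp : p.Outputs G w [n, s.reg 71] S τ) {Q : State → ℕ → Prop}
    (hQ : ∀ s' k, Frame (callProg p) s s' → SimReady n s' →
      (∀ i, s'.arr 8 i = s.arr 8 i) →
      (∀ v : Fin n, v ∈ S ↔ s'.arr 21 v = s'.reg 99 ∧ s'.arr 20 v ≠ 0) →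
      k ≤ 12 * τ + 10 → Q s' k) : WP G w' (callProg p) s Q := by
  obtain ⟨f, hf, hS⟩ := hp
  have key : WP G w' (callProg p) s fun s' k =>
      Simulates w (s.reg 99 + 1) f s' ∧ k ≤ 12 * τ + 10 := by
    simp only [callProg, wp_seq, wp_mov, wp_const, wp_add]
    refine (wp_sim hf (cur := s.reg 99 + 1) ⟨?_, ?_, ?_, ?_, ?_, ?_⟩).imp ?_
    · simp
    · intro x
      match x with
      | 0 => simp [State.init, hn]
      | 1 => simp [State.init]
      | x + 2 =>
        have h1 := hs.reg_le (x + 2)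
        have h2 : (State.init [n, s.reg 71]).reg (x + 2) = 0 := by simp [State.init]
        rw [h2, if_neg]
        simp (disch := omega) only [State.setReg_ne]
        omega
    · intro a i
      have h1 := hs.arr_le a i
      have h0 : (State.init [n, s.reg 71]).arr a i = 0 := rfl
      exact h0.trans (if_neg (show ¬ s.arr (21 + 2 * a) i = s.reg 99 + 1 by omega)).symm
    · intro x
      have h1 := hs.reg_le x
      simp
      split_ifs <;> omega
    · intro a i
      have h1 := hs.arr_le a i
      simp only [State.setReg_arr]
      omega
    · simpa using hw
    · intro s' k _ ⟨h1, h2⟩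
      exact ⟨h1, by omega⟩
  refine key.imp fun s' k hf' ⟨h1, hk⟩ => hQ s' k hf' ?_ ?_ ?_ hk
  · exact ⟨fun x => by rw [h1.stamp]; exact h1.reg_le x,
      fun a i => by rw [h1.stamp]; exact h1.arr_le a i,
      fun i hi => by rw [h1.weight, weightEntry, dif_neg (by omega)]⟩
  · intro i
    rw [h1.weight, hw]
  · intro v
    have := h1.arr 0 v
    rw [← hS, State.output, Finset.mem_filter, this, h1.stamp]
    simp

theorem sum_weightEntry (f : Fin n → ℕ) : ∑ i ∈ Finset.range n, weightEntry f i = ∑ v, f v := by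
  rw [← Fin.sum_univ_eq_sum_range]
  exact Finset.sum_congr rfl fun v _ => by simp [weightEntry]

/-- Put the weights (from array `8`) of the simulated output into array `11` and their sum into
`r₇₂`. -/
def readOutput : Prog :=
  .const 72 0 ;; forLt 63 0 3 (.load 4 21 63 ;; .sub 4 99 4 ;; .const 5 0 ;;
    .ite 4 (.const 3 0) (.load 4 20 63 ;; .ite 4 (.load 5 8 63) (.const 3 0)) ;;
    .store 11 63 5 ;; .add 72 72 5)

theorem wp_readOutput {s : State} (hn : s.reg 0 = n) (hs : SimReady n s) {S : Finset (Fin n)}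
    {u : Fin n → ℕ} (hu : ∀ i, s.arr 8 i = weightEntry u i)
    (hS : ∀ v : Fin n, v ∈ S ↔ s.arr 21 v = s.reg 99 ∧ s.arr 20 v ≠ 0) {Q : State → ℕ → Prop}
    (hQ : ∀ s' k, Frame readOutput s s' →
      (∀ i, i < n → s'.arr 11 i = weightEntry (fun v => if v ∈ S then u v else 0) i) →
      s'.reg 72 = ∑ v ∈ S, u v → k ≤ 14 * n + 4 → Q s' k) : WP G w readOutput s Q := by
  have key : WP G w readOutput s fun s' k =>
      (∀ i, i < n → s'.arr 11 i = weightEntry (fun v => if v ∈ S then u v else 0) i) ∧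
      s'.reg 72 = ∑ v ∈ S, u v ∧ k ≤ 14 * n + 4 := by
    simp only [readOutput, wp_seq, wp_const]
    refine wp_forLt (fun j s' => (∀ i, i < j → s'.arr 11 i =
        weightEntry (fun v => if v ∈ S then u v else 0) i) ∧
      s'.reg 72 = ∑ i ∈ Finset.range j, weightEntry (fun v => if v ∈ S then u v else 0) i) 10 n
      (by simpa using hn) (by decide) (by decide) (by decide) (by simp) (by simp) ?_ ?_
    · intro j s' hj hi hm hf ⟨hI₁, hI₂⟩
      have h8 := hf.arr 8 (by decide)
      have h20 := hf.arr 20 (by decide)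
      have h21 := hf.arr 21 (by decide)
      have h99 := hf.reg 99 (by decide)
      have hS' := hS ⟨j, hj⟩
      have hle := hs.arr_le 0 j
      have huj := hu j
      simp only [State.setReg_reg, State.setReg_arr] at h8 h20 h21 h99
      simp only [Finset.sum_range_succ, wp_seq, wp_load, wp_sub, wp_add, wp_ite, wp_const,
        wp_store]
      rw [← hI₂]
      have hval : weightEntry (fun v => if v ∈ S then u v else 0) j =
          if s.arr 21 j = s.reg 99 ∧ s.arr 20 j ≠ 0 then s.arr 8 j else 0 := by
        rw [huj]
        simp [weightEntry, hj, hS']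
      rw [hval]
      have hst : ∀ x : ℕ, (∀ i, i < j + 1 → (if i = j then x else s'.arr 11 i) =
          weightEntry (fun v => if v ∈ S then u v else 0) i) ↔
          x = if s.arr 21 j = s.reg 99 ∧ s.arr 20 j ≠ 0 then s.arr 8 j else 0 := by
        intro x
        rw [← hval]
        exact ⟨fun h => by simpa using h j (by omega), prefix_update hI₁⟩
      simp [-Order.lt_add_one_iff, hi, h8, h20, h21, h99, hst]
      simp at hle
      refine ⟨fun h1 => ?_, fun h1 => ⟨fun h2 => ?_, fun h2 => ?_⟩⟩
      · have hne : s.arr 21 j ≠ s.reg 99 := by omega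
        simp [hne]
      · have : s.arr 21 j = s.reg 99 := by omega
        simp [this, h2]
      · simp [h2]
    · intro s' k hf ⟨hI₁, hI₂⟩ hk
      refine ⟨hI₁, ?_, by omega⟩
      rw [hI₂, sum_weightEntry]
      simp
  exact key.imp fun s' k hf hq => hQ s' k hf hq.1 hq.2.1 hq.2.2

/-- Find a best independent set of size at most `r₇₁` in colour class `r₆₇` (the colours being
in array `7`). -/
def solveProg (p : Prog) : Prog := classWeights ;; callProg p ;; readOutput

/-- `p` finds maximum-weight independent sets of size at most `1, …, ℓ` in at most `τ` steps. -/
def Solves (p : Prog) {n : ℕ} (G : SimpleGraph (Fin n)) (ℓ τ : ℕ) : Prop :=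
  ∀ (w : Fin n → ℕ) (i : ℕ), 1 ≤ i → i ≤ ℓ → ∃ (S : Finset (Fin n)) (k : ℕ),
    p.Outputs G w [n, i] S k ∧ IsMaxWeightIndepSet G w i S ∧ k ≤ τ

/-- The returned set may contain vertices of modified weight zero, including vertices outside the
class. Discarding them preserves independence and the size bound and does not change the weight.
Inside the class the modified and the original weights agree, so optimality carries over. -/
theorem wp_solveProg {p : Prog} {s : State} {ℓ τ : ℕ} (hp : Solves p G ℓ τ) (hn : s.reg 0 = n)
    (hs : SimReady n s) (h1 : 1 ≤ s.reg 71) (h2 : s.reg 71 ≤ ℓ) {Q : State → ℕ → Prop}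
    (hQ : ∀ s' k, ∀ T : Finset (Fin n), Frame (solveProg p) s s' → SimReady n s' →
      (∀ v ∈ T, s.arr 7 v = s.reg 67 ∧ w v ≠ 0) → T.card ≤ s.reg 71 →
      G.IsIndepSet (T : Set (Fin n)) →
      (∀ T' : Finset (Fin n), (∀ v ∈ T', s.arr 7 v = s.reg 67) → T'.card ≤ s.reg 71 →
        G.IsIndepSet (T' : Set (Fin n)) → ∑ v ∈ T', w v ≤ ∑ v ∈ T, w v) →
      (∀ i, i < n → s'.arr 11 i = weightEntry (fun v => if v ∈ T then w v else 0) i) →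
      s'.reg 72 = ∑ v ∈ T, w v → k ≤ 26 * n + 12 * τ + 17 → Q s' k) :
    WP G w (solveProg p) s Q := by
  set u : Fin n → ℕ := fun v => if s.arr 7 v = s.reg 67 then w v else 0 with hu
  obtain ⟨S, k₀, hS, ⟨⟨hS₁, hS₂⟩, hS₃⟩, hk₀⟩ := hp u _ h1 h2
  suffices key : WP G w (solveProg p) s fun s' k => SimReady n s' ∧
      (∀ i, i < n → s'.arr 11 i = weightEntry (fun v => if v ∈ S then u v else 0) i) ∧
      s'.reg 72 = ∑ v ∈ S, u v ∧ k ≤ 26 * n + 12 * τ + 17 by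
    classical
    have hsum : ∀ T' : Finset (Fin n), ∑ v ∈ T'.filter (fun v => u v ≠ 0), w v = ∑ v ∈ T', u v := by
      intro T'
      rw [Finset.sum_filter]
      refine Finset.sum_congr rfl fun v _ => ?_
      by_cases h4 : s.arr 7 v = s.reg 67 <;> by_cases h5 : w v = 0 <;> simp [hu, h4, h5]
    refine key.imp fun s' k hf ⟨q1, q2, q3, q4⟩ =>
      hQ s' k (S.filter fun v => u v ≠ 0) hf q1 ?_ ?_ ?_ ?_ ?_ ?_ q4
    · intro v hv
      have := (Finset.mem_filter.1 hv).2
      simp only [hu] at this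
      split_ifs at this with h
      · exact ⟨h, this⟩
      · exact absurd rfl this
    · exact (Finset.card_filter_le _ _).trans hS₁
    · exact hS₂.mono (Finset.coe_subset.2 (Finset.filter_subset _ _))
    · intro T' h1 h2 h3
      rw [hsum]
      have := hS₃ T' ⟨h2, h3⟩
      refine le_trans (le_of_eq (Finset.sum_congr rfl fun v hv => ?_)) this
      simp [hu, h1 v hv]
    · intro i hi
      rw [q2 i hi]
      congr 1
      funext v
      by_cases h3 : v ∈ S <;> by_cases h4 : s.arr 7 v = s.reg 67 <;> by_cases h5 : w v = 0 <;>
        simp [hu, h3, h4, h5]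
    · rw [q3, hsum]
  simp only [solveProg, wp_seq]
  refine wp_classWeights hn hs fun s₁ k₁ f₁ r₁ hw₁ hk₁ => ?_
  have e0 := f₁.reg 0 (by decide)
  have e71 := f₁.reg 71 (by decide)
  rw [hn] at e0
  rw [← e71] at hS
  refine wp_callProg e0 r₁ hw₁ hS fun s₂ k₂ f₂ r₂ hw₂ hm hk₂ => ?_
  have e0' := f₂.reg 0 (by simp [callProg, mov, Prog.writes, sim_writes])
  rw [e0] at e0'
  refine wp_readOutput e0' r₂ (fun i => (hw₂ i).trans (hw₁ i)) hm fun s₃ k₃ f₃ h11 h72 hk₃ =>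
    ⟨r₂.of_frame f₃ ?_ ?_, h11, h72, by omega⟩
  · intro x hx
    simp [readOutput, forLt, Prog.writes]
    omega
  · intro a ha
    simp [readOutput, forLt, Prog.stores]
    omega

end

/-! ### Tables of functions -/

/-- From address `base` on, the memory `f` holds the values on `{0, …, N - 1}` of the functions in
the list `rows`. -/
def Holds (f : ℕ → ℕ) (base N : ℕ) (rows : List (ℕ → ℕ)) : Prop :=
  ∀ (r : ℕ) (hr : r < rows.length) (u : ℕ), u < N → f (base + r * N + u) = rows[r] u

theorem row_lt {r u L N : ℕ} (hr : r < L) (hu : u < N) : r * N + u < L * N := by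
  have : (r + 1) * N ≤ L * N := Nat.mul_le_mul_right _ hr
  rw [add_mul] at this
  omega

theorem Holds.congr {f f' : ℕ → ℕ} {base N : ℕ} {rows : List (ℕ → ℕ)} (h : Holds f base N rows)
    (hf : ∀ i, base ≤ i → i < base + rows.length * N → f' i = f i) : Holds f' base N rows := by
  intro r hr u hu
  have := row_lt hr hu
  rw [hf _ (by omega) (by omega), h r hr u hu]

theorem Holds.append {f : ℕ → ℕ} {base N : ℕ} {rows : List (ℕ → ℕ)} (h : Holds f base N rows)
    {g : ℕ → ℕ} (hg : ∀ u, u < N → f (base + rows.length * N + u) = g u) :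
    Holds f base N (rows ++ [g]) := by
  intro r hr u hu
  by_cases h' : r < rows.length
  · rw [h r h' u hu, List.getElem_append_left h']
  · have : r = rows.length := by
      simp at hr
      omega
    subst this
    simp [hg u hu]

theorem Holds.nil (f : ℕ → ℕ) (base N : ℕ) : Holds f base N [] := fun r hr => by simp at hr

/-- The partial functions from `{0, …, N - 1}` to `{0, …, c - 1}` defined at one point. The value
`y` is represented by `y + 1`, and `0` stands for undefined. -/
def pointRows (N c : ℕ) : List (ℕ → ℕ) :=
  (List.range N).flatMap fun x => (List.range c).map fun y u => if u = x then y + 1 else 0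

theorem length_pointRows (N c : ℕ) : (pointRows N c).length = N * c := by
  simp [pointRows, List.length_flatMap]

/-- Write `pointRows` into array `1` and its length into `r₂₇`. -/
def pointProg : Prog :=
  .const 24 0 ;; .const 27 0 ;; forLt 25 23 3 (forLt 26 2 3
    (.add 4 24 25 ;; .const 5 1 ;; .add 5 26 5 ;; .store 1 4 5 ;; .add 24 24 23 ;; .const 5 1 ;;
      .add 27 27 5))

/-- `g` below `x`, and `f` from `x` on. -/
def cut (g : ℕ → ℕ) (x : ℕ) (f : ℕ → ℕ) : ℕ → ℕ := fun u => if u < x then g u else f u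

/-- All functions that agree with a function in `old` below some `x ≤ N` and with a function in
`F` from `x` on. -/
def chainStep (N : ℕ) (F old : List (ℕ → ℕ)) : List (ℕ → ℕ) :=
  old.flatMap fun g => (List.range (N + 1)).flatMap fun x => F.map (cut g x)

/-- The functions that are composed of `k` functions in `F` on successive intervals. -/
def chainRows (N : ℕ) (F : List (ℕ → ℕ)) (k : ℕ) : List (ℕ → ℕ) :=
  (chainStep N F)^[k] [fun _ => 0]

theorem chainRows_succ (N : ℕ) (F : List (ℕ → ℕ)) (k : ℕ) :
    chainRows N F (k + 1) = chainStep N F (chainRows N F k) :=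
  Function.iterate_succ_apply' _ _ _

theorem length_chainStep (N : ℕ) (F old : List (ℕ → ℕ)) :
    (chainStep N F old).length = old.length * ((N + 1) * F.length) := by
  simp [chainStep, List.length_flatMap]

theorem length_chainRows (N : ℕ) (F : List (ℕ → ℕ)) (k : ℕ) :
    (chainRows N F k).length = ((N + 1) * F.length) ^ k := by
  induction k with
  | zero => simp [chainRows]
  | succ k ih => rw [chainRows_succ, length_chainStep, ih, pow_succ]

/-- Append `cut g x f` to the table in array `a`, where `g` is stored there at `r₃₃`, `f` is
stored in array `b` at `r₃₈`, and `x` is in `r₃₇`. -/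
def cutRow (a b : ℕ) : Prog :=
  forLt 40 23 3 (.sub 4 37 40 ;; .ite 4 (.add 5 33 40 ;; .load 5 a 5) (.add 5 38 40 ;; .load 5 b 5)
    ;; .add 4 30 40 ;; .store a 4 5) ;;
  .add 30 30 23 ;; .const 3 1 ;; .add 32 32 3 ;; .add 38 38 23

def cutRows (a b : ℕ) : Prog := .const 38 0 ;; forLt 39 27 3 (cutRow a b)

def cutPoints (a b : ℕ) : Prog := forLt 37 35 3 (cutRows a b) ;; .add 33 33 23

/-- One step of `chainProg`. -/
def chainLevel (a b : ℕ) : Prog :=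
  .const 32 0 ;; mov 33 29 ;; mov 34 30 ;; forLt 36 28 3 (cutPoints a b) ;; mov 28 32 ;; mov 29 34

/-- Compute `chainRows` for the list of `r₂₇` functions in array `b`, in array `a`. The result
starts at address `r₂₉` and has length `r₂₈`. -/
def chainProg (a b : ℕ) : Prog :=
  .const 29 0 ;; .const 28 1 ;; mov 30 23 ;; .const 3 1 ;; .add 35 23 3 ;;
    forLt 31 20 3 (chainLevel a b)

/-- In state `s` the rows in `acc` have been appended to array `a` from address `nb` on, without
changing the entries `f₀` below. -/
structure Appended (f₀ : ℕ → ℕ) (a nb N : ℕ) (acc : List (ℕ → ℕ)) (s : State) : Prop where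
  out : s.reg 30 = nb + acc.length * N
  cnt : s.reg 32 = acc.length
  rows : Holds (s.arr a) nb N acc
  old : ∀ i, i < nb → s.arr a i = f₀ i

section

variable {n : ℕ} {G : SimpleGraph (Fin n)} {w : Fin n → ℕ}

/-- Each row needs only one store, because the array is still zero beyond the rows written so far;
the invariant `I` records this. -/
theorem wp_pointProg {s : State} {N c : ℕ} (hN : s.reg 23 = N) (hc : s.reg 2 = c)
    (h0 : ∀ i, s.arr 1 i = 0) {Q : State → ℕ → Prop}
    (hQ : ∀ s' k, Frame pointProg s s' → Holds (s'.arr 1) 0 N (pointRows N c) →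
      s'.reg 27 = N * c → k ≤ N * (c * 11 + 7) + 5 → Q s' k) :
    WP G w pointProg s Q := by
  let row : ℕ → ℕ → ℕ → ℕ := fun x y u => if u = x then y + 1 else 0
  let pre : ℕ → List (ℕ → ℕ) := fun x =>
    (List.range x).flatMap fun x => (List.range c).map fun y => row x y
  let I : List (ℕ → ℕ) → State → Prop := fun acc s' => s'.reg 24 = acc.length * N ∧
    s'.reg 27 = acc.length ∧ Holds (s'.arr 1) 0 N acc ∧
    ∀ i, acc.length * N ≤ i → s'.arr 1 i = 0
  have key : WP G w pointProg s fun s' k => I (pre N) s' ∧ k ≤ N * (c * 11 + 7) + 5 := by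
    simp only [pointProg, wp_seq, wp_const]
    refine wp_forLt (fun x => I (pre x)) (c * 11 + 3) N (by simpa using hN) (by decide) rfl rfl
      (by simp [I]) ?_ ?_ ?_
    · simp [I, pre, h0, Holds.nil]
    · intro x s₁ hx hi hm hf hI
      have e2 : s₁.reg 2 = c := (hf.reg 2 rfl).trans (by simpa using hc)
      refine wp_forLt (fun y => I (pre x ++ (List.range y).map (row x))) 7 c e2 (by decide)
        rfl rfl (by simp [I]) (by simpa using hI) ?_ ?_
      · intro y s₂ hy hi' hm' hf' ⟨i1, i2, i3, i4⟩
        have e23 : s₂.reg 23 = N := (hf'.reg 23 rfl).trans hm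
        have e25 : s₂.reg 25 = x := (hf'.reg 25 rfl).trans hi
        set acc := pre x ++ (List.range y).map (row x) with hacc
        have hr : pre x ++ (List.range (y + 1)).map (row x) = acc ++ [row x y] := by
          simp [hacc, List.range_succ]
        rw [hr]
        simp only [wp_seq, wp_add, wp_const, wp_store]
        refine ⟨⟨?_, ?_, ?_, ?_⟩, by omega⟩
        · simp [i1, e23, add_mul]
        · simp [i2]
        · refine Holds.append (i3.congr ?_) ?_
          · intro i _ hi
            simp [i1, e25]
            omega
          · intro u hu
            simp [i1, e25, row, hi']
            rw [i4 _ (Nat.le_add_right _ _)]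
        · intro i hi
          simp [add_mul] at hi
          simp [i1, e25]
          rw [if_neg (by omega)]
          exact i4 _ (by omega)
      · intro s₂ k hf' hI' hk
        refine ⟨?_, by omega⟩
        have : pre (x + 1) = pre x ++ (List.range c).map (row x) := by
          simp [pre, List.range_succ]
        rwa [this]
    · intro s₁ k hf hI hk
      exact ⟨hI, by rw [show c * 11 + 7 = c * 11 + 3 + 4 by omega]; omega⟩
  refine key.imp fun s' k hf hq => hQ s' k hf hq.1.2.2.1 ?_ hq.2
  rw [hq.1.2.1]
  exact length_pointRows N c

/-- Old and new rows share array `a`. The row being read ends at or below address `nb` and the new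
rows start there, so writing does not disturb the source. -/
theorem wp_cutRow {a b : ℕ} (hab : b ≠ a) {f₀ : ℕ → ℕ} {nb N : ℕ} {acc : List (ℕ → ℕ)}
    {s : State} (hs : Appended f₀ a nb N acc s) (hN : s.reg 23 = N) {g f : ℕ → ℕ}
    (hg : ∀ u, u < N → f₀ (s.reg 33 + u) = g u) (hg' : s.reg 33 + N ≤ nb)
    (hf : ∀ u, u < N → s.arr b (s.reg 38 + u) = f u) {Q : State → ℕ → Prop}
    (hQ : ∀ s' k, Frame (cutRow a b) s s' →
      Appended f₀ a nb N (acc ++ [cut g (s.reg 37) f]) s' → s'.reg 38 = s.reg 38 + N →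
      k ≤ 10 * N + 7 → Q s' k) :
    WP G w (cutRow a b) s Q := by
  suffices key : WP G w (cutRow a b) s fun s' k =>
      Appended f₀ a nb N (acc ++ [cut g (s.reg 37) f]) s' ∧ s'.reg 38 = s.reg 38 + N ∧
      k ≤ 10 * N + 7 from
    key.imp fun s' k hf hq => hQ s' k hf hq.1 hq.2.1 hq.2.2
  have hadd : ∀ x y z : ℕ, x + y = x + z ↔ y = z := by omega
  simp only [cutRow, wp_seq]
  refine wp_forLt (fun j s' => (∀ i, i < s.reg 30 → s'.arr a i = s.arr a i) ∧
    ∀ u, u < j → s'.arr a (s.reg 30 + u) = cut g (s.reg 37) f u) 6 N hN (by decide) rfl rfl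
    (by simp) (by simp) ?_ ?_
  · intro j s₁ hj hi hm hfr ⟨h1, h2⟩
    have e30 := hfr.reg 30 rfl
    have e33 := hfr.reg 33 rfl
    have e37 := hfr.reg 37 rfl
    have e38 := hfr.reg 38 rfl
    have eb := hfr.arr b (by simp [forLt, Prog.stores, hab.symm])
    have hout := hs.out
    have hst : ∀ x : ℕ, x = cut g (s.reg 37) f j →
        (∀ i, i < s.reg 30 → (if i = s.reg 30 + j then x else s₁.arr a i) = s.arr a i) ∧
        ∀ u, u < j + 1 → (if s.reg 30 + u = s.reg 30 + j then x else s₁.arr a (s.reg 30 + u)) =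
          cut g (s.reg 37) f u := by
      refine fun x hx => ⟨fun i hi => by rw [if_neg (by omega), h1 i hi], fun u hu => ?_⟩
      simpa using prefix_update h2 hx u hu
    simp only [wp_seq, wp_sub, wp_ite, wp_add, wp_load, wp_store]
    refine ⟨fun h => ?_, fun h => ?_⟩
    · simp [hi, e37] at h
      have := hst (s₁.arr a (s.reg 33 + j)) (by
        rw [cut, if_pos (by omega), h1 _ (by omega), hs.old _ (by omega), hg j hj])
      simpa [-Order.lt_add_one_iff, e30, e33, hi] using this
    · simp [hi, e37] at h
      have := hst (s₁.arr b (s.reg 38 + j)) (by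
        rw [cut, if_neg (by omega), eb, hf j hj])
      simpa [-Order.lt_add_one_iff, e30, e38, hi] using this
  · intro s₁ k hfr ⟨h1, h2⟩ hk
    have e30 := hfr.reg 30 rfl
    have e32 := hfr.reg 32 rfl
    have e23 := hfr.reg 23 rfl
    have e38 := hfr.reg 38 rfl
    simp only [wp_add, wp_const]
    refine ⟨⟨?_, ?_, ?_, ?_⟩, ?_, by omega⟩
    · simp [e30, e23, hs.out, hN, add_mul, add_assoc]
    · simp [e32, hs.cnt]
    · refine Holds.append (hs.rows.congr ?_) ?_
      · intro i _ hi
        simpa using h1 i (by rw [hs.out]; exact hi)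
      · intro u hu
        simpa [hs.out] using h2 u hu
    · intro i hi
      have := h1 i (by rw [hs.out]; omega)
      simpa [hs.old i hi] using this
    · simp [e38, e23, hN]

theorem wp_cutRows {a b : ℕ} (hab : b ≠ a) {f₀ : ℕ → ℕ} {nb N : ℕ} {acc F : List (ℕ → ℕ)}
    {s : State} (hs : Appended f₀ a nb N acc s) (hN : s.reg 23 = N) {g : ℕ → ℕ}
    (hg : ∀ u, u < N → f₀ (s.reg 33 + u) = g u) (hg' : s.reg 33 + N ≤ nb)
    (hF : Holds (s.arr b) 0 N F) (hl : s.reg 27 = F.length) {Q : State → ℕ → Prop}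
    (hQ : ∀ s' k, Frame (cutRows a b) s s' →
      Appended f₀ a nb N (acc ++ F.map (cut g (s.reg 37))) s' →
      k ≤ 11 * ((F.length + 1) * (N + 1)) → Q s' k) :
    WP G w (cutRows a b) s Q := by
  suffices key : WP G w (cutRows a b) s fun s' k =>
      Appended f₀ a nb N (acc ++ F.map (cut g (s.reg 37))) s' ∧
      k ≤ 11 * ((F.length + 1) * (N + 1)) from
    key.imp fun s' k hf hq => hQ s' k hf hq.1 hq.2
  simp only [cutRows, wp_seq, wp_const]
  refine wp_forLt (fun j s' => Appended f₀ a nb N (acc ++ (F.take j).map (cut g (s.reg 37))) s' ∧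
    s'.reg 38 = j * N) (10 * N + 7) F.length (by simpa using hl) (by decide) rfl rfl ?_ ?_ ?_ ?_
  · rintro j s' x y ⟨⟨h1, h2, h3, h4⟩, h5⟩
    exact ⟨⟨by simpa using h1, by simpa using h2, h3, h4⟩, by simpa using h5⟩
  · simp only [List.take_zero, List.map_nil, List.append_nil]
    exact ⟨⟨by simpa using hs.out, by simpa using hs.cnt, hs.rows, hs.old⟩, by simp⟩
  · intro j s₁ hj hi hm hfr ⟨h1, h2⟩
    have e23 := hfr.reg 23 rfl
    have e33 := hfr.reg 33 rfl
    have e37 := hfr.reg 37 rfl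
    have eb := hfr.arr b (by simp [forLt, cutRow, Prog.stores, hab.symm])
    simp at e23 e33 e37 eb
    refine wp_cutRow hab h1 (e23.trans hN) (g := g) (f := F[j]) (by rwa [e33]) (by rwa [e33]) ?_ ?_
    · intro u hu
      rw [eb, h2]
      simpa using hF j hj u hu
    · intro s₂ k _ h3 h4 hk
      refine ⟨⟨?_, by rw [h4, h2]; ring⟩, hk⟩
      rw [e37] at h3
      rwa [List.take_add_one, List.getElem?_eq_getElem hj, Option.toList_some, List.map_append,
        ← List.append_assoc]
  · intro s₁ k _ ⟨h1, _⟩ hk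
    rw [List.take_length] at h1
    exact ⟨h1, by nlinarith⟩

theorem wp_cutPoints {a b : ℕ} (hab : b ≠ a) {f₀ : ℕ → ℕ} {nb N : ℕ} {acc F : List (ℕ → ℕ)}
    {s : State} (hs : Appended f₀ a nb N acc s) (hN : s.reg 23 = N) (hN1 : s.reg 35 = N + 1)
    {g : ℕ → ℕ} (hg : ∀ u, u < N → f₀ (s.reg 33 + u) = g u) (hg' : s.reg 33 + N ≤ nb)
    (hF : Holds (s.arr b) 0 N F) (hl : s.reg 27 = F.length) {Q : State → ℕ → Prop}
    (hQ : ∀ s' k, Frame (cutPoints a b) s s' →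
      Appended f₀ a nb N
        (acc ++ (List.range (N + 1)).flatMap fun x => F.map (cut g x)) s' →
      s'.reg 33 = s.reg 33 + N → k ≤ 19 * ((F.length + 1) * (N + 1) * (N + 1)) → Q s' k) :
    WP G w (cutPoints a b) s Q := by
  suffices key : WP G w (cutPoints a b) s fun s' k =>
      Appended f₀ a nb N
        (acc ++ (List.range (N + 1)).flatMap fun x => F.map (cut g x)) s' ∧
      s'.reg 33 = s.reg 33 + N ∧ k ≤ 19 * ((F.length + 1) * (N + 1) * (N + 1)) from
    key.imp fun s' k hf hq => hQ s' k hf hq.1 hq.2.1 hq.2.2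
  simp only [cutPoints, wp_seq]
  refine wp_forLt (fun j s' => Appended f₀ a nb N
    (acc ++ (List.range j).flatMap fun x => F.map (cut g x)) s')
    (11 * ((F.length + 1) * (N + 1))) (N + 1) hN1 (by decide) rfl rfl ?_ ?_ ?_ ?_
  · rintro j s' x y ⟨h1, h2, h3, h4⟩
    exact ⟨by simpa using h1, by simpa using h2, h3, h4⟩
  · simpa using hs
  · intro j s₁ hj hi hm hfr h1
    have e23 := hfr.reg 23 rfl
    have e33 := hfr.reg 33 rfl
    have e27 := hfr.reg 27 rfl
    have eb := hfr.arr b (by simp [forLt, cutRow, cutRows, Prog.stores, hab.symm])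
    refine wp_cutRows hab h1 (e23.trans hN) (g := g) (by rwa [e33]) (by rwa [e33])
      (F := F) (by rwa [eb]) (e27.trans hl) ?_
    intro s₂ k _ h3 hk
    refine ⟨?_, hk⟩
    rw [hi] at h3
    rw [List.range_succ, List.flatMap_append]
    simpa using h3
  · intro s₁ k hfr h1 hk
    have e23 := hfr.reg 23 rfl
    have e33 := hfr.reg 33 rfl
    simp only [wp_add]
    refine ⟨⟨by simpa using h1.out, by simpa using h1.cnt, h1.rows, h1.old⟩, ?_, ?_⟩
    · simp [e33, e23, hN]
    · have : 1 ≤ (F.length + 1) * (N + 1) := Nat.mul_pos (by omega) (by omega)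
      nlinarith

theorem wp_chainLevel {a b : ℕ} (hab : b ≠ a) {N : ℕ} {old F : List (ℕ → ℕ)}
    {s : State} (hN : s.reg 23 = N) (hN1 : s.reg 35 = N + 1) (hold : Holds (s.arr a) (s.reg 29) N old)
    (holdl : s.reg 28 = old.length) (hout : s.reg 30 = s.reg 29 + old.length * N)
    (hF : Holds (s.arr b) 0 N F) (hl : s.reg 27 = F.length) {Q : State → ℕ → Prop}
    (hQ : ∀ s' k, Frame (chainLevel a b) s s' →
      Holds (s'.arr a) (s'.reg 29) N (chainStep N F old) →
      s'.reg 28 = (chainStep N F old).length →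
      s'.reg 30 = s'.reg 29 + (chainStep N F old).length * N →
      k ≤ 36 * ((old.length + 1) * ((F.length + 1) * (N + 1) * (N + 1))) → Q s' k) :
    WP G w (chainLevel a b) s Q := by
  suffices key : WP G w (chainLevel a b) s fun s' k =>
      Holds (s'.arr a) (s'.reg 29) N (chainStep N F old) ∧
      s'.reg 28 = (chainStep N F old).length ∧
      s'.reg 30 = s'.reg 29 + (chainStep N F old).length * N ∧
      k ≤ 36 * ((old.length + 1) * ((F.length + 1) * (N + 1) * (N + 1))) from
    key.imp fun s' k hf hq => hQ s' k hf hq.1 hq.2.1 hq.2.2.1 hq.2.2.2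
  simp only [chainLevel, wp_seq, wp_const, wp_mov]
  set step : (ℕ → ℕ) → List (ℕ → ℕ) := fun g =>
    (List.range (N + 1)).flatMap fun x => F.map (cut g x) with hstep
  refine wp_forLt (fun j s' => Appended (s.arr a) a (s.reg 30) N ((old.take j).flatMap step) s' ∧
    s'.reg 33 = s.reg 29 + j * N)
    (19 * ((F.length + 1) * (N + 1) * (N + 1))) old.length (by simpa using holdl) (by decide)
    rfl rfl ?_ ?_ ?_ ?_
  · rintro j s' x y ⟨⟨h1, h2, h3, h4⟩, h5⟩
    exact ⟨⟨by simpa using h1, by simpa using h2, h3, h4⟩, by simpa using h5⟩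
  · exact ⟨⟨by simp, by simp, by simp [Holds.nil], by simp⟩, by simp⟩
  · intro j s₁ hj hi hm hfr ⟨h1, h2⟩
    have e23 := hfr.reg 23 rfl
    have e27 := hfr.reg 27 rfl
    have e35 := hfr.reg 35 rfl
    have eb := hfr.arr b (by simp [forLt, cutRow, cutRows, cutPoints, Prog.stores, hab.symm])
    simp at e23 e27 e35 eb
    have hle : (j + 1) * N ≤ old.length * N := Nat.mul_le_mul_right _ hj
    rw [add_mul] at hle
    refine wp_cutPoints hab h1 (e23.trans hN) (e35.trans hN1) (g := old[j]) ?_ (by omega)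
      (F := F) (by rwa [eb]) (e27.trans hl) ?_
    · intro u hu
      rw [h2]
      exact hold j hj u hu
    · intro s₂ k _ h3 h4 hk
      refine ⟨⟨?_, by rw [h4, h2]; ring⟩, hk⟩
      rw [List.take_add_one, List.getElem?_eq_getElem hj, Option.toList_some,
        List.flatMap_append]
      simpa using h3
  · intro s₁ k hfr ⟨h1, _⟩ hk
    rw [List.take_length, show old.flatMap step = chainStep N F old from rfl] at h1
    have e34 := hfr.reg 34 rfl
    simp at e34
    refine ⟨?_, ?_, ?_, ?_⟩
    · simpa [e34] using h1.rows
    · simpa using h1.cnt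
    · simpa [e34] using h1.out
    · have : 1 ≤ (F.length + 1) * (N + 1) * (N + 1) :=
        Nat.mul_pos (Nat.mul_pos (by omega) (by omega)) (by omega)
      nlinarith

theorem wp_chainProg {a b : ℕ} (hab : b ≠ a) {N m : ℕ} {F : List (ℕ → ℕ)}
    {s : State} (hN : s.reg 23 = N) (hm : s.reg 20 = m) (h0 : ∀ i, s.arr a i = 0)
    (hF : Holds (s.arr b) 0 N F) (hl : s.reg 27 = F.length) {Q : State → ℕ → Prop}
    (hQ : ∀ s' k, Frame (chainProg a b) s s' →
      Holds (s'.arr a) (s'.reg 29) N (chainRows N F m) →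
      s'.reg 28 = ((N + 1) * F.length) ^ m →
      k ≤ 40 * ((m + 1) * ((((N + 1) * (F.length + 1)) ^ m + 1) *
        ((F.length + 1) * (N + 1) * (N + 1)))) → Q s' k) :
    WP G w (chainProg a b) s Q := by
  suffices key : WP G w (chainProg a b) s fun s' k =>
      Holds (s'.arr a) (s'.reg 29) N (chainRows N F m) ∧
      s'.reg 28 = (chainRows N F m).length ∧
      k ≤ 40 * ((m + 1) * ((((N + 1) * (F.length + 1)) ^ m + 1) *
        ((F.length + 1) * (N + 1) * (N + 1)))) from
    key.imp fun s' k hf hq => hQ s' k hf hq.1 (hq.2.1.trans (length_chainRows _ _ _)) hq.2.2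
  simp only [chainProg, wp_seq, wp_const, wp_mov, wp_add]
  set X := (F.length + 1) * (N + 1) * (N + 1) with hX
  set Y := ((N + 1) * (F.length + 1)) ^ m + 1 with hY
  have hXY : 1 ≤ Y * X := Nat.mul_pos (by omega)
    (Nat.mul_pos (Nat.mul_pos (by omega) (by omega)) (by omega))
  refine wp_forLt (fun j s' => Holds (s'.arr a) (s'.reg 29) N (chainRows N F j) ∧
      s'.reg 28 = (chainRows N F j).length ∧
      s'.reg 30 = s'.reg 29 + (chainRows N F j).length * N)
    (36 * (Y * X)) m (by simpa using hm) (by decide) rfl rfl ?_ ?_ ?_ ?_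
  · rintro j s' x y ⟨h1, h2, h3⟩
    exact ⟨by simpa using h1, by simpa using h2, by simpa using h3⟩
  -- The table starts as a single zero row, which the untouched array already holds.
  · refine ⟨?_, by simp [chainRows], by simp [chainRows, hN]⟩
    intro r hr u hu
    simp [chainRows] at hr
    subst hr
    simp [chainRows, h0]
    rfl
  · intro j s₁ hj hi hm hfr ⟨h1, h2, h3⟩
    have e23 := hfr.reg 23 rfl
    have e27 := hfr.reg 27 rfl
    have e35 := hfr.reg 35 rfl
    have eb := hfr.arr b
      (by simp [forLt, cutRow, cutRows, cutPoints, chainLevel, mov, Prog.stores, hab.symm])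
    simp at e23 e27 e35 eb
    refine wp_chainLevel hab (e23.trans hN) (by rw [e35, hN]) h1 h2 h3 (by rwa [eb])
      (e27.trans hl) ?_
    intro s₂ k _ h4 h5 h6 hk
    refine ⟨by simpa only [chainRows_succ] using ⟨h4, h5, h6⟩, hk.trans ?_⟩
    refine Nat.mul_le_mul_left _ (Nat.mul_le_mul_right _ ?_)
    rw [length_chainRows, hY]
    -- The `+ 1` keeps the base positive, so the power is monotone in the exponent even if `F` is
    -- empty; every level is charged like the largest one.
    have h7 : ((N + 1) * F.length) ^ j ≤ ((N + 1) * (F.length + 1)) ^ j :=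
      Nat.pow_le_pow_left (Nat.mul_le_mul_left _ (by omega)) _
    have h8 : ((N + 1) * (F.length + 1)) ^ j ≤ ((N + 1) * (F.length + 1)) ^ m :=
      Nat.pow_le_pow_right (Nat.mul_pos (by omega) (by omega)) hj.le
    omega
  · intro s₁ k _ ⟨h1, h2, _⟩ hk
    exact ⟨h1, h2, by nlinarith⟩

end

/-! ### The greedy covering algorithm -/

/-- The total weight of the rows whose entry is `y + 1`. -/
def colorWeight (R : ℕ) (W p : ℕ → ℕ) (y : ℕ) : ℕ :=
  ∑ r ∈ Finset.range R, if p r = y + 1 then W r else 0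

/-- The weight `x` of a row with entry `p` after its column has been coloured with `y`. -/
def newWeight (c x p y : ℕ) : ℕ := if p = 0 then x else if p = y + 1 then x * c else 0

/-- `f` has the prescribed values in the first `j` columns. -/
def Matches (f p : ℕ → ℕ) (j : ℕ) : Prop := ∀ u, u < j → p u ≠ 0 → p u = f u + 1

open Classical in
/-- The weight of the row `p` after `j` columns have been coloured according to `f`. -/
noncomputable def rowWeight (c x : ℕ) (p f : ℕ → ℕ) (j : ℕ) : ℕ :=
  if Matches f p j then x * c ^ ((Finset.range j).filter fun u => p u ≠ 0).card else 0

/-- This is the averaging step of the method of conditional expectations. The rows that prescribe a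
value in this column are distributed over `c` colours, so the heaviest colour carries at least a `1
/ c` fraction of their weight. Multiplying that part by `c` makes up for the rows that are lost. -/
theorem sum_le_sum_newWeight {R c y : ℕ} {W p : ℕ → ℕ} (hp : ∀ r, r < R → p r ≤ c)
    (hy : ∀ y', y' < c → colorWeight R W p y' ≤ colorWeight R W p y) :
    ∑ r ∈ Finset.range R, W r ≤ ∑ r ∈ Finset.range R, newWeight c (W r) (p r) y := by
  have h1 : ∑ r ∈ Finset.range R, (if p r = 0 then 0 else W r) =
      ∑ y' ∈ Finset.range c, colorWeight R W p y' := by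
    simp only [colorWeight]
    rw [Finset.sum_comm]
    refine Finset.sum_congr rfl fun r hr => ?_
    by_cases h0 : p r = 0
    · simp [h0]
    · obtain ⟨q, hq⟩ := Nat.exists_eq_succ_of_ne_zero h0
      have hqc : q < c := by
        have := hp r (Finset.mem_range.1 hr)
        omega
      rw [if_neg h0, Finset.sum_eq_single_of_mem q (Finset.mem_range.2 hqc)]
      · simp [hq]
      · intro b _ hb
        rw [if_neg]
        omega
  have h2 : ∑ y' ∈ Finset.range c, colorWeight R W p y' ≤ c * colorWeight R W p y := by
    refine (Finset.sum_le_card_nsmul _ _ _ fun y' h => hy y' (Finset.mem_range.1 h)).trans ?_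
    simp
  have h3 : ∑ r ∈ Finset.range R, W r = ∑ r ∈ Finset.range R, (if p r = 0 then W r else 0) +
      ∑ r ∈ Finset.range R, (if p r = 0 then 0 else W r) := by
    rw [← Finset.sum_add_distrib]
    exact Finset.sum_congr rfl fun r _ => by split_ifs <;> simp
  have h4 : ∑ r ∈ Finset.range R, newWeight c (W r) (p r) y =
      ∑ r ∈ Finset.range R, (if p r = 0 then W r else 0) + c * colorWeight R W p y := by
    rw [colorWeight, Finset.mul_sum, ← Finset.sum_add_distrib]
    refine Finset.sum_congr rfl fun r _ => ?_
    unfold newWeight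
    split_ifs <;> first | omega | ring
  omega

theorem rowWeight_zero (c x : ℕ) (p f : ℕ → ℕ) : rowWeight c x p f 0 = x := by
  simp [rowWeight, Matches]

theorem rowWeight_congr {c x : ℕ} {p f g : ℕ → ℕ} {j : ℕ} (h : ∀ u, u < j → f u = g u) :
    rowWeight c x p f j = rowWeight c x p g j := by
  have : Matches f p j ↔ Matches g p j :=
    forall₂_congr fun u hu => by rw [h u hu]
  by_cases hf : Matches f p j
  · rw [rowWeight, rowWeight, if_pos hf, if_pos (this.1 hf)]
  · rw [rowWeight, rowWeight, if_neg hf, if_neg fun hg => hf (this.2 hg)]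

theorem rowWeight_succ (c x : ℕ) (p f : ℕ → ℕ) (j : ℕ) :
    rowWeight c x p f (j + 1) = newWeight c (rowWeight c x p f j) (p j) (f j) := by
  have hm : Matches f p (j + 1) ↔ Matches f p j ∧ (p j ≠ 0 → p j = f j + 1) := by
    constructor
    · exact fun h => ⟨fun u hu => h u (by omega), h j (by omega)⟩
    · rintro ⟨h1, h2⟩ u hu
      rcases Nat.lt_succ_iff_lt_or_eq.1 hu with h | rfl
      · exact h1 u h
      · exact h2
  unfold rowWeight newWeight
  rw [Finset.range_add_one, Finset.filter_insert]
  by_cases hj : Matches f p j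
  · by_cases h0 : p j = 0
    · rw [if_pos (hm.2 ⟨hj, fun h => absurd h0 h⟩), if_pos hj, if_pos h0, if_neg (by simpa using h0)]
    · by_cases h1 : p j = f j + 1
      · rw [if_pos (hm.2 ⟨hj, fun _ => h1⟩), if_pos hj, if_neg h0, if_pos h1, if_pos h0,
          Finset.card_insert_of_notMem (by simp), pow_succ, mul_assoc]
      · rw [if_neg fun h => h1 ((hm.1 h).2 h0), if_neg h0, if_neg h1]
  · rw [if_neg fun h => hj (hm.1 h).1, if_neg hj]
    simp

theorem rowWeight_le {c x j k : ℕ} {p f : ℕ → ℕ} (hc : 1 ≤ c)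
    (hk : ((Finset.range j).filter fun u => p u ≠ 0).card ≤ k) :
    rowWeight c x p f j ≤ c ^ k * x := by
  unfold rowWeight
  split_ifs
  · rw [mul_comm]
    exact Nat.mul_le_mul_right _ (Nat.pow_le_pow_right hc hk)
  · simp

theorem rowWeight_ne_zero {c x j : ℕ} {p f : ℕ → ℕ} (hc : 1 ≤ c) :
    rowWeight c x p f j ≠ 0 ↔ Matches f p j ∧ x ≠ 0 := by
  have : c ^ ((Finset.range j).filter fun u => p u ≠ 0).card ≠ 0 := pow_ne_zero _ (by omega)
  unfold rowWeight
  split_ifs with h <;> simp [h]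
  intro _
  omega

/-- Put the weight of the rows whose entry in column `r₄₇` is `r₅₀ + 1` into `r₅₁`. -/
def colorSum : Prog :=
  .const 51 0 ;; .add 52 41 47 ;; .const 4 1 ;; .add 53 50 4 ;; forLt 46 42 3
    (.load 4 2 52 ;; .sub 5 4 53 ;; .sub 6 53 4 ;; .add 5 5 6 ;;
      .ite 5 (.const 3 0) (.load 6 5 46 ;; .add 51 51 6) ;; .add 52 52 23)

/-- Put the colour for which `colorSum` is largest into `r₄₉`. -/
def bestColor : Prog :=
  .const 48 0 ;; .const 49 0 ;; forLt 50 2 3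
    (colorSum ;; .sub 4 51 48 ;; .ite 4 (mov 48 51 ;; mov 49 50) (.const 3 0))

/-- Colour column `r₄₇` with `r₄₉`. -/
def updateWeights : Prog :=
  .add 52 41 47 ;; .const 4 1 ;; .add 53 49 4 ;; forLt 46 42 3
    (.load 4 2 52 ;; .ite 4 (.sub 5 4 53 ;; .sub 6 53 4 ;; .add 5 5 6 ;;
      .ite 5 (.const 6 0 ;; .store 5 46 6) (.load 11 5 46 ;; mov 12 2 ;; mulProg ;; .store 5 46 10))
        (.const 3 0) ;; .add 52 52 23)

def colorColumns : Prog :=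
  forLt 47 23 3 (bestColor ;; .add 4 44 47 ;; .store 3 4 49 ;; updateWeights)

def updateAlive : Prog :=
  .const 45 0 ;; forLt 46 42 3
    (.load 4 5 46 ;; .ite 4 (.const 5 0 ;; .store 6 46 5) (.load 5 6 46 ;; .add 45 45 5))

/-- Find one function that matches many of the rows that are not yet matched. -/
def greedyRound : Prog :=
  forLt 46 42 3 (.load 4 6 46 ;; .store 5 46 4) ;; colorColumns ;; .add 44 44 23 ;; .const 3 1 ;;
    .add 43 43 3 ;; updateAlive

/-- Write functions that match the `r₄₂` rows in array `2` into array `3`, and their number into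
`r₄₃`. -/
def greedyProg : Prog :=
  .const 43 0 ;; .const 44 0 ;; forLt 46 42 3 (.const 4 1 ;; .store 6 46 4) ;; mov 45 42 ;;
    .loop 45 greedyRound

/-- The rows `P 0, …, P (R - 1)` are stored in array `2`, and the registers contain the parameters
of the greedy algorithm. -/
structure GreedyInput (P : ℕ → ℕ → ℕ) (R N c : ℕ) (s : State) : Prop where
  width : s.reg 23 = N
  colors : s.reg 2 = c
  length : s.reg 42 = R
  rows : ∀ r, r < R → ∀ u, u < N → s.arr 2 (s.reg 41 + r * N + u) = P r u

section

variable {n : ℕ} {G : SimpleGraph (Fin n)} {w : Fin n → ℕ} {P : ℕ → ℕ → ℕ} {R N c : ℕ}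

theorem GreedyInput.of_frame {p : Prog} {s s' : State} (h : GreedyInput P R N c s)
    (hf : Frame p s s') (h1 : p.writes 23 = false) (h2 : p.writes 2 = false)
    (h3 : p.writes 42 = false) (h4 : p.writes 41 = false) (h5 : p.stores 2 = false) :
    GreedyInput P R N c s' where
  width := (hf.reg _ h1).trans h.width
  colors := (hf.reg _ h2).trans h.colors
  length := (hf.reg _ h3).trans h.length
  rows := by
    rw [hf.reg _ h4, hf.arr _ h5]
    exact h.rows

theorem wp_colorSum {s : State} (hs : GreedyInput P R N c s) (hu : s.reg 47 < N)
    {Q : State → ℕ → Prop}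
    (hQ : ∀ s' k, Frame colorSum s s' →
      s'.reg 51 = colorWeight R (s.arr 5) (fun r => P r (s.reg 47)) (s.reg 50) →
      k ≤ 12 * R + 7 → Q s' k) :
    WP G w colorSum s Q := by
  suffices key : WP G w colorSum s fun s' k =>
      s'.reg 51 = colorWeight R (s.arr 5) (fun r => P r (s.reg 47)) (s.reg 50) ∧
      k ≤ 12 * R + 7 from key.imp fun s' k hf hq => hQ s' k hf hq.1 hq.2
  simp only [colorSum, wp_seq, wp_const, wp_add]
  refine wp_forLt (fun j s' => s'.reg 52 = s.reg 41 + s.reg 47 + j * N ∧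
    s'.reg 51 = colorWeight j (s.arr 5) (fun r => P r (s.reg 47)) (s.reg 50)) 8 R
    (by simpa using hs.length) (by decide) rfl rfl (by simp) (by simp [colorWeight]) ?_ ?_
  · rintro j s₁ hj hi hm hf ⟨h1, h2⟩
    have e2 := hf.arr 2 rfl
    have e5 := hf.arr 5 rfl
    have e53 := hf.reg 53 rfl
    have e23 := hf.reg 23 rfl
    have hP := hs.rows j hj _ hu
    rw [add_right_comm, add_assoc] at hP
    simp at e2 e5 e53 e23
    simp only [wp_seq, wp_load, wp_sub, wp_add, wp_ite, wp_const]
    have hs' : colorWeight (j + 1) (s.arr 5) (fun r => P r (s.reg 47)) (s.reg 50) =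
        colorWeight j (s.arr 5) (fun r => P r (s.reg 47)) (s.reg 50) +
        if P j (s.reg 47) = s.reg 50 + 1 then s.arr 5 j else 0 := Finset.sum_range_succ _ _
    rw [hs']
    simp [e2, e5, e53, h1, hP, hi, h2, e23, hs.width, add_mul, add_assoc]
    refine ⟨fun h => ?_, fun h1 h2 => ?_⟩
    · intro h'
      omega
    · intro h'
      omega
  · rintro s₁ k - ⟨-, h2⟩ hk
    exact ⟨h2, by omega⟩

theorem wp_bestColor {s : State} (hs : GreedyInput P R N c s) (hu : s.reg 47 < N)
    {Q : State → ℕ → Prop}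
    (hQ : ∀ s' k, Frame bestColor s s' →
      (∀ y, y < c → colorWeight R (s.arr 5) (fun r => P r (s.reg 47)) y ≤
        colorWeight R (s.arr 5) (fun r => P r (s.reg 47)) (s'.reg 49)) →
      k ≤ c * (12 * R + 17) + 5 → Q s' k) :
    WP G w bestColor s Q := by
  set S := colorWeight R (s.arr 5) (fun r => P r (s.reg 47)) with hS
  suffices key : WP G w bestColor s fun s' k => (∀ y, y < c → S y ≤ S (s'.reg 49)) ∧
      k ≤ c * (12 * R + 17) + 5 from key.imp fun s' k hf hq => hQ s' k hf hq.1 hq.2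
  simp only [bestColor, wp_seq, wp_const]
  refine wp_forLt (fun j s' => s'.reg 48 ≤ S (s'.reg 49) ∧ ∀ y, y < j → S y ≤ s'.reg 48)
    (12 * R + 13) c (by simpa using hs.colors) (by decide) rfl rfl (by simp) (by simp) ?_ ?_
  · rintro j s₁ hj hi hm hf ⟨h1, h2⟩
    have e5 := hf.arr 5 rfl
    have e47 := hf.reg 47 rfl
    simp at e5 e47
    have hs₁ : GreedyInput P R N c s₁ :=
      GreedyInput.of_frame (s := (s.setReg 48 0).setReg 49 0)
        ⟨by simpa using hs.width, by simpa using hs.colors, by simpa using hs.length, by simpa using hs.rows⟩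
        hf rfl rfl rfl rfl rfl
    rw [wp_seq]
    refine wp_colorSum hs₁ (by rwa [e47]) fun s₂ k hf₂ h51 hk => ?_
    have e48 := hf₂.reg 48 rfl
    have e49 := hf₂.reg 49 rfl
    have e50 := hf₂.reg 50 rfl
    rw [e5, e47, hi, ← hS] at h51
    simp [h51, e48, e49, e50, hi]
    refine ⟨fun h => ⟨fun y hy => ?_, by omega⟩, fun h => ⟨⟨h1, fun y hy => ?_⟩, by omega⟩⟩
    · rcases Nat.lt_or_eq_of_le hy with hy | rfl
      · exact (h2 y hy).trans (by omega)
      · exact le_rfl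
    · rcases Nat.lt_or_eq_of_le hy with hy | rfl
      · exact h2 y hy
      · omega
  · rintro s₁ k - ⟨h1, h2⟩ hk
    exact ⟨fun y hy => (h2 y hy).trans h1, by
      rw [show 12 * R + 17 = 12 * R + 13 + 4 by omega]; omega⟩

theorem wp_updateWeights {s : State} (hs : GreedyInput P R N c s) (hu : s.reg 47 < N)
    {Q : State → ℕ → Prop}
    (hQ : ∀ s' k, Frame updateWeights s s' →
      (∀ r, r < R → s'.arr 5 r = newWeight c (s.arr 5 r) (P r (s.reg 47)) (s.reg 49)) →
      k ≤ R * (5 * c + 19) + 6 → Q s' k) :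
    WP G w updateWeights s Q := by
  suffices key : WP G w updateWeights s fun s' k =>
      (∀ r, r < R → s'.arr 5 r = newWeight c (s.arr 5 r) (P r (s.reg 47)) (s.reg 49)) ∧
      k ≤ R * (5 * c + 19) + 6 from key.imp fun s' k hf hq => hQ s' k hf hq.1 hq.2
  simp only [updateWeights, wp_seq, wp_const, wp_add]
  refine wp_forLt (fun j s' => s'.reg 52 = s.reg 41 + s.reg 47 + j * N ∧
    (∀ r, r < j → s'.arr 5 r = newWeight c (s.arr 5 r) (P r (s.reg 47)) (s.reg 49)) ∧
    ∀ r, j ≤ r → s'.arr 5 r = s.arr 5 r) (5 * c + 15) R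
    (by simpa using hs.length) (by decide) rfl rfl (by simp) (by simp) ?_ ?_
  · rintro j s₁ hj hi hm hf ⟨h1, h2, h3⟩
    have e2 := hf.arr 2 rfl
    have e53 := hf.reg 53 rfl
    have e23 := hf.reg 23 rfl
    have ec := hf.reg 2 rfl
    have hP := hs.rows j hj _ hu
    rw [add_right_comm] at hP
    simp at e2 e53 e23 ec
    have hst : ∀ x, x = newWeight c (s.arr 5 j) (P j (s.reg 47)) (s.reg 49) →
        (∀ r, r < j + 1 → (if r = j then x else s₁.arr 5 r) =
          newWeight c (s.arr 5 r) (P r (s.reg 47)) (s.reg 49)) ∧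
        ∀ r, j + 1 ≤ r → (if r = j then x else s₁.arr 5 r) = s.arr 5 r := fun x hx =>
      ⟨prefix_update h2 hx, fun r hr => by rw [if_neg (by omega), h3 r (by omega)]⟩
    have h52 : s.reg 41 + s.reg 47 + j * N + s.reg 23 = s.reg 41 + s.reg 47 + (j + 1) * N := by
      rw [hs.width]
      ring
    have h5j := h3 j le_rfl
    simp only [wp_seq, wp_load, wp_sub, wp_add, wp_ite, wp_const, wp_store, wp_mov]
    simp only [State.setReg_reg, State.setReg_arr, State.setArr_reg, State.setArr_arr, h1, e2, hP,
      e53, hi]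
    refine ⟨fun hne => ⟨fun h => ?_, fun h => ?_⟩, fun h => ?_⟩
    · have := hst 0 (by simp at h hne; rw [newWeight, if_neg hne, if_neg (by omega)])
      refine ⟨⟨by simpa [e23] using h52, ?_, ?_⟩, by omega⟩
      · simpa [-Order.lt_add_one_iff] using this.1
      · simpa [-Order.add_one_le_iff] using this.2
    · refine wp_mulProg fun s₂ k hf₂ h10 hk => ?_
      have f23 := hf₂.reg 23 rfl
      have f46 := hf₂.reg 46 rfl
      have f52 := hf₂.reg 52 rfl
      have f5 := hf₂.arr 5 rfl
      simp [e23, h1, hi, h5j, ec, hs.colors] at f23 f46 f52 f5 h10 hk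
      simp at h hne
      have := hst (s.arr 5 j * c) (by
        rw [newWeight, if_neg hne, if_pos (by omega)])
      refine ⟨⟨by simpa [f52, f23] using h52, ?_, ?_⟩, by omega⟩
      · simpa [-Order.lt_add_one_iff, f46, f5, h10] using this.1
      · simpa [-Order.add_one_le_iff, f46, f5, h10] using this.2
    · have h' : P j (s.reg 47) = 0 := by simpa using h
      refine ⟨⟨by simpa [e23] using h52, ?_, ?_⟩, by omega⟩
      · intro r hr
        rcases Nat.lt_succ_iff_lt_or_eq.1 hr with hr | rfl
        · exact h2 r hr
        · rw [newWeight, if_pos h']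
          exact h5j
      · exact fun r hr => h3 r (by omega)
  · rintro s₁ k - ⟨-, h2, -⟩ hk
    exact ⟨h2, by rw [show 5 * c + 19 = 5 * c + 15 + 4 by omega]; omega⟩

/-- For a row with d prescribed values, `rowWeight` is the initial weight times c^d times the
probability that the row is matched when the remaining columns are coloured uniformly at random.
Taking the heaviest colour in each column keeps the sum of these quantities from decreasing. -/
theorem wp_colorColumns {s : State} (hs : GreedyInput P R N c s)
    (hPc : ∀ r, r < R → ∀ u, u < N → P r u ≤ c) {Q : State → ℕ → Prop}
    (hQ : ∀ s' k f, Frame colorColumns s s' →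
      (∀ u, u < N → s'.arr 3 (s.reg 44 + u) = f u) →
      (∀ i, i < s.reg 44 → s'.arr 3 i = s.arr 3 i) →
      (∀ r, r < R → s'.arr 5 r = rowWeight c (s.arr 5 r) (P r) f N) →
      ∑ r ∈ Finset.range R, s.arr 5 r ≤
        ∑ r ∈ Finset.range R, rowWeight c (s.arr 5 r) (P r) f N →
      k ≤ 60 * ((N + 1) * ((c + 1) * (R + 1))) → Q s' k) :
    WP G w colorColumns s Q := by
  suffices key : WP G w colorColumns s fun s' k => ∃ f : ℕ → ℕ,
      (∀ u, u < N → s'.arr 3 (s.reg 44 + u) = f u) ∧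
      (∀ i, i < s.reg 44 → s'.arr 3 i = s.arr 3 i) ∧
      (∀ r, r < R → s'.arr 5 r = rowWeight c (s.arr 5 r) (P r) f N) ∧
      ∑ r ∈ Finset.range R, s.arr 5 r ≤
        ∑ r ∈ Finset.range R, rowWeight c (s.arr 5 r) (P r) f N ∧
      k ≤ 60 * ((N + 1) * ((c + 1) * (R + 1))) from
    key.imp fun s' k hf ⟨f, h1, h2, h3, h4, h5⟩ => hQ s' k f hf h1 h2 h3 h4 h5
  refine wp_forLt (fun j s' => ∃ f : ℕ → ℕ,
      (∀ u, u < j → s'.arr 3 (s.reg 44 + u) = f u) ∧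
      (∀ i, i < s.reg 44 → s'.arr 3 i = s.arr 3 i) ∧
      (∀ r, r < R → s'.arr 5 r = rowWeight c (s.arr 5 r) (P r) f j) ∧
      ∑ r ∈ Finset.range R, s.arr 5 r ≤
        ∑ r ∈ Finset.range R, rowWeight c (s.arr 5 r) (P r) f j)
    (c * (12 * R + 17) + R * (5 * c + 19) + 13) N hs.width (by decide) rfl rfl (by simp)
    ⟨fun _ => 0, by simp [rowWeight_zero]⟩ ?_ ?_
  · rintro j s₁ hj hi hm hf ⟨f, h1, h2, h3, h4⟩
    have hs₁ := hs.of_frame hf rfl rfl rfl rfl rfl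
    have e44 := hf.reg 44 rfl
    simp only [wp_seq]
    refine wp_bestColor hs₁ (by omega) fun s₂ k₂ hf₂ hbest hk₂ => ?_
    have hs₂ := hs₁.of_frame hf₂ rfl rfl rfl rfl rfl
    simp only [wp_add, wp_store]
    set y := s₂.reg 49 with hy
    have e44' := hf₂.reg 44 rfl
    have e47' := hf₂.reg 47 rfl
    have e3' := hf₂.arr 3 rfl
    have e5' := hf₂.arr 5 rfl
    refine wp_updateWeights (P := P) (R := R) (N := N) (c := c) ⟨by simpa using hs₂.width,
      by simpa using hs₂.colors, by simpa using hs₂.length, by simpa using hs₂.rows⟩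
      (by simp [e47', hi, hj]) fun s₃ k₃ hf₃ h5 hk₃ => ?_
    have e3'' := hf₃.arr 3 rfl
    simp [e5', e47', hi] at h5
    set f' := Function.update f j y with hf'
    have hff : ∀ u, u < j → f u = f' u := fun u hu => by
      rw [hf', Function.update_of_ne (by omega)]
    have hrw : ∀ r, rowWeight c (s.arr 5 r) (P r) f' (j + 1) =
        newWeight c (rowWeight c (s.arr 5 r) (P r) f j) (P r j) y := by
      intro r
      rw [rowWeight_succ, ← rowWeight_congr hff, hf', Function.update_self]
    refine ⟨⟨f', ?_, ?_, ?_, ?_⟩, by omega⟩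
    · intro u hu
      rw [e3'']
      simp [e44', e44, e47', hi, e3', ← hy]
      refine prefix_update (f := fun u => s₁.arr 3 (s.reg 44 + u)) (g := f')
        (fun u hu => (h1 u hu).trans (hff u hu)) (by simp [hf']) u hu
    · intro i hi'
      rw [e3'']
      simp [e44', e44, e47', hi, e3']
      rw [if_neg (by omega), h2 i hi']
    · intro r hr
      rw [h5 r hr, hrw, h3 r hr]
    · refine h4.trans ?_
      simp only [hrw]
      refine sum_le_sum_newWeight (fun r hr => hPc r hr j hj) fun y' hy' => ?_
      have := hbest y' hy'
      rw [hi] at this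
      refine le_of_eq_of_le ?_ (this.trans_eq ?_)
      all_goals
        refine Finset.sum_congr rfl fun r hr => ?_
        rw [h3 r (Finset.mem_range.1 hr)]
  · rintro s₁ k hf ⟨f, h1, h2, h3, h4⟩ hk
    refine ⟨f, h1, h2, h3, h4, hk.trans ?_⟩
    nlinarith [Nat.zero_le (c * R), Nat.zero_le (N * (c * R)), Nat.zero_le (N * c),
      Nat.zero_le (N * R)]

/-- The bookkeeping of the rows that are not matched yet. -/
theorem wp_updateAlive {s : State} (hR : s.reg 42 = R) {Q : State → ℕ → Prop}
    (hQ : ∀ s' k, Frame updateAlive s s' →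
      (∀ r, r < R → s'.arr 6 r = if s.arr 5 r = 0 then s.arr 6 r else 0) →
      s'.reg 45 = ∑ r ∈ Finset.range R, (if s.arr 5 r = 0 then s.arr 6 r else 0) →
      k ≤ 9 * R + 4 → Q s' k) : WP G w updateAlive s Q := by
  suffices key : WP G w updateAlive s fun s' k =>
      (∀ r, r < R → s'.arr 6 r = if s.arr 5 r = 0 then s.arr 6 r else 0) ∧
      s'.reg 45 = ∑ r ∈ Finset.range R, (if s.arr 5 r = 0 then s.arr 6 r else 0) ∧
      k ≤ 9 * R + 4 from key.imp fun s' k hf hq => hQ s' k hf hq.1 hq.2.1 hq.2.2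
  simp only [updateAlive, wp_seq, wp_const]
  refine wp_forLt (fun j s' =>
    (∀ r, r < j → s'.arr 6 r = if s.arr 5 r = 0 then s.arr 6 r else 0) ∧
    (∀ r, j ≤ r → s'.arr 6 r = s.arr 6 r) ∧
    s'.reg 45 = ∑ r ∈ Finset.range j, (if s.arr 5 r = 0 then s.arr 6 r else 0)) 5 R
    (by simpa using hR) (by decide) rfl rfl (by simp) (by simp) ?_ ?_
  · rintro j s₁ hj hi hm hf ⟨h1, h2, h3⟩
    have e5 := hf.arr 5 rfl
    simp at e5
    simp only [wp_seq, wp_load, wp_ite, wp_const, wp_store, wp_add, Finset.sum_range_succ]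
    simp only [State.setReg_reg, State.setReg_arr, State.setArr_reg, State.setArr_arr, hi, e5]
    refine ⟨fun h => ?_, fun h => ?_⟩
    · have h' : s.arr 5 j ≠ 0 := by simpa using h
      refine ⟨⟨?_, ?_, by simp [h3, h']⟩, by omega⟩
      · simpa using prefix_update h1 (x := 0) (by simp [h'])
      · intro r hr
        simp
        rw [if_neg (by omega), h2 r (by omega)]
    · have h' : s.arr 5 j = 0 := by simpa using h
      refine ⟨⟨?_, fun r hr => h2 r (by omega), by simp [h3, h', h2 j le_rfl]⟩, by omega⟩
      intro r hr
      rcases Nat.lt_succ_iff_lt_or_eq.1 hr with hr | rfl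
      · exact h1 r hr
      · simp [h2 r le_rfl, h']
  · rintro s₁ k - ⟨h1, h2, h3⟩ hk
    exact ⟨h1, h3, by omega⟩

/-- The round starts with weight one on each uncovered row and zero on the covered ones. At the end
only matched rows have positive weight, at most `c ^ m` times the initial one. As the total has not
dropped, at least a fraction `1 / c ^ m` of the uncovered rows is newly matched. -/
theorem wp_greedyRound {s : State} {m : ℕ} (hs : GreedyInput P R N c s) (hc : 1 ≤ c)
    (hPc : ∀ r, r < R → ∀ u, u < N → P r u ≤ c)
    (hPm : ∀ r, r < R → ((Finset.range N).filter fun u => P r u ≠ 0).card ≤ m)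
    {Q : State → ℕ → Prop}
    (hQ : ∀ s' k f, Frame greedyRound s s' →
      (∀ u, u < N → s'.arr 3 (s.reg 44 + u) = f u) →
      (∀ i, i < s.reg 44 → s'.arr 3 i = s.arr 3 i) →
      s'.reg 44 = s.reg 44 + N → s'.reg 43 = s.reg 43 + 1 →
      (∀ r, r < R → s'.arr 6 r ≤ s.arr 6 r) →
      (∀ r, r < R → s'.arr 6 r = 0 → s.arr 6 r = 0 ∨ Matches f (P r) N) →
      s'.reg 45 = ∑ r ∈ Finset.range R, s'.arr 6 r →
      ∑ r ∈ Finset.range R, s.arr 6 r ≤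
        c ^ m * (∑ r ∈ Finset.range R, s.arr 6 r - ∑ r ∈ Finset.range R, s'.arr 6 r) →
      k ≤ 75 * ((N + 1) * ((c + 1) * (R + 1))) → Q s' k) :
    WP G w greedyRound s Q := by
  suffices key : WP G w greedyRound s fun s' k => ∃ f : ℕ → ℕ,
      (∀ u, u < N → s'.arr 3 (s.reg 44 + u) = f u) ∧
      (∀ i, i < s.reg 44 → s'.arr 3 i = s.arr 3 i) ∧
      s'.reg 44 = s.reg 44 + N ∧ s'.reg 43 = s.reg 43 + 1 ∧
      (∀ r, r < R → s'.arr 6 r = if rowWeight c (s.arr 6 r) (P r) f N = 0 then s.arr 6 r else 0) ∧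
      s'.reg 45 = ∑ r ∈ Finset.range R, s'.arr 6 r ∧
      ∑ r ∈ Finset.range R, s.arr 6 r ≤
        ∑ r ∈ Finset.range R, rowWeight c (s.arr 6 r) (P r) f N ∧
      k ≤ 75 * ((N + 1) * ((c + 1) * (R + 1))) by
    refine key.imp fun s' k hf ⟨f, h1, h2, h3, h4, h5, h6, h7, h8⟩ =>
      hQ s' k f hf h1 h2 h3 h4 ?_ ?_ h6 (h7.trans ?_) h8
    · intro r hr
      rw [h5 r hr]
      split_ifs <;> simp
    · intro r hr h0
      rw [h5 r hr] at h0
      split_ifs at h0 with h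
      · exact Or.inl h0
      · exact Or.inr ((rowWeight_ne_zero hc).1 h).1
    · have hsub : ∑ r ∈ Finset.range R, s.arr 6 r - ∑ r ∈ Finset.range R, s'.arr 6 r =
          ∑ r ∈ Finset.range R,
            (if rowWeight c (s.arr 6 r) (P r) f N = 0 then 0 else s.arr 6 r) := by
        rw [Nat.sub_eq_iff_eq_add, ← Finset.sum_add_distrib]
        · refine Finset.sum_congr rfl fun r hr => ?_
          rw [h5 r (Finset.mem_range.1 hr)]
          split_ifs <;> simp
        · refine Finset.sum_le_sum fun r hr => ?_
          rw [h5 r (Finset.mem_range.1 hr)]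
          split_ifs <;> simp
      rw [hsub, Finset.mul_sum]
      refine Finset.sum_le_sum fun r hr => ?_
      split_ifs with h
      · simp [h]
      · exact rowWeight_le hc (hPm r (Finset.mem_range.1 hr))
  simp only [greedyRound, wp_seq]
  refine wp_forLt (fun j s' => ∀ r, r < j → s'.arr 5 r = s.arr 6 r) 2 R hs.length (by decide) rfl rfl
    (by simp) (by simp) ?_ ?_
  · rintro j s₁ hj hi hm hf h1
    have e6 := hf.arr 6 rfl
    simp only [wp_seq, wp_load, wp_store]
    refine ⟨?_, by omega⟩
    simpa [-Order.lt_add_one_iff, hi, e6] using prefix_update h1 (x := s.arr 6 j) rfl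
  intro s₁ k₁ hf₁ h5 hk₁
  have hs₁ := hs.of_frame hf₁ rfl rfl rfl rfl rfl
  have e44 := hf₁.reg 44 rfl
  have e3 := hf₁.arr 3 rfl
  have e6 := hf₁.arr 6 rfl
  have e43 := hf₁.reg 43 rfl
  refine wp_colorColumns hs₁ hPc fun s₂ k₂ f hf₂ g1 g2 g3 g4 hk₂ => ?_
  have hs₂ := hs₁.of_frame hf₂ rfl rfl rfl rfl rfl
  have f44 := hf₂.reg 44 rfl
  have f6 := hf₂.arr 6 rfl
  have f43 := hf₂.reg 43 rfl
  simp only [wp_add, wp_const]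
  refine wp_updateAlive (R := R) (by simpa using hs₂.length) fun s₃ k₃ hf₃ q1 q2 hk₃ => ?_
  have i44 := hf₃.reg 44 rfl
  have i43 := hf₃.reg 43 rfl
  have i3 := hf₃.arr 3 rfl
  simp [f44, f43, e44, e43, hs₂.width, f6, e6] at i44 i43 i3 q1 q2
  have hw : ∀ r, r < R → s₂.arr 5 r = rowWeight c (s.arr 6 r) (P r) f N := by
    intro r hr
    rw [g3 r hr, h5 r hr]
  refine ⟨f, ?_, ?_, i44, i43, ?_, ?_, ?_, ?_⟩
  · intro u hu
    rw [i3, ← e44]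
    exact g1 u hu
  · intro i hi
    rw [i3, g2 i (by omega), e3]
  · intro r hr
    rw [q1 r hr, hw r hr]
  · rw [q2]
    exact Finset.sum_congr rfl fun r hr => (q1 r (Finset.mem_range.1 hr)).symm
  · refine le_of_eq_of_le (Finset.sum_congr rfl fun r hr => ?_) (g4.trans_eq
      (Finset.sum_congr rfl fun r hr => ?_))
    · rw [h5 r (Finset.mem_range.1 hr)]
    · rw [h5 r (Finset.mem_range.1 hr)]
  · nlinarith [Nat.zero_le (c * R), Nat.zero_le (N * (c * R)), Nat.zero_le (N * c),
      Nat.zero_le (N * R)]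

/-- Each round leaves at most the fraction 1 - c^(-m) ≤ exp(-c^(-m)) of the uncovered rows. After j
rounds at most R · exp(-j / c^m) are left, and once this is below one, nothing is left. -/
theorem wp_greedyProg {s : State} {m : ℕ} (hs : GreedyInput P R N c s) (hc : 1 ≤ c)
    (hPc : ∀ r, r < R → ∀ u, u < N → P r u ≤ c)
    (hPm : ∀ r, r < R → ((Finset.range N).filter fun u => P r u ≠ 0).card ≤ m)
    {Q : State → ℕ → Prop}
    (hQ : ∀ s' k F, Frame greedyProg s s' → Holds (s'.arr 3) 0 N F → s'.reg 43 = F.length →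
      F.length ≤ c ^ m * Nat.size R + 1 → (∀ r, r < R → ∃ f ∈ F, Matches f (P r) N) →
      k ≤ (c ^ m * Nat.size R + 2) * (90 * ((N + 1) * ((c + 1) * (R + 1)))) → Q s' k) :
    WP G w greedyProg s Q := by
  set J := c ^ m * Nat.size R + 1 with hJ
  suffices key : WP G w greedyProg s fun s' k => ∃ F : List (ℕ → ℕ),
      Holds (s'.arr 3) 0 N F ∧ s'.reg 43 = F.length ∧
      F.length ≤ J ∧ (∀ r, r < R → ∃ f ∈ F, Matches f (P r) N) ∧
      k ≤ (J + 1) * (90 * ((N + 1) * ((c + 1) * (R + 1)))) from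
    key.imp fun s' k hf ⟨F, h1, h2, h3, h4, h5⟩ => hQ s' k F hf h1 h2 h3 h4 h5
  have hM : (0 : ℝ) < (c : ℝ) ^ m := by positivity
  simp only [greedyProg, wp_seq, wp_const]
  have hs0 : GreedyInput P R N c ((s.setReg 43 0).setReg 44 0) :=
    ⟨by simpa using hs.width, by simpa using hs.colors, by simpa using hs.length, by simpa using hs.rows⟩
  refine wp_forLt (fun j s' => ∀ r, r < j → s'.arr 6 r = 1) 2 R hs0.length (by decide) rfl rfl
    (by simp) (by simp) ?_ ?_
  · rintro j s₁ hj hi hm hf h1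
    simp only [wp_seq, wp_const, wp_store]
    refine ⟨?_, by omega⟩
    simpa [-Order.lt_add_one_iff, hi] using prefix_update h1 (x := 1) rfl
  intro s₁ k₁ hf₁ h6 hk₁
  have hs₁ := hs0.of_frame hf₁ rfl rfl rfl rfl rfl
  have e44 := hf₁.reg 44 rfl
  have e43 := hf₁.reg 43 rfl
  simp at e44 e43
  simp only [wp_mov]
  refine wp_loop (fun j s' => ∃ F : List (ℕ → ℕ), F.length = j ∧ s'.reg 43 = j ∧
      s'.reg 44 = j * N ∧ Holds (s'.arr 3) 0 N F ∧ (∀ r, r < R → s'.arr 6 r ≤ 1) ∧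
      (∀ r, r < R → s'.arr 6 r = 0 → ∃ f ∈ F, Matches f (P r) N) ∧
      s'.reg 45 = ∑ r ∈ Finset.range R, s'.arr 6 r ∧
      (s'.reg 45 : ℝ) ≤ R * Real.exp (-(j / (c : ℝ) ^ m)))
    J (75 * ((N + 1) * ((c + 1) * (R + 1)))) ?_ ?_ ?_ ?_
  · have hsum : ∑ r ∈ Finset.range R, s₁.arr 6 r = R := by
      rw [Finset.sum_congr rfl fun r hr => h6 r (Finset.mem_range.1 hr)]
      simp
    refine ⟨[], rfl, by simpa using e43, by simpa using e44, Holds.nil _ _ _, ?_, ?_, ?_, ?_⟩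
    · intro r hr
      simp [h6 r hr]
    · intro r hr h
      simp [h6 r hr] at h
    · simpa [hs₁.length] using hsum.symm
    · simp [hs₁.length]
  · rintro j s' ⟨F, -, -, -, -, -, -, -, h⟩ hne
    have h1 : (1 : ℝ) ≤ s'.reg 45 := by exact_mod_cast Nat.one_le_iff_ne_zero.2 hne
    have h2 := h1.trans h
    have h3 : Real.exp (j / (c : ℝ) ^ m) ≤ R := by
      rw [Real.exp_neg] at h2
      have := Real.exp_pos (j / (c : ℝ) ^ m)
      rw [← div_eq_mul_inv, le_div_iff₀ this] at h2
      linarith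
    -- As 2 ≤ e, the binary length, a natural number, can replace the natural logarithm of `R`.
    have h4 : (R : ℝ) < Real.exp (Nat.size R) := by
      have h5 : (R : ℝ) < 2 ^ Nat.size R := by exact_mod_cast Nat.lt_size_self R
      refine h5.trans_le ?_
      rw [← Real.exp_one_pow]
      exact pow_le_pow_left₀ (by norm_num) (by linarith [Real.add_one_le_exp 1]) _
    have h5 := Real.exp_lt_exp.1 (h3.trans_lt h4)
    rw [div_lt_iff₀ hM] at h5
    have h6 : j < Nat.size R * c ^ m := by exact_mod_cast h5
    rw [hJ, mul_comm]
    omega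
  · rintro j s' hf ⟨F, h1, h2, h3, h4, h5, h6, h7, h8⟩ hne
    have hs' : GreedyInput P R N c s' := by
      refine GreedyInput.of_frame (s := (s₁.setReg 3 0).setReg 45 (s₁.reg 42))
        ⟨by simpa using hs₁.width, by simpa using hs₁.colors, by simpa using hs₁.length, by simpa using hs₁.rows⟩
        (by simpa using hf) rfl rfl rfl rfl rfl
    refine wp_greedyRound hs' hc hPc hPm fun s'' k f _ g1 g2 g3 g4 g5 g6 g7 g8 hk => ?_
    refine ⟨⟨F ++ [f], by simp [h1], by rw [g4, h2], by rw [g3, h3]; ring, ?_, ?_, ?_, g7, ?_⟩, hk⟩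
    · refine Holds.append (h4.congr ?_) ?_
      · intro i _ hi
        exact g2 i (by rw [h3, ← h1]; omega)
      · intro u hu
        rw [h1, zero_add, ← h3]
        exact g1 u hu
    · exact fun r hr => (g5 r hr).trans (h5 r hr)
    · intro r hr h0
      rcases g6 r hr h0 with h | h
      · obtain ⟨f', hf', hm'⟩ := h6 r hr h
        exact ⟨f', by simp [hf'], hm'⟩
      · exact ⟨f, by simp, h⟩
    · rw [← h7, ← g7] at g8
      -- The truncated difference in `g8` is a true one: otherwise its right-hand side would vanish
      -- while rows are still uncovered.
      have hle : s''.reg 45 ≤ s'.reg 45 := by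
        by_contra hlt
        rw [Nat.sub_eq_zero_of_le (by omega)] at g8
        omega
      have g9 : (s'.reg 45 : ℝ) ≤ (c : ℝ) ^ m * (s'.reg 45 - s''.reg 45) := by
        have := (Nat.cast_le (α := ℝ)).2 g8
        push_cast [Nat.cast_sub hle] at this
        exact this
      have g10 : (s''.reg 45 : ℝ) ≤ s'.reg 45 * (1 - 1 / (c : ℝ) ^ m) := by
        rw [← sub_nonneg] at g9 ⊢
        have := div_nonneg g9 hM.le
        field_simp at this ⊢
        linarith
      have g11 : 1 - 1 / (c : ℝ) ^ m ≤ Real.exp (-(1 / (c : ℝ) ^ m)) := by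
        linarith [Real.add_one_le_exp (-(1 / (c : ℝ) ^ m))]
      calc (s''.reg 45 : ℝ) ≤ s'.reg 45 * (1 - 1 / (c : ℝ) ^ m) := g10
        _ ≤ s'.reg 45 * Real.exp (-(1 / (c : ℝ) ^ m)) :=
          mul_le_mul_of_nonneg_left g11 (Nat.cast_nonneg _)
        _ ≤ R * Real.exp (-(j / (c : ℝ) ^ m)) * Real.exp (-(1 / (c : ℝ) ^ m)) :=
          mul_le_mul_of_nonneg_right h8 (Real.exp_pos _).le
        _ = R * Real.exp (-((j + 1 : ℕ) / (c : ℝ) ^ m)) := by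
          rw [mul_assoc, ← Real.exp_add]
          congr 2
          push_cast
          ring
  · rintro j s' k hf ⟨F, h1, h2, h3, h4, h5, h6, h7, h8⟩ h0 hj hk
    refine ⟨F, h4, by rw [h2, h1], by omega, fun r hr => h6 r hr ?_, ?_⟩
    · rw [h0] at h7
      exact (Finset.sum_eq_zero_iff.1 h7.symm) r (Finset.mem_range.2 hr)
    · set X := (N + 1) * ((c + 1) * (R + 1)) with hX
      have hX1 : R + 1 ≤ X := by
        rw [hX]
        nlinarith [Nat.zero_le (c * R), Nat.zero_le (N * (c * R)), Nat.zero_le (N * c),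
          Nat.zero_le (N * R)]
      have : j * (75 * X + 1) ≤ J * (75 * X + 1) := Nat.mul_le_mul_right _ hj
      nlinarith

end

/-! ### Universality of the tables -/

/-- Every function with values in `A` on a subset of `{0, …, N - 1}` of size at most `s` is the
restriction of a function in `F`. -/
def Universal (N s : ℕ) (A : ℕ → Prop) (F : List (ℕ → ℕ)) : Prop :=
  ∀ (S : Finset ℕ) (g : ℕ → ℕ), (∀ u ∈ S, u < N) → S.card ≤ s → (∀ u ∈ S, A (g u)) →
    ∃ f ∈ F, ∀ u ∈ S, f u = g u

/-- Take the least `x` with at most `b` elements from `x` on. Stepping back by one gains at most one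
element and yet exceeds `b`, so at least `b` elements lie from `x` on, and at most `a` are left
below. -/
theorem exists_cut {N a b : ℕ} {S : Finset ℕ} (hS : ∀ u ∈ S, u < N) (hc : S.card ≤ a + b) :
    ∃ x ≤ N, (S.filter fun u => u < x).card ≤ a ∧ (S.filter fun u => ¬ u < x).card ≤ b := by
  have hex : ∃ x, (S.filter fun u => ¬ u < x).card ≤ b := by
    refine ⟨N, ?_⟩
    rw [Finset.filter_eq_empty_iff.2]
    · simp
    · exact fun u hu => not_not.2 (hS u hu)
  classical
  refine ⟨Nat.find hex, Nat.find_min' hex ?_, ?_, Nat.find_spec hex⟩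
  · rw [Finset.filter_eq_empty_iff.2]
    · simp
    · exact fun u hu => not_not.2 (hS u hu)
  · rcases Nat.eq_zero_or_pos (Nat.find hex) with h0 | hpos
    · rw [h0]
      simp
    · have hmin := Nat.find_min hex (m := Nat.find hex - 1) (by omega)
      have hsub : (S.filter fun u => ¬ u < Nat.find hex - 1) ⊆
          insert (Nat.find hex - 1) (S.filter fun u => ¬ u < Nat.find hex) := by
        intro u hu
        rw [Finset.mem_filter] at hu
        rw [Finset.mem_insert, Finset.mem_filter]
        by_cases h : u = Nat.find hex - 1
        · exact Or.inl h
        · exact Or.inr ⟨hu.1, by omega⟩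
      have h1 := (Finset.card_le_card hsub).trans (Finset.card_insert_le _ _)
      have h2 := Finset.card_filter_add_card_filter_not (s := S) fun u => u < Nat.find hex
      omega

theorem mem_chainStep {N : ℕ} {F old : List (ℕ → ℕ)} {f : ℕ → ℕ} :
    f ∈ chainStep N F old ↔ ∃ g ∈ old, ∃ x ≤ N, ∃ f' ∈ F, cut g x f' = f := by
  simp [chainStep, List.mem_flatMap]

/-- Cut the set into `a` points below some `x` and `b` points from `x` on; the two families serve
the two parts independently, and all cut points are tried. -/
theorem Universal.chainStep {N a b : ℕ} {A : ℕ → Prop} {F old : List (ℕ → ℕ)}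
    (ho : Universal N a A old) (hF : Universal N b A F) :
    Universal N (a + b) A (chainStep N F old) := by
  intro S g hS hc hA
  obtain ⟨x, hx, h1, h2⟩ := exists_cut hS hc
  obtain ⟨f₁, hf₁, e₁⟩ := ho _ g (fun u hu => hS u (Finset.mem_filter.1 hu).1) h1
    fun u hu => hA u (Finset.mem_filter.1 hu).1
  obtain ⟨f₂, hf₂, e₂⟩ := hF _ g (fun u hu => hS u (Finset.mem_filter.1 hu).1) h2
    fun u hu => hA u (Finset.mem_filter.1 hu).1
  refine ⟨_, mem_chainStep.2 ⟨f₁, hf₁, x, hx, f₂, hf₂, rfl⟩, fun u hu => ?_⟩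
  unfold cut
  split_ifs with h
  · exact e₁ u (Finset.mem_filter.2 ⟨hu, h⟩)
  · exact e₂ u (Finset.mem_filter.2 ⟨hu, h⟩)

theorem Universal.chainRows {N b : ℕ} {A : ℕ → Prop} {F : List (ℕ → ℕ)}
    (hF : Universal N b A F) (k : ℕ) : Universal N (k * b) A (chainRows N F k) := by
  induction k with
  | zero =>
    intro S g _ hc _
    rw [zero_mul, Nat.le_zero, Finset.card_eq_zero] at hc
    subst hc
    exact ⟨fun _ => 0, by simp [RAM.chainRows], by simp⟩
  | succ k ih =>
    rw [chainRows_succ, add_mul, one_mul]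
    exact ih.chainStep hF

theorem mem_pointRows {N c : ℕ} {f : ℕ → ℕ} :
    f ∈ pointRows N c ↔ ∃ x < N, ∃ y < c, (fun u => if u = x then y + 1 else 0) = f := by
  simp [pointRows]

theorem universal_pointRows {N c : ℕ} (hN : 1 ≤ N) (hc : 1 ≤ c) :
    Universal N 1 (fun y => 1 ≤ y ∧ y ≤ c) (pointRows N c) := by
  intro S g hS h1 hA
  rcases Nat.le_one_iff_eq_zero_or_eq_one.1 h1 with h | h
  · rw [Finset.card_eq_zero] at h
    subst h
    exact ⟨_, mem_pointRows.2 ⟨0, hN, 0, hc, rfl⟩, by simp⟩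
  -- Rows store values increased by one, so the wanted value `g x` corresponds to the index `g x -
  -- 1`.
  · obtain ⟨x, rfl⟩ := Finset.card_eq_one.1 h
    have h2 := hA x (by simp)
    refine ⟨_, mem_pointRows.2 ⟨x, hS x (by simp), g x - 1, by omega, rfl⟩, fun u hu => ?_⟩
    rw [Finset.mem_singleton] at hu
    subst hu
    simp only [if_true]
    omega

theorem le_of_mem_chainRows_pointRows {N c k : ℕ} {p : ℕ → ℕ}
    (hp : p ∈ chainRows N (pointRows N c) k) (u : ℕ) : p u ≤ c := by
  induction k generalizing p u with
  | zero =>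
    simp only [chainRows, Function.iterate_zero, id_eq, List.mem_singleton] at hp
    simp [hp]
  | succ k ih =>
    rw [chainRows_succ, mem_chainStep] at hp
    obtain ⟨g, hg, x, -, f, hf, rfl⟩ := hp
    unfold cut
    split_ifs
    · exact ih hg u
    · obtain ⟨_, _, y, hy, rfl⟩ := mem_pointRows.1 hf
      dsimp only
      split_ifs <;> omega

/-- Each chaining step adds at most one point to the support. This gives the greedy algorithm its
ratio `c ^ k`. -/
theorem card_support_chainRows_pointRows {N c k : ℕ} {p : ℕ → ℕ}
    (hp : p ∈ chainRows N (pointRows N c) k) :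
    ((Finset.range N).filter fun u => p u ≠ 0).card ≤ k := by
  induction k generalizing p with
  | zero =>
    simp only [chainRows, Function.iterate_zero, id_eq, List.mem_singleton] at hp
    simp [hp]
  | succ k ih =>
    rw [chainRows_succ, mem_chainStep] at hp
    obtain ⟨g, hg, x, -, f, hf, rfl⟩ := hp
    obtain ⟨z, _, y, hy, rfl⟩ := mem_pointRows.1 hf
    have hsub : ((Finset.range N).filter fun u =>
        cut g x (fun u => if u = z then y + 1 else 0) u ≠ 0) ⊆
        insert z ((Finset.range N).filter fun u => g u ≠ 0) := by
      intro u hu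
      rw [Finset.mem_filter] at hu
      rw [Finset.mem_insert, Finset.mem_filter]
      by_cases h : u = z
      · exact Or.inl h
      · refine Or.inr ⟨hu.1, ?_⟩
        have := hu.2
        unfold cut at this
        split_ifs at this
        · exact this
        · simp [h] at this
    have h1 := (Finset.card_le_card hsub).trans (Finset.card_insert_le _ _)
    have h2 := ih hg
    omega

/-- The chained point functions include, for each set of at most `m` points and each colouring of
it, a partial colouring that prescribes it. A function matching all of them is therefore not needed:
one match for each suffices. Colours are shifted by one, as `0` means undefined. -/
theorem universal_of_matches {N c m : ℕ} (hN : 1 ≤ N) (hc : 1 ≤ c) {F : List (ℕ → ℕ)}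
    (hF : ∀ p ∈ chainRows N (pointRows N c) m, ∃ f ∈ F, Matches f p N) :
    Universal N m (· < c) F := by
  intro S g hS hs hA
  obtain ⟨p, hp, e⟩ := (universal_pointRows hN hc).chainRows m S (fun u => g u + 1) hS
    (by simpa using hs) fun u hu => by
      have := hA u hu
      omega
  obtain ⟨f, hf, hm⟩ := hF p hp
  refine ⟨f, hf, fun u hu => ?_⟩
  have h1 := hm u (hS u hu)
  rw [e u hu] at h1
  omega

/-! ### Hashing by remainders -/

/-- Let D be the product of all differences of elements of `S`, at most 2^(a·L²) = 2^(h-1) with h =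
a·L² + 1. If no m ≤ 2h were injective on `S`, all of them would divide D. Then the central binomial
coefficient of h would divide D too, contradicting its lower bound 4^h / (2h). -/
theorem exists_mod_injOn {a L : ℕ} {S : Finset ℕ} (hS : ∀ u ∈ S, u < 2 ^ a) (hc : S.card ≤ L) :
    ∃ m, 1 ≤ m ∧ m ≤ 2 * (a * (L * L) + 1) ∧ Set.InjOn (· % m) (S : Set ℕ) := by
  by_contra! hcon
  set D := ∏ q ∈ (S ×ˢ S).filter (fun q => q.1 < q.2), (q.2 - q.1) with hD
  have hD0 : D ≠ 0 := by
    rw [hD, Finset.prod_ne_zero_iff]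
    intro q hq
    have := (Finset.mem_filter.1 hq).2
    omega
  have hDle : D ≤ 2 ^ (a * (L * L)) := by
    calc D ≤ ∏ q ∈ (S ×ˢ S).filter (fun q => q.1 < q.2), 2 ^ a := by
          refine Finset.prod_le_prod' fun q hq => ?_
          have h1 := hS q.2 (Finset.mem_product.1 (Finset.mem_filter.1 hq).1).2
          omega
      _ = 2 ^ (a * ((S ×ˢ S).filter (fun q => q.1 < q.2)).card) := by
          rw [Finset.prod_const, pow_mul]
      _ ≤ 2 ^ (a * (L * L)) := by
          refine Nat.pow_le_pow_right (by omega) (Nat.mul_le_mul_left _ ?_)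
          refine (Finset.card_filter_le _ _).trans ?_
          rw [Finset.card_product]
          exact Nat.mul_le_mul hc hc
  have hdvd : ∀ m, 1 ≤ m → m ≤ 2 * (a * (L * L) + 1) → m ∣ D := by
    intro m h1 h2
    have h3 := hcon m h1 h2
    simp only [Set.InjOn, Finset.mem_coe, not_forall] at h3
    obtain ⟨u, hu, v, hv, he, hne⟩ := h3
    rcases Nat.lt_or_gt_of_ne hne with h | h
    · exact ((Nat.modEq_iff_dvd' h.le).1 he).trans
        (Finset.dvd_prod_of_mem (fun q : ℕ × ℕ => q.2 - q.1) (a := (u, v)) (by simp [hu, hv, h]))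
    · exact ((Nat.modEq_iff_dvd' h.le).1 he.symm).trans
        (Finset.dvd_prod_of_mem (fun q : ℕ × ℕ => q.2 - q.1) (a := (v, u)) (by simp [hu, hv, h]))
  set h := a * (L * L) + 1 with hh
  have hcb : Nat.centralBinom h ∣ D := by
    -- The full power of a prime in the binomial coefficient of `2h` over `h` is at most `2h`, so it
    -- is one of the moduli that divide `D`.
    rw [← Nat.factorization_prime_le_iff_dvd (Nat.centralBinom_ne_zero h) hD0]
    intro p hp
    rw [← hp.pow_dvd_iff_le_factorization hD0]
    refine hdvd _ (Nat.pow_pos hp.pos) ?_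
    rw [Nat.centralBinom_eq_two_mul_choose]
    exact Nat.pow_factorization_choose_le (by omega)
  have h1 := Nat.le_of_dvd (Nat.pos_of_ne_zero hD0) hcb
  have h2 := Nat.four_pow_le_two_mul_self_mul_centralBinom h (by omega)
  have h3 : h < 2 ^ h := Nat.lt_two_pow_self
  have h4 : 4 ^ h = 2 ^ h * 2 ^ h := by rw [← mul_pow]; norm_num
  have h5 : 2 * 2 ^ (a * (L * L)) = 2 ^ h := by rw [hh, pow_succ, mul_comm]
  have h6 : 2 * h * Nat.centralBinom h ≤ h * (2 * 2 ^ (a * (L * L))) := by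
    calc 2 * h * Nat.centralBinom h ≤ 2 * h * 2 ^ (a * (L * L)) :=
          Nat.mul_le_mul_left _ (h1.trans hDle)
      _ = _ := by ring
  rw [h5] at h6
  have h7 : h * 2 ^ h < 2 ^ h * 2 ^ h := Nat.mul_lt_mul_of_pos_right h3 (by positivity)
  omega

/-- The range of the moduli for sets of at most `L` numbers smaller than `x`. -/
def hashBound (x L : ℕ) : ℕ := 2 * (Nat.size x * (L * L) + 1)

/-- One modulus would leave a range of order log n, and the table size has this range to the power
√ℓ, which is too much. Hashing the residues again reduces the dependence to log log n. -/
theorem exists_mod_mod_injOn {n L : ℕ} {S : Finset ℕ} (hS : ∀ u ∈ S, u < n) (hc : S.card ≤ L) :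
    ∃ m₁ m₂, 1 ≤ m₁ ∧ m₁ ≤ hashBound n L ∧ 1 ≤ m₂ ∧ m₂ ≤ hashBound (hashBound n L) L ∧
      Set.InjOn (fun u => u % m₁ % m₂) (S : Set ℕ) := by
  classical
  obtain ⟨m₁, h1, h2, h3⟩ := exists_mod_injOn
    (fun u hu => (hS u hu).trans (Nat.lt_size_self n)) hc
  obtain ⟨m₂, h4, h5, h6⟩ := exists_mod_injOn (S := S.image (· % m₁))
    (a := Nat.size (hashBound n L)) (L := L) (by
      intro u hu
      obtain ⟨v, _, rfl⟩ := Finset.mem_image.1 hu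
      exact ((Nat.mod_lt _ h1).trans_le h2).trans (Nat.lt_size_self _))
    (Finset.card_image_le.trans hc)
  refine ⟨m₁, m₂, h1, h2, h4, h5, ?_⟩
  intro u hu v hv he
  exact h3 hu hv (h6 (by simpa using ⟨u, hu, rfl⟩) (by simpa using ⟨v, hv, rfl⟩) he)

/-- Every colouring of a set of at most `L` vertices is found. -/
theorem exists_hash_coloring {n L c N : ℕ} (hN : hashBound (hashBound n L) L = N)
    {rows : List (ℕ → ℕ)} (hr : Universal N L (· < c) rows) {S : Finset (Fin n)}
    (hc : S.card ≤ L) {col : Fin n → ℕ} (hcol : ∀ v ∈ S, col v < c) :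
    ∃ m₁ m₂, m₁ < hashBound n L ∧ m₂ < N ∧ ∃ f ∈ rows,
      ∀ v ∈ S, f (v % (m₁ + 1) % (m₂ + 1)) = col v := by
  classical
  obtain ⟨m₁, m₂, h1, h2, h3, h4, h5⟩ := exists_mod_mod_injOn (n := n) (L := L)
    (S := S.map Fin.valEmbedding) (by simp) (by simpa using hc)
  have hinj : Set.InjOn (fun v : Fin n => v.val % m₁ % m₂) (S : Set (Fin n)) := by
    intro u hu v hv he
    exact Fin.ext (h5 (Finset.mem_coe.2 (Finset.mem_map_of_mem _ hu))
      (Finset.mem_coe.2 (Finset.mem_map_of_mem _ hv)) he)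
  -- The colouring is transported to the hash values by choosing preimages; by injectivity on `S`
  -- the choice is the only possible one.
  obtain ⟨f, hf, e⟩ := hr (S.image fun v : Fin n => v.val % m₁ % m₂)
    (fun u => if h : ∃ v ∈ S, v.val % m₁ % m₂ = u then col h.choose else 0)
    (by
      intro u hu
      obtain ⟨v, _, rfl⟩ := Finset.mem_image.1 hu
      exact (Nat.mod_lt _ h3).trans_le (hN ▸ h4))
    (Finset.card_image_le.trans hc)
    (by
      intro u hu
      have h : ∃ v ∈ S, v.val % m₁ % m₂ = u := by simpa using hu
      simp only [dif_pos h]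
      exact hcol _ h.choose_spec.1)
  -- The search loops count from zero, whereas moduli start at one.
  refine ⟨m₁ - 1, m₂ - 1, by omega, by omega, f, hf, fun v hv => ?_⟩
  rw [Nat.sub_add_cancel h1, Nat.sub_add_cancel h3, e _ (Finset.mem_image_of_mem _ hv)]
  have h : ∃ v' ∈ S, v'.val % m₁ % m₂ = v.val % m₁ % m₂ := ⟨v, hv, rfl⟩
  rw [dif_pos h, hinj h.choose_spec.1 hv h.choose_spec.2]

/-! ### The parameters and the table of colourings -/

/-- `r₂₀ := ⌈√r₁⌉`, `r₂₁ := r₂₀²`, and the ranges of the moduli in `r₂₂` and `r₂₃`. -/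
def paramProg : Prog :=
  sqrtProg ;; mov 11 21 ;; mov 12 21 ;; mulProg ;; mov 16 10 ;;
  mov 11 0 ;; sizeProg ;; mov 11 16 ;; mov 12 10 ;; mulProg ;; .const 3 1 ;; .add 22 10 3 ;;
  .add 22 22 22 ;;
  mov 11 22 ;; sizeProg ;; mov 11 16 ;; mov 12 10 ;; mulProg ;; .const 3 1 ;; .add 23 10 3 ;;
  .add 23 23 23

/-- Compute the table of colourings in array `4`. -/
def tableProg : Prog :=
  paramProg ;; pointProg ;; chainProg 2 1 ;; mov 41 29 ;; mov 42 28 ;; greedyProg ;; mov 27 43 ;;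
    chainProg 4 3

/-- A bound for the number of steps of `tableProg`, where `f` is the number of functions found by
the greedy algorithm. -/
def tableTime (n ℓ c k B N f : ℕ) : ℕ :=
  (7 * ℓ + 5 * (k * k) + 9 * Nat.size n + 9 * Nat.size B + 60) + (N * (c * 11 + 7) + 5) +
  40 * ((k + 1) * ((((N + 1) * (N * c + 1)) ^ k + 1) * ((N * c + 1) * (N + 1) * (N + 1)))) +
  (c ^ k * Nat.size (((N + 1) * (N * c)) ^ k) + 2) *
    (90 * ((N + 1) * ((c + 1) * (((N + 1) * (N * c)) ^ k + 1)))) +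
  40 * ((k + 1) * ((((N + 1) * (f + 1)) ^ k + 1) * ((f + 1) * (N + 1) * (N + 1)))) + 6

section

variable {n : ℕ} {G : SimpleGraph (Fin n)} {w : Fin n → ℕ}

theorem wp_paramProg {s : State} {Q : State → ℕ → Prop}
    (hQ : ∀ s' t k, Frame paramProg s s' → s.reg 1 ≤ k * k → k * k ≤ s.reg 1 + 2 * k →
      k ≤ s.reg 1 → s'.reg 20 = k → s'.reg 22 = hashBound (s.reg 0) (k * k) →
      s'.reg 23 = hashBound (hashBound (s.reg 0) (k * k)) (k * k) →
      t ≤ 7 * s.reg 1 + 5 * (k * k) + 9 * Nat.size (s.reg 0) +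
        9 * Nat.size (hashBound (s.reg 0) (k * k)) + 60 → Q s' t) :
    WP G w paramProg s Q := by
  suffices key : WP G w paramProg s fun s' t => ∃ k, s.reg 1 ≤ k * k ∧
      k * k ≤ s.reg 1 + 2 * k ∧ k ≤ s.reg 1 ∧ s'.reg 20 = k ∧
      s'.reg 22 = hashBound (s.reg 0) (k * k) ∧
      s'.reg 23 = hashBound (hashBound (s.reg 0) (k * k)) (k * k) ∧
      t ≤ 7 * s.reg 1 + 5 * (k * k) + 9 * Nat.size (s.reg 0) +
        9 * Nat.size (hashBound (s.reg 0) (k * k)) + 60 from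
    key.imp fun s' t hf ⟨k, h1, h2, h3, h4, h5, h6, h7⟩ => hQ s' t k hf h1 h2 h3 h4 h5 h6 h7
  simp only [paramProg, wp_seq, wp_mov, wp_const, wp_add]
  refine wp_sqrtProg fun s₁ t₁ k hf₁ h20 h21 hk₁ hk₂ hk₃ ht₁ => ?_
  have a0 := hf₁.reg 0 rfl
  refine wp_mulProg fun s₂ t₂ hf₂ hm₂ ht₂ => ?_
  have b0 := hf₂.reg 0 rfl
  have b20 := hf₂.reg 20 rfl
  simp [h21, h20, a0] at hm₂ ht₂ b0 b20
  refine wp_sizeProg fun s₃ t₃ hf₃ hm₃ ht₃ => ?_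
  have c16 := hf₃.reg 16 rfl
  have c20 := hf₃.reg 20 rfl
  simp [b0, hm₂, b20] at hm₃ ht₃ c16 c20
  refine wp_mulProg fun s₄ t₄ hf₄ hm₄ ht₄ => ?_
  have d16 := hf₄.reg 16 rfl
  have d20 := hf₄.reg 20 rfl
  simp [c16, hm₃, c20] at hm₄ ht₄ d16 d20
  have hB : k * k * (k * k) * Nat.size (s.reg 0) + 1 + (k * k * (k * k) * Nat.size (s.reg 0) + 1) =
      hashBound (s.reg 0) (k * k) := by
    rw [hashBound]
    ring
  refine wp_sizeProg fun s₅ t₅ hf₅ hm₅ ht₅ => ?_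
  have e16 := hf₅.reg 16 rfl
  have e20 := hf₅.reg 20 rfl
  have e22 := hf₅.reg 22 rfl
  simp [hm₄, hB, d16, d20] at hm₅ ht₅ e16 e20 e22
  refine wp_mulProg fun s₆ t₆ hf₆ hm₆ ht₆ => ?_
  have g20 := hf₆.reg 20 rfl
  have g22 := hf₆.reg 22 rfl
  simp [e16, hm₅, e20, e22] at hm₆ ht₆ g20 g22
  have hN : k * k * (k * k) * Nat.size (hashBound (s.reg 0) (k * k)) + 1 +
      (k * k * (k * k) * Nat.size (hashBound (s.reg 0) (k * k)) + 1) =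
      hashBound (hashBound (s.reg 0) (k * k)) (k * k) := by
    conv_rhs => rw [hashBound]
    ring
  refine ⟨k, hk₁, hk₂, hk₃, ?_, ?_, ?_, ?_⟩
  · simp [g20]
  · simp [g22]
  · simp [hm₆, hN]
  · clear * - ht₁ ht₂ ht₃ ht₄ ht₅ ht₆
    linarith

/-- Chaining is used twice: `k` point functions give all partial colourings to be covered, and `k`
functions of the greedy cover give a table universal for `k * k ≥ ℓ` points. Building only functions
for `k` points greedily keeps the cover instance small. -/
theorem wp_tableProg {s : State} {ℓ c : ℕ} (hn : s.reg 0 = n) (hℓ : s.reg 1 = ℓ)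
    (hc : s.reg 2 = c) (hc1 : 1 ≤ c) (h0 : ∀ a i, s.arr a i = 0) {Q : State → ℕ → Prop}
    (hQ : ∀ s' t k f rows, ∀ B N : ℕ, Frame tableProg s s' → ℓ ≤ k * k → k * k ≤ ℓ + 2 * k → k ≤ ℓ →
      hashBound n (k * k) = B → hashBound B (k * k) = N → s'.reg 22 = B → s'.reg 23 = N →
      s'.reg 28 = rows.length → Holds (s'.arr 4) (s'.reg 29) N rows →
      Universal N (k * k) (· < c) rows → rows.length = ((N + 1) * f) ^ k →
      f ≤ c ^ k * Nat.size (((N + 1) * (N * c)) ^ k) + 1 →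
      t ≤ tableTime n ℓ c k B N f → Q s' t) :
    WP G w tableProg s Q := by
  suffices key : WP G w tableProg s fun s' t => ∃ (k f : ℕ) (rows : List (ℕ → ℕ)) (B N : ℕ),
      ℓ ≤ k * k ∧ k * k ≤ ℓ + 2 * k ∧ k ≤ ℓ ∧
      hashBound n (k * k) = B ∧ hashBound B (k * k) = N ∧ s'.reg 22 = B ∧ s'.reg 23 = N ∧
      s'.reg 28 = rows.length ∧ Holds (s'.arr 4) (s'.reg 29) N rows ∧
      Universal N (k * k) (· < c) rows ∧ rows.length = ((N + 1) * f) ^ k ∧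
      f ≤ c ^ k * Nat.size (((N + 1) * (N * c)) ^ k) + 1 ∧
      t ≤ tableTime n ℓ c k B N f from
    key.imp fun s' t hf ⟨k, f, rows, B, N, h1, h2, h3, h4, h5, h6, h7, h8, h9, h10, h11, h12, h13⟩ =>
      hQ s' t k f rows B N hf h1 h2 h3 h4 h5 h6 h7 h8 h9 h10 h11 h12 h13
  simp only [tableProg, wp_seq, wp_mov]
  refine wp_paramProg fun s₁ t₁ k hf₁ hk₁ hk₂ hk₃ a20 a22 a23 ht₁ => ?_
  have a2 := hf₁.reg 2 rfl
  have aA : ∀ a i, s₁.arr a i = 0 := fun a i => by rw [hf₁.arr a rfl, h0]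
  rw [hn] at a22 a23 ht₁
  rw [hℓ] at ht₁ hk₁ hk₂ hk₃
  rw [hc] at a2
  set B := hashBound n (k * k) with hB
  set N := hashBound B (k * k) with hN
  have hN1 : 1 ≤ N := by
    rw [hN, hashBound]
    omega
  refine wp_pointProg a23 a2 (aA 1) fun s₂ t₂ hf₂ b1 b27 ht₂ => ?_
  have b23 := hf₂.reg 23 rfl
  have b20 := hf₂.reg 20 rfl
  have b2 := hf₂.reg 2 rfl
  have b22 := hf₂.reg 22 rfl
  have bA4 := hf₂.arr 4 rfl
  have bA2 := hf₂.arr 2 rfl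
  rw [a23] at b23
  rw [a20] at b20
  rw [a2] at b2
  rw [a22] at b22
  refine wp_chainProg (by decide) b23 b20 (fun i => by rw [bA2, aA]) b1
    (by rw [b27, length_pointRows]) fun s₃ t₃ hf₃ d2 d28 ht₃ => ?_
  have d23 := (hf₃.reg 23 rfl).trans b23
  have d20 := (hf₃.reg 20 rfl).trans b20
  have dc := (hf₃.reg 2 rfl).trans b2
  have d22 := (hf₃.reg 22 rfl).trans b22
  have dA4 := (hf₃.arr 4 rfl).trans bA4
  rw [length_pointRows] at d28 ht₃
  set rowsP := chainRows N (pointRows N c) k with hrowsP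
  have hlenP : rowsP.length = ((N + 1) * (N * c)) ^ k := by
    rw [hrowsP, length_chainRows, length_pointRows]
  set R := ((N + 1) * (N * c)) ^ k with hR
  -- The greedy algorithm is stated for a family indexed by all numbers; the default of `getD` lies
  -- outside the range that is used.
  have hP : ∀ r (hr : r < R), rowsP.getD r (fun _ => 0) ∈ rowsP := by
    intro r hr
    rw [List.getD_eq_getElem _ _ (by omega)]
    exact List.getElem_mem _
  refine wp_greedyProg (P := fun r => rowsP.getD r (fun _ => 0)) (R := R) (N := N) (c := c)
    (m := k) ⟨by simpa using d23, by simpa using dc, by simpa using d28, ?_⟩ hc1 ?_ ?_ ?_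
  · intro r hr u hu
    simp only [List.getD_eq_getElem rowsP (fun _ => 0) (show r < rowsP.length by omega)]
    simpa using d2 r (by omega) u hu
  · exact fun r hr u _ => le_of_mem_chainRows_pointRows (hP r hr) u
  · exact fun r hr => card_support_chainRows_pointRows (hP r hr)
  intro s₄ t₄ F hf₄ e3 e43 hFl hFm ht₄
  have e23 := hf₄.reg 23 rfl
  have e20 := hf₄.reg 20 rfl
  have e22 := hf₄.reg 22 rfl
  have eA4 := (hf₄.arr 4 rfl).trans dA4
  simp [d23, d20, d22] at e23 e20 e22
  have hF : Universal N k (· < c) F := by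
    refine universal_of_matches hN1 hc1 fun p hp => ?_
    obtain ⟨r, hr, rfl⟩ := List.getElem_of_mem hp
    have hr' : r < rowsP.length := hr
    obtain ⟨f, hf, hm⟩ := hFm r (by omega)
    simp only [List.getD_eq_getElem rowsP (fun _ => 0) hr] at hm
    exact ⟨f, hf, hm⟩
  refine wp_chainProg (N := N) (m := k) (F := F) (by decide) (by simpa using e23)
    (by simpa using e20) (fun i => by rw [State.setReg_arr, State.setReg_arr, eA4, aA])
    (by simpa using e3) (by simpa using e43) fun s₅ t₅ hf₅ g4 g28 ht₅ => ?_
  have g23 := hf₅.reg 23 rfl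
  have g22 := hf₅.reg 22 rfl
  simp [e23, e22] at g23 g22
  refine ⟨k, F.length, chainRows N F k, B, N, hk₁, hk₂, hk₃, rfl, rfl, g22, g23, ?_, g4,
    hF.chainRows k, length_chainRows _ _ _, hFl, ?_⟩
  · rw [g28, length_chainRows]
  · unfold tableTime
    rw [hR] at ht₄
    omega

end

section

variable {n : ℕ} {G : SimpleGraph (Fin n)} {w : Fin n → ℕ}

/-! ### Assembling optimal solutions colour by colour -/

/-- Vertices of `T` with the same colour are not adjacent. -/
def Proper (G : SimpleGraph (Fin n)) (col : ℕ → ℕ) (T : Finset (Fin n)) : Prop :=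
  ∀ u ∈ T, ∀ v ∈ T, col u = col v → ¬ G.Adj u v

theorem Proper.mono {col : ℕ → ℕ} {S T : Finset (Fin n)} (h : Proper G col T) (hs : S ⊆ T) :
    Proper G col S := fun u hu v hv => h u (hs hu) v (hs hv)

theorem Proper.colorable {col : ℕ → ℕ} {T : Finset (Fin n)} {c : ℕ} (h : Proper G col T)
    (hc : ∀ v ∈ T, col v < c) : (G.induce (T : Set (Fin n))).Colorable c :=
  ⟨SimpleGraph.Coloring.mk (fun v => (⟨col v, hc v v.2⟩ : Fin c)) fun {u v} huv he =>
    h u u.2 v v.2 (by simpa using he) huv⟩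

/-- `T` has at most `j` vertices, their colours are at most `y` and form a proper colouring, and
at most `i` of them have colour `y`. -/
structure Admissible (G : SimpleGraph (Fin n)) (col : ℕ → ℕ) (y i j : ℕ) (T : Finset (Fin n)) :
    Prop where
  card_le : T.card ≤ j
  col_le : ∀ v ∈ T, col v ≤ y
  class_le : (T.filter fun v : Fin n => col v = y).card ≤ i
  proper : Proper G col T

/-- `B` is an optimal admissible set, without vertices of weight zero. -/
structure Optimal (G : SimpleGraph (Fin n)) (w : Fin n → ℕ) (col : ℕ → ℕ) (y i j : ℕ)
    (B : Finset (Fin n)) : Prop where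
  admissible : Admissible G col y i j B
  weight_ne : ∀ v ∈ B, w v ≠ 0
  le : ∀ T, Admissible G col y i j T → ∑ v ∈ T, w v ≤ ∑ v ∈ B, w v

theorem Admissible.col_lt {col : ℕ → ℕ} {y j : ℕ} {T : Finset (Fin n)}
    (h : Admissible G col y 0 j T) : ∀ v ∈ T, col v < y := by
  intro v hv
  have h1 := h.class_le
  rw [Nat.le_zero, Finset.card_eq_zero, Finset.filter_eq_empty_iff] at h1
  exact lt_of_le_of_ne (h.col_le v hv) (h1 hv)

theorem Admissible.of_col_lt {col : ℕ → ℕ} {y j : ℕ} {T : Finset (Fin n)} (hc : T.card ≤ j)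
    (hy : ∀ v ∈ T, col v < y) (hp : Proper G col T) : Admissible G col y 0 j T :=
  ⟨hc, fun v hv => (hy v hv).le, by
    rw [Nat.le_zero, Finset.card_eq_zero, Finset.filter_eq_empty_iff]
    exact fun v hv => (hy v hv).ne, hp⟩

theorem Optimal.empty {col : ℕ → ℕ} {j : ℕ} : Optimal G w col 0 0 j ∅ where
  admissible := .of_col_lt (by simp) (by simp) (by simp [Proper])
  weight_ne := by simp
  le T hT := by
    have : T = ∅ := Finset.eq_empty_of_forall_notMem fun v hv => by
      have := hT.col_lt v hv
      omega
    simp [this]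

/-- All vertices may have the colour `y`, so we can pass to the next colour. -/
theorem Optimal.next {col : ℕ → ℕ} {y j : ℕ} {B : Finset (Fin n)}
    (h : Optimal G w col y j j B) : Optimal G w col (y + 1) 0 j B where
  admissible := .of_col_lt h.admissible.card_le
    (fun v hv => Nat.lt_succ_of_le (h.admissible.col_le v hv)) h.admissible.proper
  weight_ne := h.weight_ne
  le T hT := h.le T ⟨hT.card_le, fun v hv => Nat.le_of_lt_succ (hT.col_lt v hv),
    (Finset.card_filter_le _ _).trans hT.card_le, hT.proper⟩

/-- The knapsack recurrence. A set with at most `i + 1` vertices of colour `y` either has at most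
`i` of them, or exactly `i + 1`, and then at most `j - (i + 1)` vertices of smaller colours.
Distinct colours impose no constraint on each other, so the two parts can be optimised separately.
-/
theorem Optimal.step {col : ℕ → ℕ} {y i j : ℕ} {B B' T : Finset (Fin n)} (hij : i + 1 ≤ j)
    (hB : Optimal G w col y i j B) (hB' : Optimal G w col y 0 (j - (i + 1)) B')
    (hT : ∀ v ∈ T, col v = y ∧ w v ≠ 0) (hTc : T.card ≤ i + 1)
    (hTi : G.IsIndepSet (T : Set (Fin n)))
    (hTo : ∀ T' : Finset (Fin n), (∀ v ∈ T', col v = y) → T'.card ≤ i + 1 →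
      G.IsIndepSet (T' : Set (Fin n)) → ∑ v ∈ T', w v ≤ ∑ v ∈ T, w v) :
    Disjoint B' T ∧ Optimal G w col y (i + 1) j
      (if ∑ v ∈ B, w v < ∑ v ∈ B', w v + ∑ v ∈ T, w v then B' ∪ T else B) := by
  have hlt := hB'.admissible.col_lt
  have hdis : Disjoint B' T := Finset.disjoint_left.2 fun v h1 h2 => by
    have := hlt v h1
    have := (hT v h2).1
    omega
  refine ⟨hdis, ?_⟩
  have hsum : ∑ v ∈ B' ∪ T, w v = ∑ v ∈ B', w v + ∑ v ∈ T, w v := Finset.sum_union hdis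
  have hdom : ∀ U, Admissible G col y (i + 1) j U →
      ∑ v ∈ U, w v ≤ ∑ v ∈ B, w v ∨ ∑ v ∈ U, w v ≤ ∑ v ∈ B', w v + ∑ v ∈ T, w v := by
    intro U hU
    by_cases hi : (U.filter fun v : Fin n => col v = y).card ≤ i
    · exact Or.inl (hB.le U ⟨hU.card_le, hU.col_le, hi, hU.proper⟩)
    · right
      have hc := hU.class_le
      have hcard := Finset.card_filter_add_card_filter_not (s := U) (fun v : Fin n => col v = y)
      have hUc := hU.card_le
      rw [← Finset.sum_filter_add_sum_filter_not U (fun v : Fin n => col v = y), add_comm]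
      refine Nat.add_le_add (hB'.le _ (.of_col_lt (by omega) ?_
        (hU.proper.mono (Finset.filter_subset _ _)))) (hTo _ ?_ hc ?_)
      · intro v hv
        obtain ⟨h1, h2⟩ := Finset.mem_filter.1 hv
        exact lt_of_le_of_ne (hU.col_le v h1) h2
      · exact fun v hv => (Finset.mem_filter.1 hv).2
      · intro u hu v hv _
        obtain ⟨h1, h2⟩ := Finset.mem_filter.1 (Finset.mem_coe.1 hu)
        obtain ⟨h3, h4⟩ := Finset.mem_filter.1 (Finset.mem_coe.1 hv)
        exact hU.proper u h1 v h3 (h2.trans h4.symm)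
  split_ifs with hlt'
  · refine ⟨⟨?_, ?_, ?_, ?_⟩, ?_, ?_⟩
    · have := hB'.admissible.card_le
      have := Finset.card_union_le B' T
      omega
    · intro v hv
      rcases Finset.mem_union.1 hv with h | h
      · exact (hlt v h).le
      · exact (hT v h).1.le
    · rw [Finset.filter_union, Finset.filter_eq_empty_iff.2 fun v hv => (hlt v hv).ne,
        Finset.empty_union]
      exact (Finset.card_filter_le _ _).trans hTc
    · intro u hu v hv he
      rcases Finset.mem_union.1 hu with h | h <;> rcases Finset.mem_union.1 hv with h' | h'
      · exact hB'.admissible.proper u h v h' he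
      · exact absurd ((hlt u h).trans_eq (hT v h').1.symm) (by omega)
      · exact absurd ((hlt v h').trans_eq (hT u h).1.symm) (by omega)
      · intro ha
        exact hTi (Finset.mem_coe.2 h) (Finset.mem_coe.2 h') ha.ne ha
    · intro v hv
      rcases Finset.mem_union.1 hv with h | h
      · exact hB'.weight_ne v h
      · exact (hT v h).2
    · intro U hU
      rcases hdom U hU with h | h <;> omega
  · refine ⟨⟨hB.admissible.card_le, hB.admissible.col_le,
      hB.admissible.class_le.trans (Nat.le_succ i), hB.admissible.proper⟩, hB.weight_ne, ?_⟩
    intro U hU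
    rcases hdom U hU with h | h <;> omega

/-! ### The dynamic program -/

/-- Entry `j` of array `9` is the weight of `B`, and row `j` of array `10` lists the weights of its
elements. -/
structure Cell (w : Fin n → ℕ) (arr : ℕ → ℕ → ℕ) (j : ℕ) (B : Finset (Fin n)) : Prop where
  weight : arr 9 j = ∑ v ∈ B, w v
  row : ∀ v : Fin n, arr 10 (j * n + v) = if v ∈ B then w v else 0

theorem row_inj {N r u r' u' : ℕ} (hu : u < N) (hu' : u' < N) :
    r * N + u = r' * N + u' ↔ r = r' ∧ u = u' := by
  refine ⟨fun h => ?_, by rintro ⟨rfl, rfl⟩; rfl⟩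
  rcases lt_trichotomy r r' with h1 | h1 | h1
  · have := row_lt h1 hu
    omega
  · subst h1
    omega
  · have := row_lt h1 hu'
    omega

/-- Add array `11` to row `r₇₄` (starting at `r₇₅`) of array `10`, and write the result into row
`r₆₈` (starting at `r₇₃`). -/
def copyRow : Prog :=
  forLt 63 0 3 (.add 4 75 63 ;; .load 4 10 4 ;; .load 5 11 63 ;; .add 4 4 5 ;; .add 5 73 63 ;;
    .store 10 5 4)

theorem wp_copyRow {s : State} {i j : ℕ} (hn : s.reg 0 = n)
    (h75 : s.reg 75 = i * n) (h73 : s.reg 73 = j * n) {Q : State → ℕ → Prop}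
    (hQ : ∀ s' k, Frame copyRow s s' → (∀ l v, v < n → s'.arr 10 (l * n + v) =
      if l = j then s.arr 10 (i * n + v) + s.arr 11 v else s.arr 10 (l * n + v)) →
      k ≤ 10 * n + 3 → Q s' k) : WP G w copyRow s Q := by
  have key : WP G w copyRow s fun s' k => (∀ l v, v < n → s'.arr 10 (l * n + v) =
      if l = j then s.arr 10 (i * n + v) + s.arr 11 v else s.arr 10 (l * n + v)) ∧
      k ≤ 10 * n + 3 := by
    refine wp_forLt (fun b s' => ∀ l v, v < n → s'.arr 10 (l * n + v) =
      if l = j ∧ v < b then s.arr 10 (i * n + v) + s.arr 11 v else s.arr 10 (l * n + v)) 6 n hn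
      (by decide) rfl rfl (by simp) (by simp) ?_ ?_
    · intro b s' hb hi hm hf hI
      have e75 := hf.reg 75 rfl
      have e73 := hf.reg 73 rfl
      have e11 := hf.arr 11 rfl
      -- Position `b` of the source row has not been written yet, even if source and destination
      -- coincide.
      have hib := hI i b hb
      rw [if_neg (by omega)] at hib
      simp only [wp_seq, wp_load, wp_add, wp_store]
      simp (disch := omega) only [State.setReg_ne, State.setReg_self, State.setReg_arr, hi, e75,
        e73, e11, h75, h73]
      refine ⟨fun l v hv => ?_, by omega⟩
      simp only [State.setArr_arr, true_and, row_inj hv hb, State.setReg_arr, hI l v hv, hib]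
      by_cases h1 : l = j <;> by_cases h2 : v = b
      · simp [h1, h2]
      · simp [h1, h2, show v < b + 1 ↔ v < b by omega]
      · simp [h1]
      · simp [h1]
    · intro s' k hf hI hk
      refine ⟨fun l v hv => ?_, by omega⟩
      rw [hI l v hv]
      simp [hv]
  exact key.imp fun s' k hf hq => hQ s' k hf hq.1 hq.2

/-- Try to improve the solution with at most `r₆₈` vertices by taking `r₇₀ + 1` of them from
colour class `r₆₇`. -/
def improveProg (p : Prog) : Prog :=
  .const 3 1 ;; .add 71 70 3 ;; .sub 74 68 71 ;; mov 11 0 ;; mov 12 74 ;; mulProg ;; mov 75 10 ;;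
  solveProg p ;; .load 4 9 74 ;; .add 4 4 72 ;; .load 5 9 68 ;; .sub 5 4 5 ;;
  .ite 5 (.store 9 68 4 ;; copyRow) (.const 3 0)

/-- The program contains `sim p` for a variable `p`, so its frame cannot be found by evaluation
alone and relies on `sim_writes`; the same holds for the programs built from it. -/
theorem solveProg_writes (p : Prog) (x : ℕ) (hx : x < 99)
    (h : x ∉ [3, 4, 5, 6, 63, 72]) : (solveProg p).writes x = false := by
  simp at h
  have := sim_writes p x (by omega) (by tauto) (by tauto) (by tauto)
  simp [solveProg, classWeights, callProg, readOutput, mov, forLt, Prog.writes, this]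
  omega

theorem solveProg_stores (p : Prog) (a : ℕ) (ha : a < 20)
    (h : a ∉ [8, 11]) : (solveProg p).stores a = false := by
  simp at h
  have := sim_stores p a ha
  simp [solveProg, classWeights, callProg, readOutput, mov, forLt, Prog.stores, this]
  omega

theorem improveProg_writes (p : Prog) (x : ℕ) (hx : x < 99)
    (h : x ∉ [3, 4, 5, 6, 10, 11, 12, 13, 63, 71, 72, 74, 75]) :
    (improveProg p).writes x = false := by
  simp at h
  have := solveProg_writes p x hx (by simp; tauto)
  simp [improveProg, copyRow, mulProg, mov, forLt, Prog.writes, this]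
  omega

theorem improveProg_stores (p : Prog) (a : ℕ) (ha : a < 20)
    (h : a ∉ [8, 9, 10, 11]) : (improveProg p).stores a = false := by
  simp at h
  have := solveProg_stores p a ha (by simp; tauto)
  simp [improveProg, copyRow, mulProg, mov, forLt, Prog.stores, this]
  omega

@[simp] theorem simReady_setReg {s : State} {x v : ℕ} (hx : x < 99) :
    SimReady n (s.setReg x v) ↔ SimReady n s := by
  constructor <;> rintro ⟨h1, h2, h3⟩ <;> refine ⟨fun y => ?_, fun a i => ?_, h3⟩
  · have := h1 y
    simpa (disch := omega) only [State.setReg_ne] using this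
  · have := h2 a i
    simpa (disch := omega) only [State.setReg_ne, State.setReg_arr] using this
  · have := h1 y
    simpa (disch := omega) only [State.setReg_ne] using this
  · have := h2 a i
    simpa (disch := omega) only [State.setReg_ne, State.setReg_arr] using this

theorem simReady_setArr {s : State} {a i v : ℕ} (ha : a < 20) (h8 : a ≠ 8) :
    SimReady n (s.setArr a i v) ↔ SimReady n s := by
  constructor <;> rintro ⟨h1, h2, h3⟩ <;> refine ⟨h1, fun b l => ?_, fun l hl => ?_⟩
  · have := h2 b l
    simpa (disch := omega) only [State.setArr_ne, State.setArr_reg] using this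
  · have := h3 l hl
    simpa (disch := omega) only [State.setArr_ne] using this
  · have := h2 b l
    simpa (disch := omega) only [State.setArr_ne, State.setArr_reg] using this
  · have := h3 l hl
    simpa (disch := omega) only [State.setArr_ne] using this

end

section

variable {n : ℕ} {G : SimpleGraph (Fin n)} {w : Fin n → ℕ}

/-- A bound for the number of steps of `improveProg p`. -/
def improveTime (n ℓ τ : ℕ) : ℕ := 36 * n + 12 * τ + 5 * ℓ + 50

/-- The sets `B'` and `T` are disjoint, since their colours differ, so adding their weight rows
entrywise gives the row of the union. The entry is overwritten only on strict improvement. -/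
theorem wp_improveProg {p : Prog} {s : State} {ℓ τ i j y : ℕ} (hp : Solves p G ℓ τ)
    (hn : s.reg 0 = n) (hs : SimReady n s) (hy : s.reg 67 = y) (hi : s.reg 70 = i)
    (hj : s.reg 68 = j) (hj' : s.reg 73 = j * n) (hij : i < j) (hjℓ : j ≤ ℓ)
    {B B' : Finset (Fin n)} (hB : Optimal G w (s.arr 7) y i j B) (hcB : Cell w s.arr j B)
    (hB' : Optimal G w (s.arr 7) y 0 (j - (i + 1)) B') (hcB' : Cell w s.arr (j - (i + 1)) B')
    {Q : State → ℕ → Prop}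
    (hQ : ∀ s' k, ∀ C : Finset (Fin n), SimReady n s' → Optimal G w (s.arr 7) y (i + 1) j C →
      Cell w s'.arr j C → (∀ l, l ≠ j → ∀ D : Finset (Fin n), Cell w s.arr l D →
      Cell w s'.arr l D) → k ≤ improveTime n ℓ τ → Q s' k) :
    WP G w (improveProg p) s Q := by
  simp only [improveProg, wp_seq, wp_mov, wp_const, wp_add, wp_sub]
  refine wp_mulProg fun s₁ k₁ f₁ m₁ hk₁ => ?_
  have a0 := f₁.reg 0 rfl
  have a67 := f₁.reg 67 rfl
  have a68 := f₁.reg 68 rfl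
  have a71 := f₁.reg 71 rfl
  have a73 := f₁.reg 73 rfl
  have a74 := f₁.reg 74 rfl
  have aA : s₁.arr = s.arr := funext fun a => f₁.arr a rfl
  have aS : SimReady n s₁ := SimReady.of_frame (p := mulProg) (by simpa using hs) f₁
    (fun x hx => by simp [mulProg, forLt, Prog.writes]; omega)
    (fun a ha => by simp [mulProg, forLt, Prog.stores])
  simp [hn, hy, hi, hj, hj'] at a0 a67 a68 a71 a73 a74 m₁ hk₁
  refine wp_solveProg hp (by simpa using a0) (by simpa using aS) (by simp [a71])
    (by simp [a71]; omega) fun s₂ k₂ T f₂ r₂ t₁ t₂ t₃ t₄ t₅ t₆ hk₂ => ?_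
  have b0 := f₂.reg 0 (solveProg_writes p _ (by decide) (by decide))
  have b68 := f₂.reg 68 (solveProg_writes p _ (by decide) (by decide))
  have b73 := f₂.reg 73 (solveProg_writes p _ (by decide) (by decide))
  have b74 := f₂.reg 74 (solveProg_writes p _ (by decide) (by decide))
  have b75 := f₂.reg 75 (solveProg_writes p _ (by decide) (by decide))
  have b9 := f₂.arr 9 (solveProg_stores p _ (by decide) (by decide))
  have b10 := f₂.arr 10 (solveProg_stores p _ (by decide) (by decide))
  simp [a0, a68, a73, a74, aA, m₁] at b0 b68 b73 b74 b75 b9 b10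
  simp [a67, a71, aA] at t₁ t₂ t₄
  obtain ⟨hdis, hopt⟩ := Optimal.step hij hB hB' t₁ t₂ t₃ t₄
  have hcell : ∀ l, ∀ D : Finset (Fin n), Cell w s.arr l D → ∀ arr : ℕ → ℕ → ℕ,
      arr 9 l = s.arr 9 l → (∀ v, v < n → arr 10 (l * n + v) = s.arr 10 (l * n + v)) →
      Cell w arr l D :=
    fun l D h arr h1 h2 => ⟨h1.trans h.weight, fun v => (h2 v v.2).trans (h.row v)⟩
  simp (disch := omega) only [wp_seq, wp_load, wp_store, wp_const, wp_ite,
    State.setReg_ne, State.setReg_self, State.setReg_arr, b68, b74, b9, hcB.weight,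
    hcB'.weight, t₆]
  split_ifs at hopt with hlt
  · refine ⟨fun _ => ?_, fun h => absurd h (by omega)⟩
    refine wp_copyRow (i := j - (i + 1)) (j := j) (by simp [b0])
      (by simp [b75, mul_comm]) (by simp [b73]) fun s₃ k₃ f₃ hr hk₃ => ?_
    have c9 := f₃.arr 9 rfl
    simp [b10] at hr
    have hc : ∀ l, s₃.arr 9 l = if l = j then ∑ v ∈ B', w v + ∑ v ∈ T, w v else s.arr 9 l := by
      intro l
      rw [c9]
      simp [b9]
    refine hQ _ _ (B' ∪ T) ?_ hopt ⟨?_, fun v => ?_⟩ (fun l hl D hD => hcell l D hD _ ?_ ?_) ?_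
    · refine SimReady.of_frame (p := copyRow) (s := _) ?_ f₃
        (fun x hx => by simp [copyRow, forLt, Prog.writes]; omega)
        (fun a ha => by simp [copyRow, forLt, Prog.stores]; omega)
      rw [simReady_setArr (by decide) (by decide)]
      simpa using r₂
    · rw [hc, if_pos rfl, Finset.sum_union hdis]
    · rw [hr _ _ v.2, if_pos rfl, hcB'.row, t₅ _ v.2]
      by_cases h1 : v ∈ B'
      · simp [weightEntry, h1, Finset.disjoint_left.1 hdis h1]
      · simp [weightEntry, h1]
    · rw [hc, if_neg hl]
    · intro v hv
      rw [hr _ _ hv, if_neg hl]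
    · simp only [improveTime]
      omega
  · refine ⟨fun h => absurd h (by omega), fun _ => ?_⟩
    refine hQ _ _ B (by simpa using r₂) hopt (hcell _ _ hcB _ ?_ ?_)
      (fun l hl D hD => hcell l D hD _ ?_ ?_) ?_
    · simp [b9]
    · simp [b10]
    · simp [b9]
    · simp [b10]
    · simp only [improveTime]
      omega

/-- The state of the dynamic program for colour `y`: entry `j` is optimal among the sets with at
most `lev j` vertices of colour `y`. -/
def Table (G : SimpleGraph (Fin n)) (w : Fin n → ℕ) (col : ℕ → ℕ) (ℓ y : ℕ) (lev : ℕ → ℕ)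
    (arr : ℕ → ℕ → ℕ) : Prop :=
  ∀ j ≤ ℓ, ∃ B : Finset (Fin n), Optimal G w col y (lev j) j B ∧ Cell w arr j B

/-- Process entry `r₆₈`. -/
def entryProg (p : Prog) : Prog := forLt 70 68 3 (improveProg p)

theorem entryProg_writes (p : Prog) (x : ℕ) (hx : x < 99)
    (h : x ∉ [3, 4, 5, 6, 10, 11, 12, 13, 63, 70, 71, 72, 74, 75]) :
    (entryProg p).writes x = false := by
  simp at h
  have := improveProg_writes p x hx (by simp; tauto)
  simp [entryProg, forLt, Prog.writes, this]
  omega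

theorem entryProg_stores (p : Prog) (a : ℕ) (ha : a < 20)
    (h : a ∉ [8, 9, 10, 11]) : (entryProg p).stores a = false := by
  have := improveProg_stores p a ha h
  simp [entryProg, forLt, Prog.stores, this]

/-- While entry `j` is raised from level `0` to level `j`, it consults only entries with smaller
index, which are still at level `0` and hence avoid the colour `y`. -/
theorem wp_entryProg {p : Prog} {s : State} {ℓ τ j y : ℕ} (hp : Solves p G ℓ τ)
    (hn : s.reg 0 = n) (hs : SimReady n s) (hy : s.reg 67 = y) (hj : s.reg 68 = j)
    (hj' : s.reg 73 = j * n) (hjℓ : j ≤ ℓ) {col : ℕ → ℕ} (hcol : s.arr 7 = col)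
    (hT : Table G w col ℓ y (fun l => if j < l then l else 0) s.arr)
    {Q : State → ℕ → Prop}
    (hQ : ∀ s' k, Frame (entryProg p) s s' → SimReady n s' →
      Table G w col ℓ y (fun l => if j ≤ l then l else 0) s'.arr →
      k ≤ ℓ * (improveTime n ℓ τ + 4) + 3 → Q s' k) :
    WP G w (entryProg p) s Q := by
  suffices key : WP G w (entryProg p) s fun s' k => SimReady n s' ∧
      Table G w col ℓ y (fun l => if j ≤ l then l else 0) s'.arr ∧
      k ≤ ℓ * (improveTime n ℓ τ + 4) + 3 from
    key.imp fun s' k hf hq => hQ s' k hf hq.1 hq.2.1 hq.2.2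
  refine wp_forLt (fun i s' => SimReady n s' ∧
    Table G w col ℓ y (fun l => if j < l then l else if l = j then i else 0) s'.arr)
    (improveTime n ℓ τ) j hj (by decide) (improveProg_writes p _ (by decide) (by decide))
    (improveProg_writes p _ (by decide) (by decide)) (by simp) ⟨hs, by simpa using hT⟩ ?_ ?_
  · rintro i s' hi hi' hm hf ⟨hs', hT'⟩
    have a0 := (hf.reg 0 (entryProg_writes p _ (by decide) (by decide))).trans hn
    have a67 := (hf.reg 67 (entryProg_writes p _ (by decide) (by decide))).trans hy
    have a73 := (hf.reg 73 (entryProg_writes p _ (by decide) (by decide))).trans hj'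
    have a7 := (hf.arr 7 (entryProg_stores p _ (by decide) (by decide))).trans hcol
    obtain ⟨B, hB, hcB⟩ := hT' j hjℓ
    obtain ⟨B', hB', hcB'⟩ := hT' (j - (i + 1)) (by omega)
    simp only [lt_irrefl, if_false, if_true] at hB
    simp only [show ¬ j < j - (i + 1) by omega, show j - (i + 1) ≠ j by omega, if_false] at hB'
    refine wp_improveProg hp a0 hs' a67 hi' hm a73 hi hjℓ (a7 ▸ hB) hcB (a7 ▸ hB') hcB'
      fun s'' k C hs'' hC hcC hr hk => ⟨⟨hs'', fun l hl => ?_⟩, hk⟩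
    rcases eq_or_ne l j with rfl | hlj
    · exact ⟨C, by simpa [a7] using hC, hcC⟩
    · obtain ⟨D, hD, hcD⟩ := hT' l hl
      exact ⟨D, by simpa [hlj] using hD, hr l hlj D hcD⟩
  · rintro s' k hf ⟨hs', hT'⟩ hk
    refine ⟨hs', fun l hl => ?_, hk.trans ?_⟩
    · obtain ⟨D, hD, hcD⟩ := hT' l hl
      refine ⟨D, ?_, hcD⟩
      convert hD using 1
      dsimp only
      split_ifs <;> omega
    · exact Nat.add_le_add_right (Nat.mul_le_mul_right _ hjℓ) 3

/-- Process colour `r₆₇`. -/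
def classProg (p : Prog) : Prog :=
  forLt 69 1 3 (.sub 68 1 69 ;; mov 11 0 ;; mov 12 68 ;; mulProg ;; mov 73 10 ;; entryProg p)

theorem classProg_writes (p : Prog) (x : ℕ) (hx : x < 99)
    (h : x ∉ [3, 4, 5, 6, 10, 11, 12, 13, 63, 68, 69, 70, 71, 72, 73, 74, 75]) :
    (classProg p).writes x = false := by
  simp at h
  have := entryProg_writes p x hx (by simp; tauto)
  simp [classProg, mov, mulProg, forLt, Prog.writes, this]
  omega

theorem classProg_stores (p : Prog) (a : ℕ) (ha : a < 20)
    (h : a ∉ [8, 9, 10, 11]) : (classProg p).stores a = false := by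
  have := entryProg_stores p a ha h
  simp [classProg, mov, mulProg, forLt, Prog.stores, this]

theorem SimReady.of_frame_of_mulProg {s s' : State} (h : SimReady n s) (hf : Frame mulProg s s') :
    SimReady n s' :=
  h.of_frame hf (fun x hx => by simp [mulProg, forLt, Prog.writes]; omega)
    (fun a ha => by simp [mulProg, forLt, Prog.stores])

/-- A bound for the number of steps of `classProg p`. -/
def classTime (n ℓ τ : ℕ) : ℕ :=
  ℓ * (ℓ * (improveTime n ℓ τ + 4) + 5 * ℓ + 18) + 3

/-- Entries are processed from `ℓ` downwards, as in the in-place knapsack algorithm, so that smaller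
entries do not yet use the current colour. -/
theorem wp_classProg {p : Prog} {s : State} {ℓ τ y : ℕ} (hp : Solves p G ℓ τ)
    (hn : s.reg 0 = n) (hℓ : s.reg 1 = ℓ) (hs : SimReady n s) (hy : s.reg 67 = y)
    {col : ℕ → ℕ} (hcol : s.arr 7 = col) (hT : Table G w col ℓ y (fun _ => 0) s.arr)
    {Q : State → ℕ → Prop}
    (hQ : ∀ s' k, Frame (classProg p) s s' → SimReady n s' →
      Table G w col ℓ (y + 1) (fun _ => 0) s'.arr → k ≤ classTime n ℓ τ → Q s' k) :
    WP G w (classProg p) s Q := by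
  suffices key : WP G w (classProg p) s fun s' k => SimReady n s' ∧
      Table G w col ℓ (y + 1) (fun _ => 0) s'.arr ∧ k ≤ classTime n ℓ τ from
    key.imp fun s' k hf hq => hQ s' k hf hq.1 hq.2.1 hq.2.2
  refine wp_forLt (fun i s' => SimReady n s' ∧
    Table G w col ℓ y (fun l => if ℓ - i < l then l else 0) s'.arr)
    (ℓ * (improveTime n ℓ τ + 4) + 5 * ℓ + 14) ℓ hℓ (by decide) ?_ ?_ (by simp) ⟨hs, ?_⟩ ?_ ?_
  · simp [mov, mulProg, forLt, Prog.writes, entryProg_writes]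
  · simp [mov, mulProg, forLt, Prog.writes, entryProg_writes]
  · intro l hl
    obtain ⟨D, hD, hcD⟩ := hT l hl
    exact ⟨D, by simpa [hl.not_gt] using hD, hcD⟩
  · rintro i s' hi hi' hm hf ⟨hs', hT'⟩
    have a0 := (hf.reg 0 (classProg_writes p _ (by decide) (by decide))).trans hn
    have a67 := (hf.reg 67 (classProg_writes p _ (by decide) (by decide))).trans hy
    have a7 := (hf.arr 7 (classProg_stores p _ (by decide) (by decide))).trans hcol
    simp only [wp_seq, wp_mov, wp_sub]
    refine wp_mulProg fun s₁ k₁ f₁ m₁ hk₁ => ?_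
    have b0 := f₁.reg 0 rfl
    have b67 := f₁.reg 67 rfl
    have b68 := f₁.reg 68 rfl
    have bA : s₁.arr = s'.arr := funext fun a => f₁.arr a rfl
    have bS : SimReady n s₁ := SimReady.of_frame_of_mulProg (by simpa using hs') f₁
    simp [a0, a67, hm, hi'] at b0 b67 b68 m₁ hk₁
    refine wp_entryProg (j := ℓ - i) hp (by simpa using b0) (by simpa using bS)
      (by simpa using b67) (by simpa using b68) (by simp [m₁, mul_comm]) (by omega)
      (by simpa [bA] using a7) (by simpa [bA] using hT') fun s₂ k₂ f₂ hs₂ hT₂ hk₂ => ?_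
    refine ⟨⟨hs₂, fun l hl => ?_⟩, by omega⟩
    obtain ⟨D, hD, hcD⟩ := hT₂ l hl
    refine ⟨D, ?_, hcD⟩
    convert hD using 1
    dsimp only
    split_ifs <;> omega
  · rintro s' k hf ⟨hs', hT'⟩ hk
    refine ⟨hs', fun l hl => ?_, ?_⟩
    · obtain ⟨D, hD, hcD⟩ := hT' l hl
      -- Entry `0` was never processed, but for it level `0` is already the full level.
      refine ⟨D, Optimal.next ?_, hcD⟩
      convert hD using 1
      dsimp only
      split_ifs <;> omega
    · exact hk

/-- Process all colours. -/
def colorsProg (p : Prog) : Prog := forLt 67 2 3 (classProg p)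

theorem colorsProg_writes (p : Prog) (x : ℕ) (hx : x < 99)
    (h : x ∉ [3, 4, 5, 6, 10, 11, 12, 13, 63, 67, 68, 69, 70, 71, 72, 73, 74, 75]) :
    (colorsProg p).writes x = false := by
  simp at h
  have := classProg_writes p x hx (by simp; tauto)
  simp [colorsProg, forLt, Prog.writes, this]
  omega

theorem colorsProg_stores (p : Prog) (a : ℕ) (ha : a < 20)
    (h : a ∉ [8, 9, 10, 11]) : (colorsProg p).stores a = false := by
  have := classProg_stores p a ha h
  simp [colorsProg, forLt, Prog.stores, this]

theorem wp_colorsProg {p : Prog} {s : State} {ℓ τ c : ℕ} (hp : Solves p G ℓ τ)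
    (hn : s.reg 0 = n) (hℓ : s.reg 1 = ℓ) (hc : s.reg 2 = c) (hs : SimReady n s)
    {col : ℕ → ℕ} (hcol : s.arr 7 = col) (hT : Table G w col ℓ 0 (fun _ => 0) s.arr)
    {Q : State → ℕ → Prop}
    (hQ : ∀ s' k, Frame (colorsProg p) s s' → SimReady n s' →
      Table G w col ℓ c (fun _ => 0) s'.arr → k ≤ c * (classTime n ℓ τ + 4) + 3 → Q s' k) :
    WP G w (colorsProg p) s Q := by
  suffices key : WP G w (colorsProg p) s fun s' k => SimReady n s' ∧
      Table G w col ℓ c (fun _ => 0) s'.arr ∧ k ≤ c * (classTime n ℓ τ + 4) + 3 from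
    key.imp fun s' k hf hq => hQ s' k hf hq.1 hq.2.1 hq.2.2
  refine wp_forLt (fun i s' => SimReady n s' ∧ Table G w col ℓ i (fun _ => 0) s'.arr)
    (classTime n ℓ τ) c hc (by decide) (classProg_writes p _ (by decide) (by decide))
    (classProg_writes p _ (by decide) (by decide)) (by simp) ⟨hs, hT⟩ ?_ ?_
  · rintro i s' hi hi' hm hf ⟨hs', hT'⟩
    exact wp_classProg hp ((hf.reg 0 (colorsProg_writes p _ (by decide) (by decide))).trans hn)
      ((hf.reg 1 (colorsProg_writes p _ (by decide) (by decide))).trans hℓ) hs' hi'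
      ((hf.arr 7 (colorsProg_stores p _ (by decide) (by decide))).trans hcol) hT'
      fun s₁ k₁ f₁ hs₁ hT₁ hk₁ => ⟨⟨hs₁, hT₁⟩, hk₁⟩
  · exact fun s' k hf hI hk => ⟨hI.1, hI.2, hk⟩

end

section

variable {n : ℕ} {G : SimpleGraph (Fin n)} {w : Fin n → ℕ}

/-! ### Trying a colouring -/

/-- Fill array `7` with the colouring given by the row of array `4` that starts at `r₅₇`, at the
vertices reduced modulo `r₆₁` and then modulo `r₆₂`. -/
def colorProg : Prog :=
  .const 59 0 ;; .const 60 0 ;; forLt 63 0 3 (.add 4 57 60 ;; .load 4 4 4 ;; .store 7 63 4 ;;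
    .const 5 1 ;; .add 59 59 5 ;; .add 60 60 5 ;; .sub 4 62 60 ;;
    .ite 4 (.const 3 0) (.const 60 0) ;; .sub 4 61 59 ;;
    .ite 4 (.const 3 0) (.const 59 0 ;; .const 60 0))

/-- Lets residues be maintained while counting upwards, without any division; the truncated
difference serves as the wrap-around test. -/
theorem succ_mod_eq_ite (v m : ℕ) (hm : 0 < m) :
    (v + 1) % m = if m - (v % m + 1) ≠ 0 then v % m + 1 else 0 := by
  have h := Nat.mod_lt v hm
  rw [Nat.add_mod, ← Nat.add_mod_mod]
  split_ifs with h1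
  · rcases Nat.lt_or_ge 1 m with h2 | h2
    · simp [Nat.mod_eq_of_lt (show v % m + 1 < m by omega)]
    · omega
  · have : v % m + 1 = m := by omega
    simp [this]

/-- Both residues advance by one with each vertex. When the residue modulo `m₁` wraps, the inner one
is reset as well, being a residue of it. -/
theorem wp_colorProg {s : State} {m₁ m₂ : ℕ} (hn : s.reg 0 = n) (h₁ : s.reg 61 = m₁)
    (h₂ : s.reg 62 = m₂) (hm₁ : 0 < m₁) (hm₂ : 0 < m₂) {Q : State → ℕ → Prop}
    (hQ : ∀ s' k, Frame colorProg s s' →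
      (∀ v, v < n → s'.arr 7 v = s.arr 4 (s.reg 57 + v % m₁ % m₂)) → k ≤ 17 * n + 5 → Q s' k) :
    WP G w colorProg s Q := by
  suffices key : WP G w colorProg s fun s' k =>
      (∀ v, v < n → s'.arr 7 v = s.arr 4 (s.reg 57 + v % m₁ % m₂)) ∧ k ≤ 17 * n + 5 from
    key.imp fun s' k hf hq => hQ s' k hf hq.1 hq.2
  simp only [colorProg, wp_seq, wp_const]
  refine wp_forLt (fun j s' => (∀ v, v < j → s'.arr 7 v = s.arr 4 (s.reg 57 + v % m₁ % m₂)) ∧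
    s'.reg 59 = j % m₁ ∧ s'.reg 60 = j % m₁ % m₂) 13 n (by simpa using hn) (by decide) rfl rfl
    (by simp) (by simp) ?_ ?_
  · rintro j s' hj hi hm hf ⟨hI, h59, h60⟩
    have e57 := hf.reg 57 rfl
    have e61 := hf.reg 61 rfl
    have e62 := hf.reg 62 rfl
    have e4 := hf.arr 4 rfl
    simp [h₁, h₂] at e57 e61 e62 e4
    have key : ∀ x, x = s.arr 4 (s.reg 57 + j % m₁ % m₂) → ∀ i, i < j + 1 →
        (if i = j then x else s'.arr 7 i) = s.arr 4 (s.reg 57 + i % m₁ % m₂) :=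
      fun x hx i hi => prefix_update (g := fun v => s.arr 4 (s.reg 57 + v % m₁ % m₂)) hI hx i hi
    have c1 := succ_mod_eq_ite j m₁ hm₁
    have c2 := succ_mod_eq_ite (j % m₁) m₂ hm₂
    simp only [wp_seq, wp_load, wp_add, wp_store, wp_const, wp_sub, wp_ite]
    simp (disch := omega) only [State.setReg_ne, State.setReg_self, State.setReg_arr,
      State.setArr_reg, State.setArr_arr, hi, e57, e61, e62, e4, h59, h60, true_and]
    refine ⟨fun h3 => ⟨fun h4 => ⟨⟨key _ rfl, ?_, ?_⟩, by omega⟩,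
        fun h4 => ⟨⟨key _ rfl, ?_, ?_⟩, by omega⟩⟩,
      fun h3 => ⟨fun h4 => ⟨⟨key _ rfl, ?_, ?_⟩, by omega⟩,
        fun h4 => ⟨⟨key _ rfl, ?_, ?_⟩, by omega⟩⟩⟩
    · rw [c1, if_pos h4]
    · rw [c1, if_pos h4, c2, if_pos h3]
    · rw [c1, if_neg (by omega)]
    · rw [c1, if_neg (by omega), Nat.zero_mod]
    · rw [c1, if_pos h4]
    · rw [c1, if_pos h4, c2, if_neg (by omega)]
    · rw [c1, if_neg (by omega)]
    · rw [c1, if_neg (by omega), Nat.zero_mod]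
  · rintro s' k hf ⟨hI, -, -⟩ hk
    exact ⟨hI, by omega⟩

/-- Reset the table of the dynamic program. -/
def resetProg : Prog :=
  .const 3 1 ;; .add 64 1 3 ;; .const 5 0 ;; forLt 65 64 3 (.store 9 65 5) ;; mov 11 0 ;;
    mov 12 64 ;; mulProg ;; mov 64 10 ;; .const 5 0 ;; forLt 65 64 3 (.store 10 65 5)

/-- The zero table represents empty sets, which are optimal before any colour is allowed. Clearing
it explicitly is affordable, as its size is only about `ℓ * n`. -/
theorem wp_resetProg {s : State} {ℓ : ℕ} (hn : s.reg 0 = n) (hℓ : s.reg 1 = ℓ)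
    {Q : State → ℕ → Prop}
    (hQ : ∀ s' k, Frame resetProg s s' → (∀ col, Table G w col ℓ 0 (fun _ => 0) s'.arr) →
      k ≤ (ℓ + 1) * (5 * n + 10) + 30 → Q s' k) :
    WP G w resetProg s Q := by
  suffices key : WP G w resetProg s fun s' k => (∀ j, j < ℓ + 1 → s'.arr 9 j = 0) ∧
      (∀ x, x < n * (ℓ + 1) → s'.arr 10 x = 0) ∧ k ≤ (ℓ + 1) * (5 * n + 10) + 30 by
    refine key.imp fun s' k hf hq => hQ s' k hf (fun col j hj => ⟨∅, Optimal.empty, ?_, ?_⟩) hq.2.2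
    · simp [hq.1 j (by omega)]
    · intro v
      have := row_lt (show j < ℓ + 1 by omega) v.2
      rw [mul_comm (ℓ + 1)] at this
      simp [hq.2.1 _ this]
  simp only [resetProg, wp_seq, wp_mov, wp_const, wp_add]
  refine wp_forLt (fun j s' => ∀ i, i < j → s'.arr 9 i = 0) 1 (ℓ + 1) (by simp [hℓ]) (by decide)
    rfl rfl (by simp) (by simp) ?_ ?_
  · intro j s' hj hi hm hf hI
    have e5 := hf.reg 5 rfl
    simp at e5
    simp only [wp_store, hi, e5]
    exact ⟨fun i hi' => by
      simpa using prefix_update (g := fun _ => 0) hI rfl i hi', le_rfl⟩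
  intro s₁ k₁ f₁ h₁ hk₁
  have a0 := f₁.reg 0 rfl
  have a64 := f₁.reg 64 rfl
  simp [hn, hℓ] at a0 a64
  refine wp_mulProg fun s₂ k₂ f₂ m₂ hk₂ => ?_
  have b9 := f₂.arr 9 rfl
  simp [a0, a64] at m₂ b9 hk₂
  refine wp_forLt (fun j s' => ∀ i, i < j → s'.arr 10 i = 0) 1 (n * (ℓ + 1)) (by simp [m₂])
    (by decide) rfl rfl (by simp) (by simp) ?_ ?_
  · intro j s' hj hi hm hf hI
    have e5 := hf.reg 5 rfl
    simp at e5
    simp only [wp_store, hi, e5]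
    exact ⟨fun i hi' => by
      simpa using prefix_update (g := fun _ => 0) hI rfl i hi', le_rfl⟩
  intro s₃ k₃ f₃ h₃ hk₃
  have c9 := f₃.arr 9 rfl
  simp [b9] at c9
  refine ⟨fun j hj => by rw [c9, h₁ j hj], h₃, ?_⟩
  have : (ℓ + 1) * (5 * n + 10) = n * (ℓ + 1) * 5 + 10 * (ℓ + 1) := by ring
  omega

/-- The array `0` holds the weights of a feasible set, whose weight is in `r₇₆`. -/
def Feasible (G : SimpleGraph (Fin n)) (w : Fin n → ℕ) (ℓ c : ℕ) (s : State) : Prop :=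
  ∃ B : Finset (Fin n), B.card ≤ ℓ ∧ (G.induce (B : Set (Fin n))).Colorable c ∧
    (∀ v ∈ B, w v ≠ 0) ∧ (∀ v : Fin n, s.arr 0 v = if v ∈ B then w v else 0) ∧
    s.reg 76 = ∑ v ∈ B, w v

/-- The weight `X` is at least that of all sets properly coloured by `col`. -/
def Dominates (G : SimpleGraph (Fin n)) (w : Fin n → ℕ) (ℓ c X : ℕ) (col : ℕ → ℕ) : Prop :=
  ∀ T : Finset (Fin n), T.card ≤ ℓ → (∀ v ∈ T, col v < c) → Proper G col T → ∑ v ∈ T, w v ≤ X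

theorem Dominates.mono {ℓ c X Y : ℕ} {col : ℕ → ℕ} (h : Dominates G w ℓ c X col) (hXY : X ≤ Y) :
    Dominates G w ℓ c Y col := fun T h1 h2 h3 => (h T h1 h2 h3).trans hXY

theorem Dominates.congr {ℓ c X : ℕ} {col col' : ℕ → ℕ} (h : Dominates G w ℓ c X col)
    (e : ∀ v : Fin n, col v = col' v) : Dominates G w ℓ c X col' := fun T h1 h2 h3 =>
  h T h1 (fun v hv => by rw [e]; exact h2 v hv)
    fun u hu v hv huv => h3 u hu v hv (by rwa [e, e] at huv)

/-- Copy the last row of the table to the output if it is better. -/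
def updateProg : Prog :=
  .load 4 9 1 ;; .sub 4 4 76 ;; .ite 4 (.load 76 9 1 ;; mov 11 0 ;; mov 12 1 ;; mulProg ;;
    forLt 63 0 3 (.add 4 10 63 ;; .load 4 10 4 ;; .store 0 63 4)) (.const 3 0)

theorem wp_updateProg {s : State} {ℓ c : ℕ} (hn : s.reg 0 = n) (hℓ : s.reg 1 = ℓ) {col : ℕ → ℕ}
    (hT : Table G w col ℓ c (fun _ => 0) s.arr) (hF : Feasible G w ℓ c s)
    {Q : State → ℕ → Prop}
    (hQ : ∀ s' k, Frame updateProg s s' → Feasible G w ℓ c s' → s.reg 76 ≤ s'.reg 76 →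
      Dominates G w ℓ c (s'.reg 76) col → k ≤ 7 * n + 5 * ℓ + 20 → Q s' k) :
    WP G w updateProg s Q := by
  suffices key : WP G w updateProg s fun s' k => Feasible G w ℓ c s' ∧ s.reg 76 ≤ s'.reg 76 ∧
      Dominates G w ℓ c (s'.reg 76) col ∧ k ≤ 7 * n + 5 * ℓ + 20 from
    key.imp fun s' k hf hq => hQ s' k hf hq.1 hq.2.1 hq.2.2.1 hq.2.2.2
  obtain ⟨B, hB, hcB⟩ := hT ℓ le_rfl
  have hdom : Dominates G w ℓ c (∑ v ∈ B, w v) col := fun T h1 h2 h3 =>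
    hB.le T (.of_col_lt h1 h2 h3)
  simp only [updateProg, wp_seq, wp_mov, wp_const, wp_load, wp_sub, wp_ite]
  simp (disch := omega) only [State.setReg_ne, State.setReg_self, State.setReg_arr, hℓ,
    hcB.weight]
  refine ⟨fun hlt => ?_, fun hle => ⟨?_, ?_, hdom.mono ?_, by omega⟩⟩
  · refine wp_mulProg fun s₁ k₁ f₁ m₁ hk₁ => ?_
    have a0 := f₁.reg 0 rfl
    have a76 := f₁.reg 76 rfl
    have a10 := f₁.arr 10 rfl
    simp [hn] at a0 a76 m₁ a10 hk₁
    refine wp_forLt (fun j s' => ∀ v, v < j → s'.arr 0 v = s.arr 10 (ℓ * n + v)) 3 n a0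
      (by decide) rfl rfl (by simp) (by simp) ?_ ?_
    · intro j s' hj hi hm hf hI
      have e10 := hf.reg 10 rfl
      have eA := hf.arr 10 rfl
      simp only [wp_seq, wp_load, wp_add, wp_store]
      simp (disch := omega) only [State.setReg_ne, State.setReg_self, State.setReg_arr,
        State.setArr_arr, hi, e10, eA, m₁, a10, true_and]
      refine ⟨prefix_update (g := fun v => s.arr 10 (ℓ * n + v)) hI (by rw [mul_comm]), by omega⟩
    · intro s' k hf hI hk
      have e76 := hf.reg 76 rfl
      rw [a76] at e76
      refine ⟨⟨B, hB.admissible.card_le, hB.admissible.proper.colorable hB.admissible.col_lt,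
        hB.weight_ne, fun v => ?_, ?_⟩, ?_, ?_, ?_⟩
      · rw [hI v v.2, hcB.row]
      · exact e76
      · rw [e76]
        omega
      · rw [e76]
        exact hdom
      · omega
  · exact hF
  · exact le_rfl
  · omega

/-- Find the best solution for a colouring. -/
def tryProg (p : Prog) : Prog := colorProg ;; resetProg ;; colorsProg p ;; updateProg

/-- A bound for the number of steps of `tryProg p`. -/
def tryTime (n ℓ c τ : ℕ) : ℕ :=
  c * (classTime n ℓ τ + 4) + (ℓ + 1) * (5 * n + 10) + 24 * n + 5 * ℓ + 60

theorem tryProg_writes (p : Prog) (x : ℕ) (hx : x < 99)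
    (h : x ∉ [3, 4, 5, 6, 10, 11, 12, 13, 59, 60, 63, 64, 65, 67, 68, 69, 70, 71, 72, 73, 74, 75,
      76]) :
    (tryProg p).writes x = false := by
  simp at h
  have := colorsProg_writes p x hx (by simp; tauto)
  simp [tryProg, colorProg, resetProg, updateProg, mulProg, mov, forLt, Prog.writes, this]
  omega

theorem tryProg_stores (p : Prog) (a : ℕ) (ha : a < 20)
    (h : a ∉ [0, 7, 8, 9, 10, 11]) : (tryProg p).stores a = false := by
  simp at h
  have := colorsProg_stores p a ha (by simp; tauto)
  simp [tryProg, colorProg, resetProg, updateProg, mulProg, mov, forLt, Prog.stores, this]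
  omega

theorem Feasible.congr {ℓ c : ℕ} {s s' : State} (h : Feasible G w ℓ c s)
    (h1 : s'.reg 76 = s.reg 76) (h2 : s'.arr 0 = s.arr 0) : Feasible G w ℓ c s' := by
  obtain ⟨B, a, b, d, e, f⟩ := h
  exact ⟨B, a, b, d, fun v => by rw [h2, e], by rw [h1, f]⟩

theorem wp_tryProg {p : Prog} {s : State} {ℓ τ c m₁ m₂ : ℕ} (hp : Solves p G ℓ τ)
    (hn : s.reg 0 = n) (hℓ : s.reg 1 = ℓ) (hc : s.reg 2 = c) (h₁ : s.reg 61 = m₁)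
    (h₂ : s.reg 62 = m₂) (hm₁ : 0 < m₁) (hm₂ : 0 < m₂) (hs : SimReady n s)
    (hF : Feasible G w ℓ c s) {Q : State → ℕ → Prop}
    (hQ : ∀ s' k, Frame (tryProg p) s s' → SimReady n s' → Feasible G w ℓ c s' →
      s.reg 76 ≤ s'.reg 76 →
      Dominates G w ℓ c (s'.reg 76) (fun v => s.arr 4 (s.reg 57 + v % m₁ % m₂)) →
      k ≤ tryTime n ℓ c τ → Q s' k) :
    WP G w (tryProg p) s Q := by
  suffices key : WP G w (tryProg p) s fun s' k => SimReady n s' ∧ Feasible G w ℓ c s' ∧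
      s.reg 76 ≤ s'.reg 76 ∧
      Dominates G w ℓ c (s'.reg 76) (fun v => s.arr 4 (s.reg 57 + v % m₁ % m₂)) ∧
      k ≤ tryTime n ℓ c τ from
    key.imp fun s' k hf hq => hQ s' k hf hq.1 hq.2.1 hq.2.2.1 hq.2.2.2.1 hq.2.2.2.2
  simp only [tryProg, wp_seq]
  refine wp_colorProg hn h₁ h₂ hm₁ hm₂ fun s₁ k₁ f₁ hcol hk₁ => ?_
  have a0 := (f₁.reg 0 rfl).trans hn
  have a1 := (f₁.reg 1 rfl).trans hℓ
  refine wp_resetProg (G := G) (w := w) a0 a1 fun s₂ k₂ f₂ hT₂ hk₂ => ?_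
  have b0 := (f₂.reg 0 rfl).trans a0
  have b1 := (f₂.reg 1 rfl).trans a1
  have b2 := (f₂.reg 2 rfl).trans ((f₁.reg 2 rfl).trans hc)
  have b7 := f₂.arr 7 rfl
  have bS : SimReady n s₂ := by
    refine (hs.of_frame f₁ ?_ ?_).of_frame f₂ ?_ ?_ <;> intro x hx <;>
      simp [colorProg, resetProg, mulProg, mov, forLt, Prog.writes, Prog.stores] <;> omega
  refine wp_colorsProg hp b0 b1 b2 bS rfl (hT₂ _) fun s₃ k₃ f₃ hs₃ hT₃ hk₃ => ?_
  have c0 := (f₃.reg 0 (colorsProg_writes p _ (by decide) (by decide))).trans b0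
  have c1 := (f₃.reg 1 (colorsProg_writes p _ (by decide) (by decide))).trans b1
  have c76 : s₃.reg 76 = s.reg 76 :=
    (f₃.reg 76 (colorsProg_writes p _ (by decide) (by decide))).trans
      ((f₂.reg 76 rfl).trans (f₁.reg 76 rfl))
  have cA : s₃.arr 0 = s.arr 0 :=
    (f₃.arr 0 (colorsProg_stores p _ (by decide) (by decide))).trans
      ((f₂.arr 0 rfl).trans (f₁.arr 0 rfl))
  refine wp_updateProg c0 c1 hT₃ (hF.congr c76 cA) fun s₄ k₄ f₄ hF₄ hle₄ hd₄ hk₄ => ?_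
  refine ⟨?_, hF₄, c76 ▸ hle₄, ?_, ?_⟩
  · refine hs₃.of_frame f₄ ?_ ?_ <;> intro x hx <;>
      simp [updateProg, mulProg, mov, forLt, Prog.writes, Prog.stores] <;> omega
  · exact hd₄.congr fun v => by rw [b7, hcol v v.2]
  · simp only [tryTime]
    omega

end

/-! ### Exhaustive search over the table rows and both moduli. -/

section

variable {n : ℕ} {G : SimpleGraph (Fin n)} {w : Fin n → ℕ}

/-- Try all colourings in the table, for the moduli `r₆₁` and `r₆₂`. -/
def rowsProg (p : Prog) : Prog := forLt 58 28 3 (tryProg p ;; .add 57 57 23)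

theorem rowsProg_writes (p : Prog) (x : ℕ) (hx : x < 99)
    (h : x ∉ [3, 4, 5, 6, 10, 11, 12, 13, 57, 58, 59, 60, 63, 64, 65, 67, 68, 69, 70, 71, 72, 73,
      74, 75, 76]) :
    (rowsProg p).writes x = false := by
  simp at h
  have := tryProg_writes p x hx (by simp; tauto)
  simp [rowsProg, forLt, Prog.writes, this]
  omega

theorem rowsProg_stores (p : Prog) (a : ℕ) (ha : a < 20)
    (h : a ∉ [0, 7, 8, 9, 10, 11]) : (rowsProg p).stores a = false := by
  have := tryProg_stores p a ha h
  simp [rowsProg, forLt, Prog.stores, this]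

theorem wp_rowsProg {p : Prog} {s : State} {ℓ τ c m₁ m₂ N : ℕ} {rows : List (ℕ → ℕ)}
    (hp : Solves p G ℓ τ) (hn : s.reg 0 = n) (hℓ : s.reg 1 = ℓ) (hc : s.reg 2 = c)
    (h₁ : s.reg 61 = m₁) (h₂ : s.reg 62 = m₂) (hm₁ : 0 < m₁) (hm₂ : 0 < m₂) (hmN : m₂ ≤ N)
    (hN : s.reg 23 = N) (h28 : s.reg 28 = rows.length) (hr : Holds (s.arr 4) (s.reg 57) N rows)
    (hs : SimReady n s) (hF : Feasible G w ℓ c s) {Q : State → ℕ → Prop}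
    (hQ : ∀ s' k, Frame (rowsProg p) s s' → SimReady n s' → Feasible G w ℓ c s' →
      s.reg 76 ≤ s'.reg 76 →
      (∀ f ∈ rows, Dominates G w ℓ c (s'.reg 76) (fun v => f (v % m₁ % m₂))) →
      k ≤ rows.length * (tryTime n ℓ c τ + 5) + 3 → Q s' k) :
    WP G w (rowsProg p) s Q := by
  suffices key : WP G w (rowsProg p) s fun s' k => SimReady n s' ∧ Feasible G w ℓ c s' ∧
      s.reg 76 ≤ s'.reg 76 ∧
      (∀ f ∈ rows, Dominates G w ℓ c (s'.reg 76) (fun v => f (v % m₁ % m₂))) ∧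
      k ≤ rows.length * (tryTime n ℓ c τ + 5) + 3 from
    key.imp fun s' k hf hq => hQ s' k hf hq.1 hq.2.1 hq.2.2.1 hq.2.2.2.1 hq.2.2.2.2
  refine wp_forLt (fun r s' => SimReady n s' ∧ Feasible G w ℓ c s' ∧ s.reg 76 ≤ s'.reg 76 ∧
    s'.reg 57 = s.reg 57 + r * N ∧ ∀ (i : ℕ) (hi : i < rows.length), i < r →
      Dominates G w ℓ c (s'.reg 76) (fun v => rows[i] (v % m₁ % m₂)))
    (tryTime n ℓ c τ + 1) rows.length h28 (by decide) ?_ ?_ ?_ ⟨hs, hF, le_rfl, by simp, by simp⟩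
    ?_ ?_
  · simp [Prog.writes, tryProg_writes]
  · simp [Prog.writes, tryProg_writes]
  · rintro r s' a b ⟨q1, q2, q3, q4, q5⟩
    exact ⟨by simpa using q1, q2.congr (by simp) (by simp), by simpa using q3, by simpa using q4,
      by simpa using q5⟩
  · rintro r s' hr' hi hm hf ⟨q1, q2, q3, q4, q5⟩
    have fr : ∀ x, x < 99 → x ∉ [3, 4, 5, 6, 10, 11, 12, 13, 57, 58, 59, 60, 63, 64, 65, 67, 68,
        69, 70, 71, 72, 73, 74, 75, 76] → s'.reg x = s.reg x :=
      fun x h1 h2 => hf.reg x (rowsProg_writes p x h1 h2)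
    have a4 := hf.arr 4 (rowsProg_stores p 4 (by decide) (by decide))
    simp only [wp_seq, wp_add]
    refine wp_tryProg hp ((fr 0 (by decide) (by decide)).trans hn)
      ((fr 1 (by decide) (by decide)).trans hℓ) ((fr 2 (by decide) (by decide)).trans hc)
      ((fr 61 (by decide) (by decide)).trans h₁) ((fr 62 (by decide) (by decide)).trans h₂)
      hm₁ hm₂ q1 q2 fun s₁ k₁ f₁ t1 t2 t3 t4 t5 => ?_
    have b57 := f₁.reg 57 (tryProg_writes p _ (by decide) (by decide))
    have b23 := f₁.reg 23 (tryProg_writes p _ (by decide) (by decide))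
    have a23 := fr 23 (by decide) (by decide)
    refine ⟨⟨by simpa using t1, t2.congr (by simp) (by simp), by simpa using q3.trans t3, ?_, ?_⟩,
      by omega⟩
    · rw [State.setReg_self, b57, q4, b23, a23, hN]
      ring
    · intro i hi' hir
      rw [State.setReg_ne _ _ (by decide)]
      rcases Nat.lt_succ_iff_lt_or_eq.1 hir with h | rfl
      · exact (q5 i hi' h).mono t3
      · refine t4.congr fun v => ?_
        rw [a4, q4]
        exact hr i hi' _ ((Nat.mod_lt _ hm₂).trans_le hmN)
  · rintro s' k hf ⟨q1, q2, q3, q4, q5⟩ hk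
    refine ⟨q1, q2, q3, fun f hf => ?_, hk⟩
    obtain ⟨i, hi, rfl⟩ := List.getElem_of_mem hf
    exact q5 i hi hi

/-- Try all colourings in the table, for the modulus `r₆₁` and all second moduli. -/
def moduliProg (p : Prog) : Prog :=
  forLt 56 23 3 (.const 3 1 ;; .add 62 56 3 ;; mov 57 29 ;; rowsProg p)

theorem moduliProg_writes (p : Prog) (x : ℕ) (hx : x < 99)
    (h : x ∉ [3, 4, 5, 6, 10, 11, 12, 13, 56, 57, 58, 59, 60, 62, 63, 64, 65, 67, 68, 69, 70, 71,
      72, 73, 74, 75, 76]) :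
    (moduliProg p).writes x = false := by
  simp at h
  have := rowsProg_writes p x hx (by simp; tauto)
  simp [moduliProg, forLt, mov, Prog.writes, this]
  omega

theorem moduliProg_stores (p : Prog) (a : ℕ) (ha : a < 20)
    (h : a ∉ [0, 7, 8, 9, 10, 11]) : (moduliProg p).stores a = false := by
  have := rowsProg_stores p a ha h
  simp [moduliProg, forLt, mov, Prog.stores, this]

/-- A bound for the number of steps of `moduliProg p`, if the table has `R` rows. -/
def moduliTime (n ℓ c τ N R : ℕ) : ℕ := N * (R * (tryTime n ℓ c τ + 5) + 11) + 3

theorem wp_moduliProg {p : Prog} {s : State} {ℓ τ c m₁ N : ℕ} {rows : List (ℕ → ℕ)}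
    (hp : Solves p G ℓ τ) (hn : s.reg 0 = n) (hℓ : s.reg 1 = ℓ) (hc : s.reg 2 = c)
    (h₁ : s.reg 61 = m₁) (hm₁ : 0 < m₁)
    (hN : s.reg 23 = N) (h28 : s.reg 28 = rows.length) (hr : Holds (s.arr 4) (s.reg 29) N rows)
    (hs : SimReady n s) (hF : Feasible G w ℓ c s) {Q : State → ℕ → Prop}
    (hQ : ∀ s' k, Frame (moduliProg p) s s' → SimReady n s' → Feasible G w ℓ c s' →
      s.reg 76 ≤ s'.reg 76 → (∀ m₂ < N, ∀ f ∈ rows,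
        Dominates G w ℓ c (s'.reg 76) (fun v => f (v % m₁ % (m₂ + 1)))) →
      k ≤ moduliTime n ℓ c τ N rows.length → Q s' k) :
    WP G w (moduliProg p) s Q := by
  suffices key : WP G w (moduliProg p) s fun s' k => SimReady n s' ∧ Feasible G w ℓ c s' ∧
      s.reg 76 ≤ s'.reg 76 ∧ (∀ m₂ < N, ∀ f ∈ rows,
        Dominates G w ℓ c (s'.reg 76) (fun v => f (v % m₁ % (m₂ + 1)))) ∧
      k ≤ moduliTime n ℓ c τ N rows.length from
    key.imp fun s' k hf hq => hQ s' k hf hq.1 hq.2.1 hq.2.2.1 hq.2.2.2.1 hq.2.2.2.2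
  refine wp_forLt (fun j s' => SimReady n s' ∧ Feasible G w ℓ c s' ∧ s.reg 76 ≤ s'.reg 76 ∧
    ∀ m₂ < j, ∀ f ∈ rows, Dominates G w ℓ c (s'.reg 76) (fun v => f (v % m₁ % (m₂ + 1))))
    (rows.length * (tryTime n ℓ c τ + 5) + 7) N hN (by decide) ?_ ?_ ?_ ⟨hs, hF, le_rfl, by simp⟩
    ?_ ?_
  · simp [mov, Prog.writes, rowsProg_writes]
  · simp [mov, Prog.writes, rowsProg_writes]
  · rintro r s' a b ⟨q1, q2, q3, q4⟩
    exact ⟨by simpa using q1, q2.congr (by simp) (by simp), by simpa using q3, by simpa using q4⟩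
  · rintro j s' hj hi hm hf ⟨q1, q2, q3, q4⟩
    have fr : ∀ x, x < 99 → x ∉ [3, 4, 5, 6, 10, 11, 12, 13, 56, 57, 58, 59, 60, 62, 63, 64, 65,
        67, 68, 69, 70, 71, 72, 73, 74, 75, 76] → s'.reg x = s.reg x :=
      fun x h1 h2 => hf.reg x (moduliProg_writes p x h1 h2)
    have a4 := hf.arr 4 (moduliProg_stores p 4 (by decide) (by decide))
    have a0 := fr 0 (by decide) (by decide)
    have a1 := fr 1 (by decide) (by decide)
    have a2 := fr 2 (by decide) (by decide)
    have a61 := fr 61 (by decide) (by decide)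
    have a28 := fr 28 (by decide) (by decide)
    have a29 := fr 29 (by decide) (by decide)
    simp only [wp_seq, wp_mov, wp_const, wp_add]
    refine wp_rowsProg (m₂ := j + 1) (N := N) (rows := rows) hp (by simp [a0, hn]) (by simp [a1, hℓ]) (by simp [a2, hc])
      (by simp [a61, h₁]) (by simp [hi]) hm₁ (by omega) hj (by simp [hm]) (by simp [a28, h28])
      (by simpa [a29, a4] using hr) (by simpa using q1) (q2.congr (by simp) (by simp))
      fun s₁ k₁ f₁ t1 t2 t3 t4 t5 => ?_
    simp at t3
    refine ⟨⟨t1, t2, q3.trans t3, fun m₂ hm₂ f hf => ?_⟩, by omega⟩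
    rcases Nat.lt_succ_iff_lt_or_eq.1 hm₂ with h | rfl
    · exact (q4 m₂ h f hf).mono t3
    · exact t4 f hf
  · rintro s' k hf ⟨q1, q2, q3, q4⟩ hk
    exact ⟨q1, q2, q3, q4, hk⟩

/-- Try all colourings in the table, for all moduli. -/
def searchProg (p : Prog) : Prog :=
  forLt 55 22 3 (.const 3 1 ;; .add 61 55 3 ;; moduliProg p)

theorem searchProg_writes (p : Prog) (x : ℕ) (hx : x < 99)
    (h : x ∉ [3, 4, 5, 6, 10, 11, 12, 13, 55, 56, 57, 58, 59, 60, 61, 62, 63, 64, 65, 67, 68, 69,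
      70, 71, 72, 73, 74, 75, 76]) :
    (searchProg p).writes x = false := by
  simp at h
  have := moduliProg_writes p x hx (by simp; tauto)
  simp [searchProg, forLt, Prog.writes, this]
  omega

theorem searchProg_stores (p : Prog) (a : ℕ) (ha : a < 20)
    (h : a ∉ [0, 7, 8, 9, 10, 11]) : (searchProg p).stores a = false := by
  have := moduliProg_stores p a ha h
  simp [searchProg, forLt, Prog.stores, this]

/-- A bound for the number of steps of `searchProg p`, if the table has `R` rows. -/
def searchTime (n ℓ c τ B N R : ℕ) : ℕ := B * (moduliTime n ℓ c τ N R + 6) + 3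

theorem wp_searchProg {p : Prog} {s : State} {ℓ τ c B N : ℕ} {rows : List (ℕ → ℕ)}
    (hp : Solves p G ℓ τ) (hn : s.reg 0 = n) (hℓ : s.reg 1 = ℓ) (hc : s.reg 2 = c)
    (hB : s.reg 22 = B) (hN : s.reg 23 = N) (h28 : s.reg 28 = rows.length)
    (hr : Holds (s.arr 4) (s.reg 29) N rows)
    (hs : SimReady n s) (hF : Feasible G w ℓ c s) :
    WP G w (searchProg p) s fun s' k => Feasible G w ℓ c s' ∧
      (∀ m₁ < B, ∀ m₂ < N, ∀ f ∈ rows,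
        Dominates G w ℓ c (s'.reg 76) (fun v => f (v % (m₁ + 1) % (m₂ + 1)))) ∧
      k ≤ searchTime n ℓ c τ B N rows.length := by
  refine wp_forLt (fun j s' => SimReady n s' ∧ Feasible G w ℓ c s' ∧
    ∀ m₁ < j, ∀ m₂ < N, ∀ f ∈ rows,
      Dominates G w ℓ c (s'.reg 76) (fun v => f (v % (m₁ + 1) % (m₂ + 1))))
    (moduliTime n ℓ c τ N rows.length + 2) B hB (by decide) ?_ ?_ ?_ ⟨hs, hF, by simp⟩
    ?_ ?_
  · simp [Prog.writes, moduliProg_writes]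
  · simp [Prog.writes, moduliProg_writes]
  · rintro r s' a b ⟨q1, q2, q3⟩
    exact ⟨by simpa using q1, q2.congr (by simp) (by simp), by simpa using q3⟩
  · rintro j s' hj hi hm hf ⟨q1, q2, q3⟩
    have fr : ∀ x, x < 99 → x ∉ [3, 4, 5, 6, 10, 11, 12, 13, 55, 56, 57, 58, 59, 60, 61, 62, 63,
        64, 65, 67, 68, 69, 70, 71, 72, 73, 74, 75, 76] → s'.reg x = s.reg x :=
      fun x h1 h2 => hf.reg x (searchProg_writes p x h1 h2)
    have a4 := hf.arr 4 (searchProg_stores p 4 (by decide) (by decide))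
    have a0 := fr 0 (by decide) (by decide)
    have a1 := fr 1 (by decide) (by decide)
    have a2 := fr 2 (by decide) (by decide)
    have a23 := fr 23 (by decide) (by decide)
    have a28 := fr 28 (by decide) (by decide)
    have a29 := fr 29 (by decide) (by decide)
    simp only [wp_seq, wp_const, wp_add]
    refine wp_moduliProg (m₁ := j + 1) (N := N) (rows := rows) hp (by simp [a0, hn]) (by simp [a1, hℓ]) (by simp [a2, hc])
      (by simp [hi]) (by omega) (by simp [a23, hN]) (by simp [a28, h28])
      (by simpa [a29, a4] using hr) (by simpa using q1) (q2.congr (by simp) (by simp))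
      fun s₁ k₁ f₁ t1 t2 t3 t4 t5 => ?_
    simp at t3
    refine ⟨⟨t1, t2, fun m₁ hm₁ m₂ hm₂ f hf => ?_⟩, by omega⟩
    rcases Nat.lt_succ_iff_lt_or_eq.1 hm₁ with h | rfl
    · exact (q3 m₁ h m₂ hm₂ f hf).mono t3
    · exact t4 m₂ hm₂ f hf
  · rintro s' k hf ⟨q1, q2, q3⟩ hk
    exact ⟨q2, q3, hk⟩

/-! ### The complete program and its correctness. -/

/-- Find an induced `r₂`-colourable subgraph of maximum weight with at most `r₁` vertices. -/
def colorableProg (p : Prog) : Prog :=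
  .ite 0 (.ite 1 (.ite 2 (tableProg ;; searchProg p) (.const 3 0)) (.const 3 0)) (.const 3 0)

theorem Feasible.init {ℓ c : ℕ} {s : State} (h1 : s.reg 76 = 0) (h2 : ∀ i, s.arr 0 i = 0) :
    Feasible G w ℓ c s :=
  ⟨∅, by simp, by
    have : IsEmpty ((∅ : Finset (Fin n)) : Set (Fin n)) := by simp
    exact SimpleGraph.Colorable.of_isEmpty _, by simp, by simp [h2], by simp [h1]⟩

/-- Given a competitor `T` with a proper colouring, hashing produces moduli and a table row that
induce exactly this colouring on `T`. The search tried that row, so its best value is at least the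
weight of `T`. -/
theorem isMaxWeightColorable_of_dominates {ℓ c k : ℕ} {s : State} {B N : ℕ}
    {rows : List (ℕ → ℕ)} (hF : Feasible G w ℓ c s) (hk : ℓ ≤ k)
    (hB : hashBound n k = B) (hN : hashBound B k = N) (hr : Universal N k (· < c) rows)
    (hd : ∀ m₁ < B, ∀ m₂ < N, ∀ f ∈ rows,
        Dominates G w ℓ c (s.reg 76) (fun v => f (v % (m₁ + 1) % (m₂ + 1)))) :
    IsMaxWeightColorable G w c ℓ (s.output n) := by
  obtain ⟨S, h1, h2, h3, h4, h5⟩ := hF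
  -- The output array holds weights rather than ones. It is a valid indicator because members of `S`
  -- have nonzero weight.
  have hS : s.output n = S := by
    ext v
    by_cases hv : v ∈ S <;> simp [State.output, h4, hv, h3]
  rw [hS]
  refine ⟨⟨h1, h2⟩, fun T ⟨hT, hcol⟩ => ?_⟩
  obtain ⟨col⟩ := hcol
  subst hB
  classical
  obtain ⟨m₁, m₂, hm₁, hm₂, f, hf, he⟩ := exists_hash_coloring (S := T) hN hr (hT.trans hk)
    (col := fun v => if h : v ∈ T then (col ⟨v, h⟩ : ℕ) else 0) fun v hv => by simp [hv]
  rw [← h5]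
  refine hd m₁ hm₁ m₂ hm₂ f hf T hT (fun v hv => ?_) fun u hu v hv huv ha => ?_
  · simp only [he v hv, dif_pos hv]
    exact Fin.is_lt _
  · simp only [he v hv, he u hu, dif_pos hv, dif_pos hu] at huv
    exact col.valid (v := ⟨u, hu⟩) (w := ⟨v, hv⟩) ha (Fin.ext huv)

theorem outputs_colorableProg {p : Prog} {ℓ c τ : ℕ} (hn : 1 ≤ n) (hℓ : 1 ≤ ℓ) (hc : 1 ≤ c)
    (hp : Solves p G ℓ τ) : ∃ S t k f, (colorableProg p).Outputs G w [n, ℓ, c] S t ∧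
      IsMaxWeightColorable G w c ℓ S ∧ k * k ≤ ℓ + 2 * k ∧ k ≤ ℓ ∧
      ∃ B N, hashBound n (k * k) = B ∧ hashBound B (k * k) = N ∧
      f ≤ c ^ k * Nat.size (((N + 1) * (N * c)) ^ k) + 1 ∧
      t ≤ tableTime n ℓ c k B N f + searchTime n ℓ c τ B N (((N + 1) * f) ^ k) + 3 := by
  have key : WP G w (colorableProg p) (State.init [n, ℓ, c]) fun s' t => ∃ k f,
      IsMaxWeightColorable G w c ℓ (s'.output n) ∧ k * k ≤ ℓ + 2 * k ∧ k ≤ ℓ ∧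
      ∃ B N, hashBound n (k * k) = B ∧ hashBound B (k * k) = N ∧
      f ≤ c ^ k * Nat.size (((N + 1) * (N * c)) ^ k) + 1 ∧
      t ≤ tableTime n ℓ c k B N f + searchTime n ℓ c τ B N (((N + 1) * f) ^ k) + 3 := by
    simp only [colorableProg, wp_ite]
    refine ⟨fun _ => ⟨fun _ => ⟨fun _ => ?_, fun h => ?_⟩, fun h => ?_⟩, fun h => ?_⟩
    · simp only [wp_seq]
      refine wp_tableProg (n := n) (ℓ := ℓ) (c := c) rfl rfl rfl hc (fun _ _ => rfl)
        fun s₁ t₁ k f rows B N f₁ h1 h2 h3 h4 h5 h6 h7 h8 h9 h10 h11 h12 h13 => ?_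
      have a0 : s₁.reg 0 = n := f₁.reg 0 rfl
      have a1 : s₁.reg 1 = ℓ := f₁.reg 1 rfl
      have a2 : s₁.reg 2 = c := f₁.reg 2 rfl
      have a76 : s₁.reg 76 = 0 := f₁.reg 76 rfl
      have aA : ∀ i, s₁.arr 0 i = 0 := fun i => by rw [f₁.arr 0 rfl]; rfl
      have hS : SimReady n s₁ := by
        refine SimReady.of_frame ⟨fun x => ?_, fun a i => ?_, fun i _ => rfl⟩ f₁ ?_ ?_
        -- Three successors are split off so that `simp` can look past the three arguments of the
        -- initial state.
        · rw [show 101 + 2 * x = 2 * x + 98 + 1 + 1 + 1 by ring]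
          simp [State.init]
        · simp [State.init]
        · intro x hx
          simp [tableProg, paramProg, sqrtProg, sizeProg, mulProg, mov, forLt,
            pointProg, cutRow, cutRows, cutPoints, chainLevel, chainProg, colorSum, bestColor, updateWeights, colorColumns, updateAlive, greedyRound, greedyProg, Prog.writes]
          omega
        · intro a ha
          simp [tableProg, paramProg, sqrtProg, sizeProg, mulProg, mov, forLt,
            pointProg, cutRow, cutRows, cutPoints, chainLevel, chainProg, colorSum, bestColor, updateWeights, colorColumns, updateAlive, greedyRound, greedyProg, Prog.stores]
          omega
      refine (wp_searchProg hp a0 a1 a2 h6 h7 h8 h9 hS (.init a76 aA)).imp ?_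
      rintro s₂ t₂ - ⟨q1, q2, q3⟩
      rw [h11] at q3
      exact ⟨k, f, isMaxWeightColorable_of_dominates q1 h1 h4 h5 h10 q2, h2, h3, B, N, h4, h5,
        h12, by omega⟩
    · exact absurd h (by simp [State.init]; omega)
    · exact absurd h (by simp [State.init]; omega)
    · exact absurd h (by simp [State.init]; omega)
  obtain ⟨s', t, he, k, f, h1, h⟩ := key
  exact ⟨_, t, k, f, ⟨s', he, rfl⟩, h1, h⟩

/-- Without vertices, size or colours the empty set is the only feasible one, so it suffices to halt
with the output array untouched. -/
theorem outputs_colorableProg_of_eq_zero {p : Prog} {ℓ c : ℕ} (h : n = 0 ∨ ℓ = 0 ∨ c = 0) :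
    ∃ S t, (colorableProg p).Outputs G w [n, ℓ, c] S t ∧ IsMaxWeightColorable G w c ℓ S := by
  have key : WP G w (colorableProg p) (State.init [n, ℓ, c]) fun s' _ => s'.output n = ∅ := by
    simp only [colorableProg, wp_ite, wp_const]
    have e : ∀ a i, ((State.init [n, ℓ, c]).setReg a i).output n = ∅ := by
      simp [State.output, State.init]
    refine ⟨fun h0 => ⟨fun h1 => ⟨fun h2 => ?_, fun _ => e _ _⟩, fun _ => e _ _⟩, fun _ => e _ _⟩
    simp [State.init] at h0 h1 h2
    omega
  obtain ⟨s', t, he, h0⟩ := key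
  refine ⟨∅, t, ⟨s', he, h0⟩, ⟨by simp, ?_⟩, fun T hT => ?_⟩
  · have : IsEmpty ((∅ : Finset (Fin n)) : Set (Fin n)) := by simp
    exact SimpleGraph.Colorable.of_isEmpty _
  · have : T = ∅ := by
      refine Finset.eq_empty_of_forall_notMem fun v hv => ?_
      rcases h with rfl | rfl | rfl
      · exact v.elim0
      · have := hT.1
        simp at this
        simp [this] at hv
      · obtain ⟨col⟩ := hT.2
        exact (col ⟨v, hv⟩).elim0
    simp [this]

end

section

variable {n : ℕ} {G : SimpleGraph (Fin n)} {w : Fin n → ℕ}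

/-! ### A lower bound for the running time -/

/-- A computation of `k` steps reads at most `k` weights. -/
theorem Exec.exists_reads {p : Prog} {s s' : State} {k : ℕ} (h : Exec G w p s s' k) :
    ∃ R : Finset ℕ, R.card ≤ k ∧ ∀ w' : Fin n → ℕ,
      (∀ i ∈ R, weightEntry w' i = weightEntry w i) → Exec G w' p s s' k := by
  induction h with
  | const s x k => exact ⟨∅, by simp, fun w' _ => .const s x k⟩
  | add s x y z => exact ⟨∅, by simp, fun w' _ => .add s x y z⟩
  | sub s x y z => exact ⟨∅, by simp, fun w' _ => .sub s x y z⟩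
  | half s x y => exact ⟨∅, by simp, fun w' _ => .half s x y⟩
  | load s x a y => exact ⟨∅, by simp, fun w' _ => .load s x a y⟩
  | store s a x y => exact ⟨∅, by simp, fun w' _ => .store s a x y⟩
  | adj s x y z => exact ⟨∅, by simp, fun w' _ => .adj s x y z⟩
  | weight s x y =>
    refine ⟨{s.reg y}, by simp, fun w' hw => ?_⟩
    rw [← hw _ (Finset.mem_singleton_self _)]
    exact .weight s x y
  | seq _ _ ih₁ ih₂ =>
    obtain ⟨R₁, c₁, h₁⟩ := ih₁
    obtain ⟨R₂, c₂, h₂⟩ := ih₂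
    exact ⟨R₁ ∪ R₂, (Finset.card_union_le _ _).trans (Nat.add_le_add c₁ c₂), fun w' hw =>
      .seq (h₁ w' fun i hi => hw i (Finset.mem_union_left _ hi))
        (h₂ w' fun i hi => hw i (Finset.mem_union_right _ hi))⟩
  | ite_true hx _ ih =>
    obtain ⟨R, c, h⟩ := ih
    exact ⟨R, c.trans (Nat.le_succ _), fun w' hw => .ite_true hx (h w' hw)⟩
  | ite_false hx _ ih =>
    obtain ⟨R, c, h⟩ := ih
    exact ⟨R, c.trans (Nat.le_succ _), fun w' hw => .ite_false hx (h w' hw)⟩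
  | loop_stop hx => exact ⟨∅, by simp, fun w' _ => Exec.loop_stop hx⟩
  | loop_step hx _ _ ih₁ ih₂ =>
    obtain ⟨R₁, c₁, h₁⟩ := ih₁
    obtain ⟨R₂, c₂, h₂⟩ := ih₂
    exact ⟨R₁ ∪ R₂, (Finset.card_union_le _ _).trans ((Nat.add_le_add c₁ c₂).trans (Nat.le_succ _)),
      fun w' hw => .loop_step hx (h₁ w' fun i hi => hw i (Finset.mem_union_left _ hi))
        (h₂ w' fun i hi => hw i (Finset.mem_union_right _ hi))⟩

/-- An adversary argument. On zero weights and `ℓ = 1`, a run that is too short leaves a vertex that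
is neither read nor in the output. Raising its weight to one changes neither the run nor the output,
which is then no longer optimal. -/
theorem le_succ_of_computesMaxWeightIndepSet {p : Prog} {C : GraphClass} {t : ℕ → ℕ → ℕ}
    (hp : ComputesMaxWeightIndepSet p C t) (hG : C.Mem G) (hn : 1 ≤ n) : n ≤ t 1 n + 1 := by
  by_contra! hlt
  obtain ⟨S, k, ⟨s, he, hS⟩, hmax, hk⟩ := hp n G (fun _ => 0) 1 hG
  obtain ⟨R, hRc, hR⟩ := he.exists_reads
  have hk := hk hn le_rfl
  obtain ⟨i, hi, hv⟩ := Finset.exists_mem_notMem_of_card_lt_card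
    (s := R ∪ S.map Fin.valEmbedding) (t := Finset.range n) (by
      have h1 := Finset.card_union_le R (S.map Fin.valEmbedding)
      have h2 := hmax.1.1
      rw [Finset.card_map] at h1
      rw [Finset.card_range]
      omega)
  rw [Finset.mem_union, not_or] at hv
  obtain ⟨v, rfl⟩ : ∃ v : Fin n, (v : ℕ) = i := ⟨⟨i, Finset.mem_range.1 hi⟩, rfl⟩
  have hvS : v ∉ S := fun h => hv.2 (Finset.mem_map_of_mem Fin.valEmbedding h)
  let w' : Fin n → ℕ := fun u => if u = v then 1 else 0
  have he' := hR w' fun i hi => by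
    simp only [weightEntry, w']
    split_ifs with h1 h2
    · exact absurd hi (by rw [show i = v by rw [← h2]]; exact hv.1)
    · rfl
    · rfl
  obtain ⟨S', k', ⟨s'', he'', hS'⟩, hmax', -⟩ := hp n G w' 1 hG
  obtain ⟨rfl, rfl⟩ := he'.unique he''
  obtain rfl : S = S' := hS.symm.trans hS'
  have := hmax'.2 {v} ⟨by simp, by simp [SimpleGraph.IsIndepSet]⟩
  simp [w', hvS] at this

theorem solves_of_computesMaxWeightIndepSet {p : Prog} {C : GraphClass} {t : ℕ → ℕ → ℕ}
    (ht : ∀ ℓ ℓ' n n' : ℕ, ℓ ≤ ℓ' → n ≤ n' → t ℓ n ≤ t ℓ' n')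
    (hp : ComputesMaxWeightIndepSet p C t) (hG : C.Mem G) (hn : 1 ≤ n) (ℓ : ℕ) :
    Solves p G ℓ (t ℓ n) := by
  intro w i h1 h2
  obtain ⟨S, k, hS, hmax, hk⟩ := hp n G w i hG
  exact ⟨S, k, hS, hmax, (hk hn h1).trans (ht _ _ _ _ h2 le_rfl)⟩

end

/-! ### The running time -/

theorem hashBound_le {n ℓ L : ℕ} (hn : 1 ≤ n) (hℓ : 1 ≤ ℓ) (hL : L ≤ 3 * ℓ) :
    hashBound n L ≤ 36 * (Nat.size n * (ℓ * ℓ)) := by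
  rw [hashBound]
  have h0 : 1 ≤ Nat.size n := Nat.lt_size.2 (by simpa using hn)
  have h1 : Nat.size n * (L * L) ≤ Nat.size n * (3 * ℓ * (3 * ℓ)) := by gcongr
  have h2 : 1 ≤ Nat.size n * (ℓ * ℓ) := Nat.mul_pos h0 (Nat.mul_pos hℓ hℓ)
  have h3 : Nat.size n * (3 * ℓ * (3 * ℓ)) = 9 * (Nat.size n * (ℓ * ℓ)) := by ring
  omega

theorem size_hashBound_le {n ℓ L : ℕ} (hn : 1 ≤ n) (hℓ : 1 ≤ ℓ) (hL : L ≤ 3 * ℓ) :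
    Nat.size (hashBound n L) ≤ Nat.size (Nat.size n) + 2 * ℓ + 6 := by
  refine Nat.size_le.2 ((hashBound_le hn hℓ hL).trans_lt ?_)
  have h1 := Nat.lt_size_self (Nat.size n)
  have h2 : ℓ < 2 ^ ℓ := Nat.lt_two_pow_self
  have h3 : Nat.size n * (ℓ * ℓ) ≤ 2 ^ Nat.size (Nat.size n) * (2 ^ ℓ * 2 ^ ℓ) := by gcongr
  have h4 : 0 < 2 ^ Nat.size (Nat.size n) * (2 ^ ℓ * 2 ^ ℓ) := by positivity
  have h5 : 2 ^ (Nat.size (Nat.size n) + 2 * ℓ + 6) =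
      64 * (2 ^ Nat.size (Nat.size n) * (2 ^ ℓ * 2 ^ ℓ)) := by ring
  rw [h5]
  linarith

/-- The width of the table depends on `n` only through `Nat.size (Nat.size n)`, which is what the
second hashing is for. -/
theorem hashBound_hashBound_lt {n ℓ L Z : ℕ} (hn : 1 ≤ n) (hℓ : 1 ≤ ℓ) (hL : L ≤ 3 * ℓ)
    (hZ : Nat.size (Nat.size n) + 2 * ℓ + 6 ≤ Z) (hZ36 : 36 ≤ Z) :
    hashBound (hashBound n L) L < Z ^ 4 := by
  have h0 : 1 ≤ hashBound n L := by
    rw [hashBound]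
    omega
  have h1 := hashBound_le h0 hℓ hL
  have h2 := size_hashBound_le hn hℓ hL
  have h3 : Nat.size (hashBound n L) * (ℓ * ℓ) < Z * (Z * Z) :=
    Nat.mul_lt_mul_of_le_of_lt (by omega) (Nat.mul_lt_mul'' (by omega) (by omega)) (by omega)
  calc hashBound (hashBound n L) L ≤ 36 * (Nat.size (hashBound n L) * (ℓ * ℓ)) := h1
    _ < 36 * (Z * (Z * Z)) := by omega
    _ ≤ Z * (Z * (Z * Z)) := by gcongr
    _ = Z ^ 4 := by ring

/-- A bound for the time of the computation of the table. -/
theorem tableTime_le {n ℓ c k f B N σ Z V W M : ℕ} (hσ : Nat.size n = σ) (hσ1 : 1 ≤ σ)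
    (hℓZ : ℓ + 1 ≤ Z) (hkℓ : k ≤ ℓ) (hkk : k * k ≤ 3 * ℓ) (hcZ : c + 7 ≤ Z) (hZ36 : 36 ≤ Z)
    (hsB : Nat.size B ≤ Z) (hN1 : N + 1 ≤ Z ^ 4) (hNc : N * c + 1 ≤ Z ^ 5) (hW1 : 1 ≤ W)
    (hV1 : 1 ≤ V) (hRP : ((N + 1) * (N * c + 1)) ^ k ≤ W ^ 9)
    (hS : c ^ k * Nat.size (((N + 1) * (N * c)) ^ k) + 2 ≤ W * Z ^ 4) (hf : f + 1 ≤ W * Z ^ 4)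
    (hR : ((N + 1) * (f + 1)) ^ k ≤ V * W ^ 10) (hM : σ * V * W ^ 11 * Z ^ 18 ≤ M) :
    tableTime n ℓ c k B N f ≤ 5 * M + 6 := by
  have hZp : ∀ a b, a ≤ b → Z ^ a ≤ Z ^ b := fun a b h => Nat.pow_le_pow_right (by omega) h
  have hWp : ∀ a b, a ≤ b → W ^ a ≤ W ^ b := fun a b h => Nat.pow_le_pow_right hW1 h
  have h90 : 90 ≤ Z ^ 2 := by nlinarith
  have hWZ : ∀ X, 1 ≤ X → X + 1 ≤ X * Z := fun X hX => by nlinarith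
  have hW9 : 1 ≤ W ^ 9 := Nat.one_le_pow _ _ hW1
  have hW10 : 1 ≤ W ^ 10 := Nat.one_le_pow _ _ hW1
  -- The exponents `18` and `11` dominate those in all five summands of the time bound.
  have hMb : ∀ a b d, a ≤ 18 → b ≤ 11 → d ≤ V → Z ^ a * W ^ b * d ≤ M := by
    intro a b d ha hb hd
    calc Z ^ a * W ^ b * d ≤ Z ^ 18 * W ^ 11 * V :=
          Nat.mul_le_mul (Nat.mul_le_mul (hZp _ _ ha) (hWp _ _ hb)) hd
      _ = 1 * V * W ^ 11 * Z ^ 18 := by ring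
      _ ≤ σ * V * W ^ 11 * Z ^ 18 := by gcongr
      _ ≤ M := hM
  have hRP' : ((N + 1) * (N * c)) ^ k ≤ W ^ 9 :=
    (Nat.pow_le_pow_left (Nat.mul_le_mul_left _ (Nat.le_succ _)) k).trans hRP
  have hT1 : 7 * ℓ + 5 * (k * k) + 9 * σ + 9 * Nat.size B + 60 ≤ M := by
    have h1 : 7 * ℓ + 5 * (k * k) + 9 * σ + 9 * Nat.size B + 60 ≤ 9 * σ + 33 * Z := by
      clear * - hkk hℓZ hsB hZ36
      omega
    calc 7 * ℓ + 5 * (k * k) + 9 * σ + 9 * Nat.size B + 60 ≤ σ * Z + σ * (33 * Z) := by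
          refine h1.trans (Nat.add_le_add ?_ (Nat.le_mul_of_pos_left _ hσ1))
          rw [mul_comm]
          exact Nat.mul_le_mul_left _ (by omega)
      _ = σ * (34 * Z) := by ring
      _ ≤ σ * (Z * Z) := by gcongr; omega
      _ = σ * 1 * 1 ^ 11 * Z ^ 2 := by ring
      _ ≤ σ * V * W ^ 11 * Z ^ 18 := by
        gcongr
        · omega
        · omega
      _ ≤ M := hM
  have hT2 : N * (c * 11 + 7) + 5 ≤ M := by
    calc N * (c * 11 + 7) + 5 ≤ (N + 1) * (c * 11 + 7) := by nlinarith
      _ ≤ Z ^ 4 * (Z * Z) := Nat.mul_le_mul hN1 (by nlinarith)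
      _ = Z ^ 6 * W ^ 0 * 1 := by ring
      _ ≤ M := hMb _ _ _ (by omega) (by omega) hV1
  have hT3 : 40 * ((k + 1) * ((((N + 1) * (N * c + 1)) ^ k + 1) *
      ((N * c + 1) * (N + 1) * (N + 1)))) ≤ M := by
    calc _ ≤ Z ^ 2 * (Z * ((W ^ 9 * Z) * (Z ^ 5 * Z ^ 4 * Z ^ 4))) := by
          gcongr
          · omega
          · omega
          · exact (Nat.add_le_add_right hRP 1).trans (hWZ _ hW9)
      _ = Z ^ 17 * W ^ 9 * 1 := by ring
      _ ≤ M := hMb _ _ _ (by omega) (by omega) hV1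
  have hT4 : (c ^ k * Nat.size (((N + 1) * (N * c)) ^ k) + 2) *
      (90 * ((N + 1) * ((c + 1) * (((N + 1) * (N * c)) ^ k + 1)))) ≤ M := by
    calc _ ≤ (W * Z ^ 4) * (Z ^ 2 * (Z ^ 4 * (Z * (W ^ 9 * Z)))) := by
          refine Nat.mul_le_mul hS ?_
          gcongr
          · omega
          · exact (Nat.add_le_add_right hRP' 1).trans (hWZ _ hW9)
      _ = Z ^ 12 * W ^ 10 * 1 := by ring
      _ ≤ M := hMb _ _ _ (by omega) (by omega) hV1
  have hT5 : 40 * ((k + 1) * ((((N + 1) * (f + 1)) ^ k + 1) *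
      ((f + 1) * (N + 1) * (N + 1)))) ≤ M := by
    calc _ ≤ Z ^ 2 * (Z * ((V * W ^ 10 * Z) * ((W * Z ^ 4) * Z ^ 4 * Z ^ 4))) := by
          gcongr
          · omega
          · omega
          · exact (Nat.add_le_add_right hR 1).trans (hWZ _ (Nat.mul_pos hV1 hW10))
      _ = Z ^ 16 * W ^ 11 * V := by ring
      _ ≤ M := hMb _ _ _ (by omega) (by omega) le_rfl
  rw [tableTime, hσ]
  linarith

/-- The hypothesis on `n` absorbs the copying of weight rows into the time `τ` of a call; the rest
is polynomial in `ℓ` and paid for by powers of `Z`. -/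
theorem classTime_le {n ℓ τ Z : ℕ} (hnτ : n ≤ 2 * τ) (hτ : 1 ≤ τ) (hℓZ : 12 * ℓ + 24 ≤ Z) :
    classTime n ℓ τ + 4 ≤ Z ^ 4 * τ := by
  have h1 : improveTime n ℓ τ + 4 ≤ Z ^ 2 * τ := by
    rw [improveTime]
    calc 36 * n + 12 * τ + 5 * ℓ + 50 + 4 ≤ 84 * τ + Z + 44 := by omega
      _ ≤ (128 + Z) * τ := by nlinarith
      _ ≤ Z ^ 2 * τ := by gcongr; nlinarith
  rw [classTime]
  calc ℓ * (ℓ * (improveTime n ℓ τ + 4) + 5 * ℓ + 18) + 3 + 4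
      = ℓ * (ℓ * (improveTime n ℓ τ + 4) + 5 * ℓ + 18) + 7 := by ring
    _ ≤ Z * (ℓ * (Z ^ 2 * τ) + 5 * ℓ + 18) + Z := by gcongr <;> omega
    _ = Z * (ℓ * (Z ^ 2 * τ) + (5 * ℓ + 19)) := by ring
    _ ≤ Z * (ℓ * (Z ^ 2 * τ) + Z * Z * τ) := by
      gcongr
      nlinarith [Nat.mul_le_mul (show 5 * ℓ + 19 ≤ Z * Z by nlinarith) hτ]
    _ = Z * Z ^ 2 * τ * (ℓ + 1) := by ring
    _ ≤ Z * Z ^ 2 * τ * Z := by gcongr; omega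
    _ = Z ^ 4 * τ := by ring

theorem tryTime_le {n ℓ c τ Z : ℕ} (hnτ : n ≤ 2 * τ) (hτ : 1 ≤ τ) (hℓZ : 12 * ℓ + 24 ≤ Z)
    (hcZ : c + 7 ≤ Z) : tryTime n ℓ c τ + 5 ≤ Z ^ 6 * τ := by
  have h1 := classTime_le hnτ hτ hℓZ
  have h2 : (ℓ + 1) * (5 * n + 10) + 24 * n + 5 * ℓ + 60 + 5 ≤ Z ^ 4 * τ := by
    calc (ℓ + 1) * (5 * n + 10) + 24 * n + 5 * ℓ + 60 + 5
        = (5 * ℓ + 29) * n + (15 * ℓ + 75) * 1 := by ring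
      _ ≤ (5 * ℓ + 29) * (2 * τ) + (15 * ℓ + 75) * τ := by gcongr
      _ = (25 * ℓ + 133) * τ := by ring
      _ ≤ (Z * Z) * (1 * 1) * τ := by gcongr; nlinarith
      _ ≤ (Z * Z) * (Z * Z) * τ := by gcongr <;> omega
      _ = Z ^ 4 * τ := by ring
  calc tryTime n ℓ c τ + 5 =
        c * (classTime n ℓ τ + 4) + ((ℓ + 1) * (5 * n + 10) + 24 * n + 5 * ℓ + 60 + 5) := by
        rw [tryTime]
        ring
    _ ≤ c * (Z ^ 4 * τ) + Z ^ 4 * τ := by gcongr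
    _ = (c + 1) * (Z ^ 4 * τ) := by ring
    _ ≤ Z * Z * (Z ^ 4 * τ) := by gcongr; nlinarith
    _ = Z ^ 6 * τ := by ring

/-- The factor `σ`, the binary length of `n`, enters only through the number `B` of first moduli. -/
theorem searchTime_le {n ℓ c τ B N R σ Z X : ℕ} (hnτ : n ≤ 2 * τ) (hτ : 1 ≤ τ)
    (hσ1 : 1 ≤ σ) (hℓZ : 12 * ℓ + 24 ≤ Z) (hcZ : c + 7 ≤ Z) (hB : B ≤ σ * Z ^ 3)
    (hN : N + 1 ≤ Z ^ 4) (hR : R ≤ X) (hX : 1 ≤ X) :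
    searchTime n ℓ c τ B N R ≤ σ * X * Z ^ 16 * τ := by
  have h1 := tryTime_le hnτ hτ hℓZ hcZ
  have hpos : 1 ≤ X * (Z ^ 6 * τ) :=
    Nat.mul_pos hX (Nat.mul_pos (Nat.pow_pos (by omega)) hτ)
  have hpos' : 1 ≤ Z ^ 4 * (X * (Z ^ 6 * τ) * Z) :=
    Nat.mul_pos (Nat.pow_pos (by omega)) (Nat.mul_pos hpos (by omega))
  have hpos2 : 1 ≤ σ * Z ^ 3 * (Z ^ 4 * (X * (Z ^ 6 * τ) * Z) * Z) :=
    Nat.mul_pos (Nat.mul_pos hσ1 (Nat.pow_pos (by omega))) (Nat.mul_pos hpos' (by omega))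
  rw [searchTime, moduliTime]
  calc B * (N * (R * (tryTime n ℓ c τ + 5) + 11) + 3 + 6) + 3
      ≤ σ * Z ^ 3 * (Z ^ 4 * (X * (Z ^ 6 * τ) + 11) + 3 + 6) + 3 := by gcongr; omega
    _ ≤ σ * Z ^ 3 * (Z ^ 4 * (X * (Z ^ 6 * τ) * Z) + 3 + 6) + 3 := by
      gcongr
      nlinarith
    _ ≤ σ * Z ^ 3 * (Z ^ 4 * (X * (Z ^ 6 * τ) * Z) * Z) + 3 := by
      gcongr
      nlinarith
    _ ≤ σ * Z ^ 3 * (Z ^ 4 * (X * (Z ^ 6 * τ) * Z) * Z) * Z := by nlinarith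
    _ = σ * X * Z ^ 16 * τ := by ring

/-- The number of steps of the program is almost linear in `c ^ ℓ * τ`. -/
theorem tableTime_add_searchTime_le {n ℓ c k f B N τ σ Z : ℕ} (hn : 2 ≤ n) (hℓ : 1 ≤ ℓ)
    (hc : 1 ≤ c) (hnτ : n ≤ 2 * τ) (hk : k * k ≤ ℓ + 2 * k) (hkℓ : k ≤ ℓ)
    (hB : hashBound n (k * k) = B) (hN : hashBound B (k * k) = N)
    (hf : f ≤ c ^ k * Nat.size (((N + 1) * (N * c)) ^ k) + 1) (hσ : Nat.size n = σ)
    (hZ : (ℓ + 2) * (c + 2) * (Nat.size σ + 2) = Z) :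
    tableTime n ℓ c k B N f + searchTime n ℓ c τ B N (((N + 1) * f) ^ k) + 3 ≤
      σ * c ^ ℓ * Z ^ (20 * (k + 1)) * τ := by
  have hσ2 : 2 ≤ σ := by
    rw [← hσ]
    exact Nat.lt_size.2 (by simpa using hn)
  have hx2 : 2 ≤ Nat.size σ := Nat.lt_size.2 (by simpa using hσ2)
  have hZx : 9 * (Nat.size σ + 2) ≤ Z := by
    rw [← hZ]
    exact Nat.mul_le_mul_right _ (Nat.mul_le_mul (show 3 ≤ ℓ + 2 by omega)
      (show 3 ≤ c + 2 by omega))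
  have hZℓ : (ℓ + 2) * 12 ≤ Z := by
    rw [← hZ, mul_assoc]
    exact Nat.mul_le_mul_left _ (Nat.mul_le_mul (show 3 ≤ c + 2 by omega)
      (show 4 ≤ Nat.size σ + 2 by omega))
  have hZc : 3 * (c + 2) * 4 ≤ Z := by
    rw [← hZ]
    exact Nat.mul_le_mul (Nat.mul_le_mul_right _ (by omega)) (by omega)
  have hZs : Nat.size σ + 2 * ℓ + 6 ≤ Z := by
    have := Nat.mul_le_mul (Nat.mul_le_mul_left (ℓ + 2) (show 3 ≤ c + 2 by omega))
      (le_refl (Nat.size σ + 2))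
    rw [hZ] at this
    nlinarith
  have hL : k * k ≤ 3 * ℓ := by omega
  have hB36 := hashBound_le (show 1 ≤ n by omega) hℓ hL
  have hsB := size_hashBound_le (show 1 ≤ n by omega) hℓ hL
  have hN1 := hashBound_hashBound_lt (Z := Z) (show 1 ≤ n by omega) hℓ hL
    (by rw [hσ]; exact hZs) (by omega)
  rw [hB, hσ] at hB36 hsB
  rw [hB, hN] at hN1
  clear hB hN hZ
  -- Opaque names make the powers with variable exponents atoms for the arithmetic below.
  obtain ⟨W, hW⟩ : ∃ W, W = Z ^ k := ⟨_, rfl⟩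
  obtain ⟨V, hV⟩ : ∃ V, V = c ^ ℓ := ⟨_, rfl⟩
  have hNc : N * c + 1 ≤ Z ^ 5 := by
    calc N * c + 1 ≤ N * Z + Z :=
          Nat.add_le_add (Nat.mul_le_mul_left _ (by omega)) (by omega)
      _ = (N + 1) * Z := by ring
      _ ≤ Z ^ 4 * Z := by gcongr; exact hN1
      _ = Z ^ 5 := by ring
  have hW1 : 1 ≤ W := by
    rw [hW]
    exact Nat.one_le_pow _ _ (by omega)
  have hV1 : 1 ≤ V := by
    rw [hV]
    exact Nat.one_le_pow _ _ (by omega)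
  have hck : c ^ k ≤ W := by
    rw [hW]
    exact Nat.pow_le_pow_left (by omega) k
  have hck1 : 1 ≤ c ^ k := Nat.one_le_pow _ _ (by omega)
  -- Rounding √ℓ up costs only `c ^ (2 * k)`, which is absorbed in `W ^ 2`; the main factor stays
  -- exactly `c ^ ℓ`.
  have hckk : c ^ (k * k) ≤ V * W ^ 2 := by
    calc c ^ (k * k) ≤ c ^ (ℓ + 2 * k) := Nat.pow_le_pow_right (by omega) hk
      _ = V * (c ^ k) ^ 2 := by rw [hV, pow_add, mul_comm 2 k, pow_mul]
      _ ≤ V * W ^ 2 := by gcongr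
  have hRP : ((N + 1) * (N * c + 1)) ^ k ≤ W ^ 9 := by
    calc ((N + 1) * (N * c + 1)) ^ k ≤ (Z ^ 4 * Z ^ 5) ^ k := by gcongr; exact hN1
      _ = W ^ 9 := by rw [hW]; ring
  have hS : c ^ k * Nat.size (((N + 1) * (N * c)) ^ k) + 2 ≤ c ^ k * Z ^ 4 := by
    have h1 : Nat.size (((N + 1) * (N * c)) ^ k) ≤ 9 * k * Z + 1 := by
      refine Nat.size_le.2 ?_
      have : Z < 2 ^ Z := Nat.lt_two_pow_self
      calc ((N + 1) * (N * c)) ^ k ≤ ((N + 1) * (N * c + 1)) ^ k :=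
            Nat.pow_le_pow_left (Nat.mul_le_mul_left _ (Nat.le_succ _)) k
        _ ≤ W ^ 9 := hRP
        _ = Z ^ (9 * k) := by rw [hW]; ring
        _ ≤ (2 ^ Z) ^ (9 * k) := by gcongr
        _ = 2 ^ (9 * k * Z) := by rw [← pow_mul, mul_comm]
        _ < 2 ^ (9 * k * Z + 1) := Nat.pow_lt_pow_right (by omega) (by omega)
    have h2 : 9 * k * Z + 3 ≤ Z ^ 4 := by
      calc 9 * k * Z + 3 ≤ Z * Z + Z := Nat.add_le_add (Nat.mul_le_mul_right _ (by omega)) (by omega)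
        _ = (Z + 1) * Z := by ring
        _ ≤ (Z * Z * Z) * Z := by
          gcongr
          calc Z + 1 ≤ 36 * 36 * Z := by omega
            _ ≤ Z * Z * Z := by gcongr <;> omega
        _ = Z ^ 4 := by ring
    calc c ^ k * Nat.size (((N + 1) * (N * c)) ^ k) + 2
        ≤ c ^ k * (9 * k * Z + 1) + c ^ k * 2 :=
          Nat.add_le_add (Nat.mul_le_mul_left _ h1) (by omega)
      _ = c ^ k * (9 * k * Z + 3) := by ring
      _ ≤ c ^ k * Z ^ 4 := by gcongr
  have hf1 : f + 1 ≤ c ^ k * Z ^ 4 := le_trans (by omega) hS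
  have hR' : ((N + 1) * (f + 1)) ^ k ≤ V * W ^ 10 := by
    calc ((N + 1) * (f + 1)) ^ k ≤ (Z ^ 4 * (c ^ k * Z ^ 4)) ^ k := by gcongr; exact hN1
      _ = c ^ (k * k) * W ^ 8 := by rw [hW, pow_mul]; ring
      _ ≤ V * W ^ 2 * W ^ 8 := by gcongr
      _ = V * W ^ 10 := by ring
  have hR : ((N + 1) * f) ^ k ≤ V * W ^ 10 :=
    (Nat.pow_le_pow_left (Nat.mul_le_mul_left _ (Nat.le_succ _)) k).trans hR'
  have hτ : 1 ≤ τ := by omega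
  have hZ1 : 1 ≤ Z := by omega
  obtain ⟨M, hM⟩ : ∃ M, M = σ * V * W ^ 11 * Z ^ 18 * τ := ⟨_, rfl⟩
  have hM1 : 1 ≤ M := by
    rw [hM]
    exact Nat.mul_pos (Nat.mul_pos (Nat.mul_pos (Nat.mul_pos (by omega) hV1)
      (Nat.pow_pos hW1)) (Nat.pow_pos hZ1)) hτ
  have hTable : tableTime n ℓ c k B N f ≤ 5 * M + 6 := by
    refine tableTime_le hσ (by omega) (by omega) hkℓ hL (by omega) (by omega) (by omega) hN1 hNc
      hW1 hV1 hRP (hS.trans (Nat.mul_le_mul_right _ hck)) (hf1.trans (Nat.mul_le_mul_right _ hck))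
      hR' ?_
    rw [hM]
    exact Nat.le_mul_of_pos_right _ hτ
  have hSearch : searchTime n ℓ c τ B N (((N + 1) * f) ^ k) ≤ M := by
    refine (searchTime_le (σ := σ) (X := V * W ^ 10) hnτ hτ (by omega) (by omega) (by omega) ?_ hN1 hR
      (Nat.mul_pos hV1 (Nat.pow_pos hW1))).trans ?_
    · calc B ≤ 36 * (σ * (ℓ * ℓ)) := hB36
        _ ≤ Z * (σ * (Z * Z)) := by gcongr <;> omega
        _ = σ * Z ^ 3 := by ring
    · rw [hM, ← mul_assoc σ V]
      gcongr <;> omega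
  calc tableTime n ℓ c k B N f + searchTime n ℓ c τ B N (((N + 1) * f) ^ k) + 3
      ≤ 36 * M := by linarith
    _ ≤ Z * Z * M := by gcongr; nlinarith
    _ = σ * V * (W ^ 11 * Z ^ 20) * τ := by rw [hM]; ring
    _ ≤ σ * V * Z ^ (20 * (k + 1)) * τ := by
        gcongr
        rw [hW, ← pow_mul, ← pow_add]
        -- The exponent `11 * k + 20` is rounded up to `20 * (k + 1)`.
        exact Nat.pow_le_pow_right hZ1 (by omega)
    _ = σ * c ^ ℓ * Z ^ (20 * (k + 1)) * τ := by rw [hV]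

/-! ### Asymptotic estimates over the reals. -/

/-- The logarithm of y is four times that of its fourth root, hence at most 4 · y^(1/4). Its square
is at most 16√y, and completing the square in √y splits this into the two summands. -/
theorem log_sq_le {y δ : ℝ} (hy : 1 ≤ y) (hδ : 0 < δ) : Real.log y ^ 2 ≤ δ * y + 64 / δ := by
  have h1 : Real.log y ≤ 4 * √√y := by
    have h2 := Real.log_le_sub_one_of_pos (x := √√y) (by positivity)
    rw [Real.log_sqrt (Real.sqrt_nonneg y), Real.log_sqrt (by linarith)] at h2
    linarith
  have h3 : Real.log y ^ 2 ≤ 16 * √y := by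
    calc Real.log y ^ 2 ≤ (4 * √√y) ^ 2 := pow_le_pow_left₀ (Real.log_nonneg hy) h1 2
      _ = 16 * √y := by
        rw [mul_pow, Real.sq_sqrt (Real.sqrt_nonneg y)]
        norm_num
  have h4 : 0 ≤ (δ * √y - 8) ^ 2 / δ := by positivity
  have h5 : (δ * √y - 8) ^ 2 / δ = δ * √y ^ 2 - 16 * √y + 64 / δ := by
    field_simp
    ring
  rw [h5, Real.sq_sqrt (by linarith)] at h4
  linarith

/-- A quasi-polynomial factor `(ℓ + 2) ^ O(√ℓ)` is at most exponential. -/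
theorem exists_pow_le_two_pow : ∃ C : ℝ, 0 ≤ C ∧ ∀ ℓ c x k : ℕ, k * k ≤ ℓ + 2 * k →
    (((ℓ + 2) * (c + 2) * (x + 2) : ℕ) : ℝ) ^ (20 * (k + 1)) ≤ C * 2 ^ (ℓ + c + x) := by
  -- The constant is chosen generously: its logarithm 10^10 exceeds the additive terms, mainly 3 ·
  -- 2400 · 614400.
  refine ⟨Real.exp 10 ^ 1000000000, by positivity, fun ℓ c x k hk => ?_⟩
  have hk' : (k : ℝ) * k ≤ ℓ + 2 * k := by exact_mod_cast hk
  -- The squares are later multiplied by 800 · 3 = 2400, so the slope 1/9600 leaves a quarter of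
  -- each of ℓ, c and x.
  have hlog : ∀ m : ℕ, Real.log (m + 2) ^ 2 ≤ (m + 2) / 9600 + 614400 := by
    intro m
    have := log_sq_le (y := m + 2) (δ := 1 / 9600) (by linarith [m.cast_nonneg (α := ℝ)])
      (by norm_num)
    linarith
  set a := Real.log (ℓ + 2) with ha
  set b := Real.log (c + 2) with hb
  set d := Real.log (x + 2) with hd
  have h1 := hlog ℓ
  have h2 := hlog c
  have h3 := hlog x
  rw [← ha] at h1
  rw [← hb] at h2
  rw [← hd] at h3
  have hexp : (((ℓ + 2) * (c + 2) * (x + 2) : ℕ) : ℝ) = Real.exp (a + b + d) := by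
    rw [Real.exp_add, Real.exp_add, Real.exp_log (by positivity), Real.exp_log (by positivity),
      Real.exp_log (by positivity)]
    push_cast
    ring
  have h2exp : (2 : ℝ) ^ (ℓ + c + x) = Real.exp (((ℓ + c + x : ℕ) : ℝ) * Real.log 2) := by
    rw [Real.exp_nat_mul, Real.exp_log (by norm_num)]
  rw [hexp, h2exp, ← Real.exp_nat_mul, ← Real.exp_nat_mul, ← Real.exp_add, Real.exp_le_exp]
  have hlog2 := Real.log_two_gt_d9
  have hs : (a + b + d) ^ 2 ≤ 3 * (a ^ 2 + b ^ 2 + d ^ 2) := by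
    nlinarith [sq_nonneg (a - b), sq_nonneg (b - d), sq_nonneg (a - d)]
  have hkk : ((k : ℝ) + 1) ^ 2 ≤ 2 * ℓ + 10 := by nlinarith [sq_nonneg ((k : ℝ) - 3)]
  -- The weights are such that the first summand contributes about ℓ/4. Together with the quarter
  -- from the logarithms this makes ℓ/2, below ℓ · log 2.
  have hamgm : 20 * ((k : ℝ) + 1) * (a + b + d) ≤ ((k : ℝ) + 1) ^ 2 / 8 + 800 * (a + b + d) ^ 2 := by
    nlinarith [sq_nonneg ((k : ℝ) + 1 - 80 * (a + b + d))]
  have hpos : ((ℓ + c + x : ℕ) : ℝ) / 2 ≤ ((ℓ + c + x : ℕ) : ℝ) * Real.log 2 := by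
    rw [div_eq_mul_inv]
    gcongr
    linarith
  have hc := c.cast_nonneg (α := ℝ)
  have hx := x.cast_nonneg (α := ℝ)
  push_cast at hpos ⊢
  linarith

/-- With size m + 1 and m ≥ 1, the size is at most 2m ≤ 2 log n / log 2, and 2 / log 2 < 3. -/
theorem size_le_log {n : ℕ} (hn : 2 ≤ n) : (Nat.size n : ℝ) ≤ 3 * Real.log n := by
  have h2 : 2 ≤ Nat.size n := Nat.lt_size.2 (by simpa using hn)
  obtain ⟨m, hm⟩ : ∃ m, Nat.size n = m + 1 := ⟨Nat.size n - 1, by omega⟩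
  have h1 : 2 ^ m ≤ n := Nat.lt_size.1 (by omega)
  have h3 : (m : ℝ) * Real.log 2 ≤ Real.log n := by
    rw [← Real.log_pow]
    exact Real.log_le_log (by positivity) (by exact_mod_cast h1)
  have h4 : (1 : ℝ) ≤ m := by exact_mod_cast (show 1 ≤ m by omega)
  rw [hm]
  push_cast
  nlinarith [Real.log_two_gt_d9]

theorem two_pow_size_le {m : ℕ} (hm : 1 ≤ m) : 2 ^ Nat.size m ≤ 2 * m := by
  obtain ⟨d, hd⟩ : ∃ d, Nat.size m = d + 1 :=
    ⟨Nat.size m - 1, by have := Nat.lt_size.2 (show 2 ^ 0 ≤ m by simpa using hm); omega⟩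
  have h1 : 2 ^ d ≤ m := Nat.lt_size.1 (by omega)
  rw [hd, pow_succ]
  omega

end RAM

/-! ### The main theorem. -/

theorem mainTheorem9 :
    ∃ K : ℕ, ∀ (C : GraphClass) (t : ℕ → ℕ → ℕ), C.IsHereditary →
      (∀ ℓ ℓ' n n' : ℕ, ℓ ≤ ℓ' → n ≤ n' → t ℓ n ≤ t ℓ' n') →
      (∃ p : RAM.Prog, ComputesMaxWeightIndepSet p C t) →
      ∃ q : RAM.Prog, ComputesMaxWeightColorable q C fun c ℓ n =>
        (K : ℝ) * 2 ^ (ℓ + c) * (c : ℝ) ^ ℓ * (ℓ : ℝ) ^ ((K : ℝ) * Real.log ℓ) *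
          (Real.log n) ^ 2 * (t ℓ n : ℝ) := by
  obtain ⟨A, hA0, hA⟩ := RAM.exists_pow_le_two_pow
  -- The constant is 18 = 3 · (2 · 3): `size_le_log` is used twice and `two_pow_size_le` once.
  refine ⟨⌈18 * A⌉₊, fun C t _ ht ⟨p, hp⟩ => ⟨RAM.colorableProg p, fun n G w ℓ c hG => ?_⟩⟩
  rcases Nat.eq_zero_or_pos n with hn | hn
  · obtain ⟨S, k, hS, hmax⟩ := RAM.outputs_colorableProg_of_eq_zero (G := G) (w := w) (p := p)
      (ℓ := ℓ) (c := c) (.inl hn)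
    exact ⟨S, k, hS, hmax, fun h => absurd h (by omega)⟩
  rcases Nat.eq_zero_or_pos ℓ with hℓ | hℓ
  · obtain ⟨S, k, hS, hmax⟩ := RAM.outputs_colorableProg_of_eq_zero (G := G) (w := w) (p := p)
      (ℓ := ℓ) (c := c) (.inr (.inl hℓ))
    exact ⟨S, k, hS, hmax, fun _ h => absurd h (by omega)⟩
  rcases Nat.eq_zero_or_pos c with hc | hc
  · obtain ⟨S, k, hS, hmax⟩ := RAM.outputs_colorableProg_of_eq_zero (G := G) (w := w) (p := p)
      (ℓ := ℓ) (c := c) (.inr (.inr hc))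
    exact ⟨S, k, hS, hmax, fun _ _ h => absurd h (by omega)⟩
  obtain ⟨S, T, k, f, hS, hmax, hk, hkℓ, B, N, hB, hN, hf, hT⟩ :=
    RAM.outputs_colorableProg (w := w) hn hℓ hc
      (RAM.solves_of_computesMaxWeightIndepSet ht hp hG hn ℓ)
  refine ⟨S, T, hS, hmax, fun hn2 _ _ => ?_⟩
  -- From `n ≥ 2` and `n ≤ t + 1` it follows that `t ≥ 1`, hence `t + 1 ≤ 2 * t`.
  have hτ : n ≤ 2 * t ℓ n := by
    have h1 := RAM.le_succ_of_computesMaxWeightIndepSet hp hG hn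
    have h2 := ht 1 ℓ n n hℓ le_rfl
    omega
  have hbound := hT.trans
    (RAM.tableTime_add_searchTime_le hn2 hℓ hc hτ hk hkℓ hB hN hf rfl rfl)
  have hZ := hA ℓ c (Nat.size (Nat.size n)) k hk
  have hσ := RAM.size_le_log hn2
  have hσ1 : 1 ≤ Nat.size n := Nat.lt_size.2 (by rwa [pow_zero])
  -- The part of the exponential bound that comes from log log n turns into the second factor log n.
  have h2σ : (2 : ℝ) ^ Nat.size (Nat.size n) ≤ 2 * Nat.size n := by
    exact_mod_cast RAM.two_pow_size_le hσ1
  have hrpow : (1 : ℝ) ≤ (ℓ : ℝ) ^ ((⌈18 * A⌉₊ : ℝ) * Real.log ℓ) := by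
    have h1 : (1 : ℝ) ≤ ℓ := by exact_mod_cast hℓ
    exact Real.one_le_rpow h1 (mul_nonneg (Nat.cast_nonneg _) (Real.log_nonneg h1))
  have hlog : 0 ≤ Real.log n := Real.log_natCast_nonneg n
  beta_reduce
  calc (T : ℝ) ≤ (Nat.size n : ℝ) * (c : ℝ) ^ ℓ *
        (((ℓ + 2) * (c + 2) * (Nat.size (Nat.size n) + 2) : ℕ) : ℝ) ^ (20 * (k + 1)) * t ℓ n := by
        exact_mod_cast hbound
    _ ≤ (Nat.size n : ℝ) * (c : ℝ) ^ ℓ * (A * 2 ^ (ℓ + c + Nat.size (Nat.size n))) * t ℓ n := by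
        gcongr
    _ = A * 2 ^ (ℓ + c) * (c : ℝ) ^ ℓ * (Nat.size n * 2 ^ Nat.size (Nat.size n)) * t ℓ n := by
        rw [pow_add]
        ring
    _ ≤ A * 2 ^ (ℓ + c) * (c : ℝ) ^ ℓ * (3 * Real.log n * (2 * (3 * Real.log n))) * t ℓ n := by
        gcongr
        exact h2σ.trans (by gcongr)
    _ = 18 * A * 2 ^ (ℓ + c) * (c : ℝ) ^ ℓ * 1 * Real.log n ^ 2 * t ℓ n := by ring
    _ ≤ _ := by
        gcongr
        exact Nat.le_ceil _
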